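/- Theorem (quasi-Hamiltonian reduction in the exact case). Setting. Let $\mathfrak d$ be a finite-dimensional real Lie algebra with an invariant non-degenerate symmetric pairing, acting by $\rho$ on a manifold $N$ so that all stabilizers are coisotropic, and let $\mathfrak h\subset\mathfrak d$ be a Lagrangian subalgebra ($\mathfrak h^\perp=\mathfrak h$). Then $\mathfrak d\times N$ is a Courant algebroid with anchor $\mathbf a(\xi,n)=\rho(\xi)_n$ and with the bracket that extends the Lie bracket of constant sections, and $\mathfrak h\times N$ is a Dirac structure in it. Let $M$ be a manifold and $\mathbb TM=TM\oplus T^*M$ its standard Courant algebroid. A morphism of Manin pairs $R:(\mathbb TM,TM)\dasharrow(\mathfrak d,\mathfrak h)\times N$ over a smooth map $\mu:M\to N$ is a Dirac structure (an involutive Lagrangian subbundle) $R\subset(\mathfrak d\times N)\times\overline{\mathbb TM}$ with support on the graph of $\mu$, where the bar negates the metric, such that (m1) $(\xi;X)\in R$ with $X\in TM$ implies $\xi\in\mathfrak h$, and (m2) $(0;X)\in R$ with $X\in TM$ implies $X=0$. It is exact if $0\to\mathrm{ann}(T\,\mathrm{gr}(\mu))\xrightarrow{\mathbf a^*}R\xrightarrow{\mathbf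 a}T\,\mathrm{gr}(\mu)\to0$ is an exact sequence. The subalgebra $\mathfrak h$ acts on $M$ by the vector fields $\rho_R(\xi)$ determined by $(\xi;\rho_R(\xi))\in R$. Reductive data. Let $\mathfrak c\subset\mathfrak d$ be a coisotropic subalgebra ($\mathfrak c^\perp\subseteq\mathfrak c$) and $i_N:S\hookrightarrow N$ a $\mathfrak c$-invariant (possibly only injectively immersed) submanifold such that the $\mathfrak c^\perp$-orbits in $S$ form a regular foliation with quotient $q_N:S\to N_{\mathfrak c,S}$, the graph of $\mu$ intersects $S\times M$ cleanly, and the $\mathfrak h\cap\mathfrak c^\perp$-orbits in $\mu^{-1}(S)$ form a regular foliation with quotient $q_M:\mu^{-1}(S)\to M_{\mathfrak c,S}$. (The orbits form a regular foliation if they are the leaves of a foliation whose leaf space is a manifold such that the quotient map is a surjective submersion.) Let $i_M:\mu^{-1}(S)\hookrightarrow M$ be the inclusion, $\mathfrak d_{\mathfrak c}=\mathfrak c/\mathfrak c^\perp$ with the induced pairing, $\mathfrak h_{\mathfrak c}$ the image of $\mathfrak h\cap\mathfrak c$ in $\mathfrak d_{\mathfrak c}$, and $R_{\mathfrak c}=\{(\xi,\xi+\mathfrak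 c^\perp):\xi\in\mathfrak c\}$ as a relation $\mathfrak d\dasharrow\mathfrak d_{\mathfrak c}$. For a smooth map $f$ let $R_f$ be the relation $v+f^*\beta\sim f_*v+\beta$ between the standard Courant algebroids. Put $$R_{\mathfrak c,S}=R_2\circ R\circ R_1^\top,\qquad R_2=R_{\mathfrak c}\times\big(\mathrm{gr}(q_N)\circ\mathrm{gr}(i_N)^\top\big),\qquad R_1=R_{q_M}\circ R_{i_M}^\top .$$ Claim. Assume in addition that $\mathfrak c$ acts transitively on $S$, that is $\rho(\mathfrak c)_s=T_sS$ for all $s\in S$, and that $R$ is an exact morphism of Manin pairs. Then the action of $\mathfrak c$ on $S$ induces an action of $\mathfrak d_{\mathfrak c}$ on $N_{\mathfrak c,S}$ with coisotropic stabilizers, $\mathfrak h_{\mathfrak c}\subset\mathfrak d_{\mathfrak c}$ is a Lagrangian subalgebra, $\mu$ induces a smooth map $\mu_{\mathfrak c,S}:M_{\mathfrak c,S}\to N_{\mathfrak c,S}$, and $$R_{\mathfrak c,S}:(\mathbb TM_{\mathfrak c,S},TM_{\mathfrak c,S})\dasharrow(\mathfrak d_{\mathfrak c},\mathfrak h_{\mathfrak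 c})\times N_{\mathfrak c,S}$$ is an exact morphism of Manin pairs over $\mu_{\mathfrak c,S}$. In particular, if $\mathfrak c$ is Lagrangian (so that $\mathfrak d_{\mathfrak c}=0$), then $M_{\mathfrak c,S}=\mu^{-1}(S)/(\mathfrak h\cap\mathfrak c)$ is symplectic: $R_{\mathfrak c,S}$ is the graph $\{(0;X+\iota_X\omega)\}$ of a symplectic form $\omega$ on $M_{\mathfrak c,S}$. -/

import Mathlib

open scoped Manifold ContDiff
open Bundle

/-! ### Quadratic Lie algebras and reduction by a coisotropic subalgebra -/

section Algebra

variable {𝔡 : Type*} [LieRing 𝔡] [LieAlgebra ℝ 𝔡]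

/-- An invariant non-degenerate symmetric pairing on a real Lie algebra. -/
structure QuadraticPairing (𝔡 : Type*) [LieRing 𝔡] [LieAlgebra ℝ 𝔡] where
  form : LinearMap.BilinForm ℝ 𝔡
  symm : ∀ x y, form x y = form y x
  nondegenerate : form.Nondegenerate
  invariant : form.lieInvariant 𝔡

namespace QuadraticPairing

variable (Q : QuadraticPairing 𝔡)

/-- `𝔠` is coisotropic: `𝔠^⊥ ⊆ 𝔠`. -/
def IsCoisotropic (𝔠 : LieSubalgebra ℝ 𝔡) : Prop :=
  Q.form.orthogonal 𝔠.toSubmodule ≤ 𝔠.toSubmodule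

/-- `𝔥` is Lagrangian: `𝔥^⊥ = 𝔥`. -/
def IsLagrangian (𝔥 : LieSubalgebra ℝ 𝔡) : Prop :=
  Q.form.orthogonal 𝔥.toSubmodule = 𝔥.toSubmodule

/-- `𝔠 ∩ 𝔠^⊥` as an ideal of `𝔠`; it is `𝔠^⊥` when `𝔠` is coisotropic. -/
def perpIdeal (𝔠 : LieSubalgebra ℝ 𝔡) : LieIdeal ℝ 𝔠 where
  carrier := {x | ∀ y : 𝔠, Q.form (y : 𝔡) (x : 𝔡) = 0}
  add_mem' := by
    intro a b ha hb y
    simp [ha y, hb y]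
  zero_mem' := by
    intro y
    simp
  smul_mem' := by
    intro r a ha y
    simp [ha y]
  lie_mem := by
    intro x m hm y
    have h1 := Q.invariant (x : 𝔡) (y : 𝔡) (m : 𝔡)
    have h2 : Q.form ⁅(x : 𝔡), (y : 𝔡)⁆ (m : 𝔡) = 0 := by
      simpa using hm ⁅x, y⁆
    rw [h2] at h1
    simpa using h1.symm

/-- The reduced Lie algebra `𝔡_𝔠 = 𝔠 / 𝔠^⊥`. -/
abbrev Reduced (𝔠 : LieSubalgebra ℝ 𝔡) : Type _ := 𝔠 ⧸ Q.perpIdeal 𝔠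

/-- The projection `𝔠 → 𝔠 / 𝔠^⊥`. -/
def proj (𝔠 : LieSubalgebra ℝ 𝔡) : 𝔠 →ₗ⁅ℝ⁆ Q.Reduced 𝔠 :=
  { (Q.perpIdeal 𝔠).toSubmodule.mkQ with
    map_lie' := fun {_ _} => rfl }

/-- The pairing on `𝔠 / 𝔠^⊥` induced by the pairing on `𝔡`. -/
def reducedForm (𝔠 : LieSubalgebra ℝ 𝔡) : LinearMap.BilinForm ℝ (Q.Reduced 𝔠) :=
  LinearMap.flip ((Q.perpIdeal 𝔠).toSubmodule.liftQ
    (LinearMap.flip ((Q.perpIdeal 𝔠).toSubmodule.liftQ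
      (Q.form.compl₁₂ 𝔠.toSubmodule.subtype 𝔠.toSubmodule.subtype)
      (by
        intro x hx
        ext y
        exact (Q.symm (x : 𝔡) (y : 𝔡)).trans (hx y))))
    (by
      intro x hx
      ext y
      obtain ⟨y, rfl⟩ := Submodule.mkQ_surjective _ y
      exact hx y))

lemma reducedForm_proj (𝔠 : LieSubalgebra ℝ 𝔡) (x y : 𝔠) :
    Q.reducedForm 𝔠 (Q.proj 𝔠 x) (Q.proj 𝔠 y) = Q.form x y := rfl

lemma proj_surjective (𝔠 : LieSubalgebra ℝ 𝔡) : Function.Surjective (Q.proj 𝔠) :=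
  Submodule.mkQ_surjective _

lemma proj_eq_zero (𝔠 : LieSubalgebra ℝ 𝔡) (x : 𝔠)
    (h : ∀ y : 𝔠, Q.form (y : 𝔡) (x : 𝔡) = 0) : Q.proj 𝔠 x = 0 :=
  (Submodule.Quotient.mk_eq_zero _).2 h

/-- The quadratic Lie algebra `𝔡_𝔠 = 𝔠 / 𝔠^⊥`. -/
def reduce (𝔠 : LieSubalgebra ℝ 𝔡) : QuadraticPairing (Q.Reduced 𝔠) where
  form := Q.reducedForm 𝔠
  symm := by
    intro x y
    obtain ⟨x, rfl⟩ := Q.proj_surjective 𝔠 x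
    obtain ⟨y, rfl⟩ := Q.proj_surjective 𝔠 y
    simp only [reducedForm_proj]
    exact Q.symm _ _
  nondegenerate := by
    constructor
    · intro x hx
      obtain ⟨x, rfl⟩ := Q.proj_surjective 𝔠 x
      exact Q.proj_eq_zero 𝔠 x fun y => (Q.symm _ _).trans (hx (Q.proj 𝔠 y))
    · intro x hx
      obtain ⟨x, rfl⟩ := Q.proj_surjective 𝔠 x
      exact Q.proj_eq_zero 𝔠 x fun y => hx (Q.proj 𝔠 y)
  invariant := by
    intro x y z
    obtain ⟨x, rfl⟩ := Q.proj_surjective 𝔠 x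
    obtain ⟨y, rfl⟩ := Q.proj_surjective 𝔠 y
    obtain ⟨z, rfl⟩ := Q.proj_surjective 𝔠 z
    rw [← LieHom.map_lie, ← LieHom.map_lie, reducedForm_proj, reducedForm_proj]
    exact Q.invariant (x : 𝔡) (y : 𝔡) (z : 𝔡)

/-- `𝔥_𝔠`, the image of `𝔥 ∩ 𝔠` in `𝔡_𝔠 = 𝔠 / 𝔠^⊥`. -/
def reduceSubalgebra (𝔠 𝔥 : LieSubalgebra ℝ 𝔡) : LieSubalgebra ℝ (Q.Reduced 𝔠) :=
  (𝔥.comap 𝔠.incl).map (Q.proj 𝔠)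

/-- The relation `R_𝔠 : 𝔡 ⇢ 𝔡_𝔠`, with `ξ ∼ ξ + 𝔠^⊥` for `ξ ∈ 𝔠`. -/
def reductionRel (𝔠 : LieSubalgebra ℝ 𝔡) : SetRel 𝔡 (Q.Reduced 𝔠) :=
  {p | ∃ ξ : 𝔠, p = ((ξ : 𝔡), Q.proj 𝔠 ξ)}

end QuadraticPairing

end Algebra

/-! ### Vector fields, forms, Lie algebra actions, orbits -/

section Manifolds

variable {E : Type*} [NormedAddCommGroup E] [NormedSpace ℝ E]
  {M : Type*} [TopologicalSpace M] [ChartedSpace E M]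

/-- The derivative of the function `f` at `z` in the direction of the tangent vector `v`. -/
noncomputable def dirDeriv {F H : Type*} [NormedAddCommGroup F] [NormedSpace ℝ F]
    [TopologicalSpace H] (I : ModelWithCorners ℝ F H)
    {Z : Type*} [TopologicalSpace Z] [ChartedSpace H Z]
    (f : Z → ℝ) (z : Z) (v : TangentSpace I z) : ℝ :=
  mfderiv I 𝓘(ℝ, ℝ) f z v

/-- A smooth vector field on `M`. -/
def IsSmoothVectorField [IsManifold 𝓘(ℝ, E) ∞ M] (X : Π m : M, TangentSpace 𝓘(ℝ, E) m) : Prop :=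
  ContMDiff 𝓘(ℝ, E) 𝓘(ℝ, E).tangent ∞ (fun m => (⟨m, X m⟩ : TangentBundle 𝓘(ℝ, E) M))

/-- A symplectic form on `M`: a smooth, alternating, non-degenerate, closed 2-form. -/
structure IsSymplecticForm [IsManifold 𝓘(ℝ, E) ∞ M]
    (σ : Π m : M, TangentSpace 𝓘(ℝ, E) m →L[ℝ] TangentSpace 𝓘(ℝ, E) m →L[ℝ] ℝ) : Prop where
  smooth : ∀ X Y : Π m : M, TangentSpace 𝓘(ℝ, E) m,
    IsSmoothVectorField X → IsSmoothVectorField Y →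
      ContMDiff 𝓘(ℝ, E) 𝓘(ℝ, ℝ) ∞ (fun m => σ m (X m) (Y m))
  alternating : ∀ m v, σ m v v = 0
  nondegenerate : ∀ m v, (∀ w, σ m v w = 0) → v = 0
  closed : ∀ X Y Z : Π m : M, TangentSpace 𝓘(ℝ, E) m,
    IsSmoothVectorField X → IsSmoothVectorField Y → IsSmoothVectorField Z → ∀ m,
      dirDeriv 𝓘(ℝ, E) (fun r => σ r (Y r) (Z r)) m (X m)
      + dirDeriv 𝓘(ℝ, E) (fun r => σ r (Z r) (X r)) m (Y m)
      + dirDeriv 𝓘(ℝ, E) (fun r => σ r (X r) (Y r)) m (Z m)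
      - σ m (VectorField.mlieBracket 𝓘(ℝ, E) X Y m) (Z m)
      - σ m (VectorField.mlieBracket 𝓘(ℝ, E) Y Z m) (X m)
      - σ m (VectorField.mlieBracket 𝓘(ℝ, E) Z X m) (Y m) = 0

/-- `ρ` is an action of the Lie algebra `𝔡` on `N`: a homomorphism of Lie algebras from `𝔡` to the
smooth vector fields on `N`. -/
structure IsLieAlgebraAction {𝔡 : Type*} [LieRing 𝔡] [LieAlgebra ℝ 𝔡] [IsManifold 𝓘(ℝ, E) ∞ M]
    (ρ : 𝔡 →ₗ[ℝ] Π m : M, TangentSpace 𝓘(ℝ, E) m) : Prop where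
  smooth : ∀ ξ, IsSmoothVectorField (ρ ξ)
  map_lie : ∀ ξ η, ρ ⁅ξ, η⁆ = VectorField.mlieBracket 𝓘(ℝ, E) (ρ ξ) (ρ η)

/-- All stabilizers of the action `ρ` are coisotropic: `(𝔡_m)^⊥ ⊆ 𝔡_m`. -/
def HasCoisotropicStabilizers {𝔡 : Type*} [LieRing 𝔡] [LieAlgebra ℝ 𝔡] (Q : QuadraticPairing 𝔡)
    (ρ : 𝔡 →ₗ[ℝ] Π m : M, TangentSpace 𝓘(ℝ, E) m) : Prop :=
  ∀ (m : M) (ζ : 𝔡), (∀ ξ, ρ ξ m = 0 → Q.form ξ ζ = 0) → ρ ζ m = 0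

/-- The data `(𝔡, 𝔥) × N`: an action `ρ` of the quadratic Lie algebra `𝔡` on `N` with coisotropic
stabilizers (so that `𝔡 × N` is an action Courant algebroid) and a Lagrangian subalgebra `𝔥` of `𝔡`
(so that `𝔥 × N` is a Dirac structure in it). -/
structure IsActionManinPair {𝔡 : Type*} [LieRing 𝔡] [LieAlgebra ℝ 𝔡] [IsManifold 𝓘(ℝ, E) ∞ M]
    (Q : QuadraticPairing 𝔡) (ρ : 𝔡 →ₗ[ℝ] Π m : M, TangentSpace 𝓘(ℝ, E) m)
    (𝔥 : LieSubalgebra ℝ 𝔡) : Prop where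
  action : IsLieAlgebraAction ρ
  coisotropic : HasCoisotropicStabilizers Q ρ
  lagrangian : Q.IsLagrangian 𝔥

/-- Two points lie in the same orbit of the set `V` of vector fields if they can be joined by
finitely many segments of integral curves of elements of `V`. -/
def SameOrbit (V : Set (Π m : M, TangentSpace 𝓘(ℝ, E) m)) : M → M → Prop :=
  Relation.EqvGen fun m m' => ∃ X ∈ V, ∃ (γ : ℝ → M) (a b : ℝ), a ≤ b ∧
    IsMIntegralCurveOn γ X (Set.Icc a b) ∧ γ a = m ∧ γ b = m'

/-- The orbits of `V` (the vector fields of a Lie algebra action) form a regular foliation of `M`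
with quotient `q : M → Y`: `q` is a surjective submersion, its fibres are exactly the orbits, and
the tangent space at `m` to the leaf through `m` consists of the values at `m` of elements of `V`. -/
structure IsRegularFoliationQuotient (V : Set (Π m : M, TangentSpace 𝓘(ℝ, E) m))
    {F : Type*} [NormedAddCommGroup F] [NormedSpace ℝ F]
    {Y : Type*} [TopologicalSpace Y] [ChartedSpace F Y] (q : M → Y) : Prop where
  smooth : ContMDiff 𝓘(ℝ, E) 𝓘(ℝ, F) ∞ q
  surjective : Function.Surjective q
  submersion : ∀ m, Function.Surjective (mfderiv 𝓘(ℝ, E) 𝓘(ℝ, F) q m)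
  fibres : ∀ m m', q m = q m' ↔ SameOrbit V m m'
  tangent : ∀ m v, mfderiv 𝓘(ℝ, E) 𝓘(ℝ, F) q m v = 0 ↔ ∃ X ∈ V, X m = v

end Manifolds

/-! ### The Courant algebroid `(𝔡 × N) × \overline{𝕋M}` and Courant morphisms `𝕋M ⇢ 𝔡 × N` -/

/-- The fibre of `𝕋M = TM ⊕ T*M` at `m`. -/
abbrev GenTangent (E : Type*) [NormedAddCommGroup E] [NormedSpace ℝ E]
    {M : Type*} [TopologicalSpace M] [ChartedSpace E M] (m : M) : Type _ :=
  TangentSpace 𝓘(ℝ, E) m × (TangentSpace 𝓘(ℝ, E) m →L[ℝ] ℝ)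

/-- The total space of `𝕋M = TM ⊕ T*M`. -/
abbrev GenTangentBundle (E : Type*) [NormedAddCommGroup E] [NormedSpace ℝ E]
    (M : Type*) [TopologicalSpace M] [ChartedSpace E M] : Type _ :=
  Σ m : M, GenTangent E m

/-- The fibre of `(𝔡 × N) × \overline{𝕋M}` at `(n, m)`, with elements `(ξ, X, α)`. -/
abbrev CourantFibre (𝔡 : Type*) (E : Type*) [NormedAddCommGroup E] [NormedSpace ℝ E]
    {M : Type*} [TopologicalSpace M] [ChartedSpace E M] (m : M) : Type _ :=
  𝔡 × GenTangent E m

section Courant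

variable {𝔡 : Type*} [LieRing 𝔡] [LieAlgebra ℝ 𝔡]
  {E : Type*} [NormedAddCommGroup E] [NormedSpace ℝ E]
  {M : Type*} [TopologicalSpace M] [ChartedSpace E M]
  {F : Type*} [NormedAddCommGroup F] [NormedSpace ℝ F]
  {N : Type*} [TopologicalSpace N] [ChartedSpace F N]

/-- The fibre metric of `(𝔡 × N) × \overline{𝕋M}`. -/
noncomputable def courantPairing (Q : QuadraticPairing 𝔡) {m : M} (z w : CourantFibre 𝔡 E m) : ℝ :=
  Q.form z.1 w.1 - (z.2.2 w.2.1 + w.2.2 z.2.1)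

/-- The anchor of `(𝔡 × N) × \overline{𝕋M}` at `(n, m)`. -/
noncomputable def courantAnchor (ρ : 𝔡 →ₗ[ℝ] Π n : N, TangentSpace 𝓘(ℝ, F) n) (n : N) (m : M)
    (z : CourantFibre 𝔡 E m) : TangentSpace (𝓘(ℝ, F).prod 𝓘(ℝ, E)) (n, m) :=
  (ρ z.1 n, z.2.1)

/-- A smooth section `z ↦ (ξ z, X z, α z)` of the pull-back of `𝔡 × 𝕋M` along `f : Z → M`. -/
structure IsSmoothSection [IsManifold 𝓘(ℝ, E) ∞ M] {G H : Type*} [NormedAddCommGroup G]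
    [NormedSpace ℝ G] [TopologicalSpace H] (I : ModelWithCorners ℝ G H)
    {Z : Type*} [TopologicalSpace Z] [ChartedSpace H Z]
    (f : Z → M) (e : Π z : Z, CourantFibre 𝔡 E (f z)) : Prop where
  algebra : ∀ ℓ : Module.Dual ℝ 𝔡, ContMDiff I 𝓘(ℝ, ℝ) ∞ (fun z => ℓ (e z).1)
  vector : ContMDiff I 𝓘(ℝ, E).tangent ∞
    (fun z => (⟨f z, (e z).2.1⟩ : TangentBundle 𝓘(ℝ, E) M))
  covector : ContMDiff I (𝓘(ℝ, E).prod 𝓘(ℝ, E →L[ℝ] ℝ)) ∞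
    (fun z => TotalSpace.mk' (E →L[ℝ] ℝ)
      (E := fun m : M => TangentSpace 𝓘(ℝ, E) m →L[ℝ] ℝ) (f z) (e z).2.2)

/-- The function `⟨⟦e₁, e₂⟧, e₃⟩` on `N × M`, for sections `eᵢ = (ξᵢ, Xᵢ, αᵢ)` of the Courant
algebroid `(𝔡 × N) × \overline{𝕋M}`; as the metric is non-degenerate, it determines the Courant
bracket. With `Aᵢ = a(eᵢ)`, a vector field on `N × M`, and with `αᵢ` also standing for the 1-form on
`N × M` that vanishes on `TN`, the terms that involve `Q` are the bracket
`⟦ξ₁, ξ₂⟧ = [ξ₁, ξ₂] + L_{A₁} ξ₂ - L_{A₂} ξ₁ + a^*⟨dξ₁, ξ₂⟩` of an action Courant algebroid paired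
with `ξ₃`, and the remaining ones are the bracket `[A₁, A₂] + L_{A₁} α₂ - ι_{A₂} dα₁` of a standard
Courant algebroid paired with `A₃ + α₃`, where `(L_A α)(C) = A(α(C)) - α([A, C])` and
`dα(B, C) = B(α(C)) - C(α(B)) - α([B, C])`. -/
noncomputable def courantBracketPairing (Q : QuadraticPairing 𝔡)
    (ρ : 𝔡 →ₗ[ℝ] Π n : N, TangentSpace 𝓘(ℝ, F) n)
    (e₁ e₂ e₃ : Π q : N × M, CourantFibre 𝔡 E q.2) (q : N × M) : ℝ :=
  let J := 𝓘(ℝ, F).prod 𝓘(ℝ, E)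
  let A₁ : Π r : N × M, TangentSpace J r := fun r => courantAnchor ρ r.1 r.2 (e₁ r)
  let A₂ : Π r : N × M, TangentSpace J r := fun r => courantAnchor ρ r.1 r.2 (e₂ r)
  let A₃ : Π r : N × M, TangentSpace J r := fun r => courantAnchor ρ r.1 r.2 (e₃ r)
  (Q.form ⁅(e₁ q).1, (e₂ q).1⁆ (e₃ q).1
    + dirDeriv J (fun r => Q.form (e₂ r).1 (e₃ q).1) q (A₁ q)
    - dirDeriv J (fun r => Q.form (e₁ r).1 (e₃ q).1) q (A₂ q)
    + dirDeriv J (fun r => Q.form (e₁ r).1 (e₂ q).1) q (A₃ q))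
  - ((e₃ q).2.2 (VectorField.mlieBracket J A₁ A₂ q).2
    + (dirDeriv J (fun r => (e₂ r).2.2 (e₃ r).2.1) q (A₁ q)
      - (e₂ q).2.2 (VectorField.mlieBracket J A₁ A₃ q).2)
    - (dirDeriv J (fun r => (e₁ r).2.2 (e₃ r).2.1) q (A₂ q)
      - dirDeriv J (fun r => (e₁ r).2.2 (e₂ r).2.1) q (A₃ q)
      - (e₁ q).2.2 (VectorField.mlieBracket J A₂ A₃ q).2))

/-- The family `L m` of subspaces of the fibres of `(𝔡 × N) × \overline{𝕋M}` over the points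
`(μ m, m)` is a Dirac structure with support on the graph of `μ : M → N`. -/
structure IsDiracOnGraph [IsManifold 𝓘(ℝ, E) ∞ M] (Q : QuadraticPairing 𝔡)
    (ρ : 𝔡 →ₗ[ℝ] Π n : N, TangentSpace 𝓘(ℝ, F) n) (μ : M → N)
    (L : Π m : M, Submodule ℝ (CourantFibre 𝔡 E m)) : Prop where
  constant_rank : ∃ k : ℕ, ∀ m, Module.finrank ℝ (L m) = k
  /-- with constant rank, this says that `L` is a smooth subbundle -/
  smooth : ∀ m, ∀ z ∈ L m, ∃ e : Π m : M, CourantFibre 𝔡 E m,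
    IsSmoothSection 𝓘(ℝ, E) id e ∧ (∀ m', e m' ∈ L m') ∧ e m = z
  lagrangian : ∀ m z, z ∈ L m ↔ ∀ w ∈ L m, courantPairing Q z w = 0
  /-- the bracket of two sections that restrict to sections of `L` again restricts to a section of
  `L`, which is the orthogonal of `L` -/
  involutive : ∀ e₁ e₂ e₃ : Π q : N × M, CourantFibre 𝔡 E q.2,
    IsSmoothSection (𝓘(ℝ, F).prod 𝓘(ℝ, E)) Prod.snd e₁ →
    IsSmoothSection (𝓘(ℝ, F).prod 𝓘(ℝ, E)) Prod.snd e₂ →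
    IsSmoothSection (𝓘(ℝ, F).prod 𝓘(ℝ, E)) Prod.snd e₃ →
    (∀ m, e₁ (μ m, m) ∈ L m) → (∀ m, e₂ (μ m, m) ∈ L m) → (∀ m, e₃ (μ m, m) ∈ L m) →
    ∀ m, courantBracketPairing Q ρ e₁ e₂ e₃ (μ m, m) = 0

/-- `L`, with support on the graph of the smooth map `μ`, is a morphism of Manin pairs
`(𝕋M, TM) ⇢ (𝔡 × N, 𝔥 × N)`. -/
structure IsManinPairMorphism [IsManifold 𝓘(ℝ, E) ∞ M] (Q : QuadraticPairing 𝔡)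
    (ρ : 𝔡 →ₗ[ℝ] Π n : N, TangentSpace 𝓘(ℝ, F) n) (𝔥 : LieSubalgebra ℝ 𝔡) (μ : M → N)
    (L : Π m : M, Submodule ℝ (CourantFibre 𝔡 E m)) : Prop where
  smooth_map : ContMDiff 𝓘(ℝ, E) 𝓘(ℝ, F) ∞ μ
  dirac : IsDiracOnGraph Q ρ μ L
  range_le : ∀ m ξ X, ((ξ, X, 0) : CourantFibre 𝔡 E m) ∈ L m → ξ ∈ 𝔥
  ker_inter : ∀ m X, ((0, X, 0) : CourantFibre 𝔡 E m) ∈ L m → X = 0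

/-- The covector `(lam, β)` at `(μ m, m)` annihilates the tangent space of the graph of `μ`. -/
def AnnihilatesGraph (μ : M → N) (m : M) (lam : TangentSpace 𝓘(ℝ, F) (μ m) →L[ℝ] ℝ)
    (β : TangentSpace 𝓘(ℝ, E) m →L[ℝ] ℝ) : Prop :=
  ∀ v : TangentSpace 𝓘(ℝ, E) m, lam (mfderiv 𝓘(ℝ, E) 𝓘(ℝ, F) μ m v) + β v = 0

/-- `z = a^*(lam, β)` in the fibre of `(𝔡 × N) × \overline{𝕋M}` at `(n, m)`. -/
def IsCoanchor (Q : QuadraticPairing 𝔡) (ρ : 𝔡 →ₗ[ℝ] Π n : N, TangentSpace 𝓘(ℝ, F) n)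
    (n : N) (m : M) (lam : TangentSpace 𝓘(ℝ, F) n →L[ℝ] ℝ)
    (β : TangentSpace 𝓘(ℝ, E) m →L[ℝ] ℝ) (z : CourantFibre 𝔡 E m) : Prop :=
  ∀ w : CourantFibre 𝔡 E m, courantPairing Q z w =
    lam (courantAnchor ρ n m w).1 + β (courantAnchor ρ n m w).2

/-- The Dirac structure `L` with support on `S = gr(μ)` is exact: the sequence
`0 → ann(TS) → L → TS → 0` with maps `a^*` and `a` is exact at every point. -/
structure IsExactOnGraph (Q : QuadraticPairing 𝔡)
    (ρ : 𝔡 →ₗ[ℝ] Π n : N, TangentSpace 𝓘(ℝ, F) n) (μ : M → N)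
    (L : Π m : M, Submodule ℝ (CourantFibre 𝔡 E m)) : Prop where
  coanchor_injective : ∀ m lam β, AnnihilatesGraph μ m lam β →
    IsCoanchor Q ρ (μ m) m lam β (0 : CourantFibre 𝔡 E m) → lam = 0 ∧ β = 0
  exact_middle : ∀ m (z : CourantFibre 𝔡 E m),
    (z ∈ L m ∧ courantAnchor ρ (μ m) m z = 0) ↔
      ∃ lam β, AnnihilatesGraph μ m lam β ∧ IsCoanchor Q ρ (μ m) m lam β z
  anchor_mem : ∀ m, ∀ z ∈ L m, ρ z.1 (μ m) = mfderiv 𝓘(ℝ, E) 𝓘(ℝ, F) μ m z.2.1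
  anchor_surjective : ∀ m (v : TangentSpace 𝓘(ℝ, E) m), ∃ z ∈ L m,
    courantAnchor ρ (μ m) m z = (mfderiv 𝓘(ℝ, E) 𝓘(ℝ, F) μ m v, v)

/-- `L`, with support on the graph of `μ`, as a relation `𝕋M ⇢ 𝔡 × N`. -/
def graphRel (μ : M → N) (L : Π m : M, Submodule ℝ (CourantFibre 𝔡 E m)) :
    SetRel (GenTangentBundle E M) (𝔡 × N) :=
  {p | ∃ (m : M) (z : CourantFibre 𝔡 E m), z ∈ L m ∧ p = (⟨m, z.2⟩, (z.1, μ m))}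

/-- The standard lift `R_f = T gr(f) ⊕ ann(T gr(f)) : 𝕋M ⇢ 𝕋N` of a map `f : M → N`, that is
`v + f^*β ∼ f_* v + β`. -/
def standardLift (f : M → N) : SetRel (GenTangentBundle E M) (GenTangentBundle F N) :=
  {p | ∃ (m : M) (v : TangentSpace 𝓘(ℝ, E) m) (β : TangentSpace 𝓘(ℝ, F) (f m) →L[ℝ] ℝ),
    p = (⟨m, v, β.comp (mfderiv 𝓘(ℝ, E) 𝓘(ℝ, F) f m)⟩,
      ⟨f m, mfderiv 𝓘(ℝ, E) 𝓘(ℝ, F) f m v, β⟩)}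

end Courant

/-! ### Reductive data and the reduced relation -/

section Reduction

variable {𝔡 : Type*} [LieRing 𝔡] [LieAlgebra ℝ 𝔡]
  {E : Type*} [NormedAddCommGroup E] [NormedSpace ℝ E]
  {M : Type*} [TopologicalSpace M] [ChartedSpace E M]
  {F : Type*} [NormedAddCommGroup F] [NormedSpace ℝ F]
  {N : Type*} [TopologicalSpace N] [ChartedSpace F N]
  {E₁ : Type*} [NormedAddCommGroup E₁] [NormedSpace ℝ E₁]
  {P : Type*} [TopologicalSpace P] [ChartedSpace E₁ P]
  {F₁ : Type*} [NormedAddCommGroup F₁] [NormedSpace ℝ F₁]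
  {S : Type*} [TopologicalSpace S] [ChartedSpace F₁ S]
  {E₂ : Type*} [NormedAddCommGroup E₂] [NormedSpace ℝ E₂]
  {M' : Type*} [TopologicalSpace M'] [ChartedSpace E₂ M']
  {F₂ : Type*} [NormedAddCommGroup F₂] [NormedSpace ℝ F₂]
  {N' : Type*} [TopologicalSpace N'] [ChartedSpace F₂ N']

/-- The vector fields on the `𝔠`-invariant submanifold `iN : S → N` by which the elements of `𝔠^⊥`
act. -/
def perpVectorFields (Q : QuadraticPairing 𝔡) (ρ : 𝔡 →ₗ[ℝ] Π n : N, TangentSpace 𝓘(ℝ, F) n)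
    (𝔠 : LieSubalgebra ℝ 𝔡) (iN : S → N) : Set (Π s : S, TangentSpace 𝓘(ℝ, F₁) s) :=
  {X | ∃ ξ ∈ Q.form.orthogonal 𝔠.toSubmodule,
    ∀ s, mfderiv 𝓘(ℝ, F₁) 𝓘(ℝ, F) iN s (X s) = ρ ξ (iN s)}

/-- The vector fields on the submanifold `iM : P → M` by which the elements of `𝔥 ∩ 𝔠^⊥` act, where
`ξ ∈ 𝔥` acts on `M` by the vector field `ρ_R(ξ)` with `ρ_R(ξ) ∼_R ξ`. -/
def residualVectorFields (Q : QuadraticPairing 𝔡) (𝔥 𝔠 : LieSubalgebra ℝ 𝔡)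
    (L : Π m : M, Submodule ℝ (CourantFibre 𝔡 E m)) (iM : P → M) :
    Set (Π p : P, TangentSpace 𝓘(ℝ, E₁) p) :=
  {X | ∃ ξ ∈ 𝔥, ξ ∈ Q.form.orthogonal 𝔠.toSubmodule ∧
    ∀ p, ((ξ, mfderiv 𝓘(ℝ, E₁) 𝓘(ℝ, E) iM p (X p), 0) : CourantFibre 𝔡 E (iM p)) ∈ L (iM p)}

/-- The intersection of `gr(μ)` with `S × M` is clean, and is (the image of) the manifold `P`, where
`iN : S → N` is the inclusion of `S`. The points of the intersection are the pairs `(s, m)` with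
`iN s = μ m`; the point `p` of `P` stands for `(j p, iM p)`, so that `P` is also `μ⁻¹(S)`, included
in `M` by `iM`, and `j` is the restriction of `μ`. -/
structure IsCleanPreimage (μ : M → N) (iN : S → N) (iM : P → M) (j : P → S) : Prop where
  smooth_incl : ContMDiff 𝓘(ℝ, E₁) 𝓘(ℝ, E) ∞ iM
  smooth_restr : ContMDiff 𝓘(ℝ, E₁) 𝓘(ℝ, F₁) ∞ j
  embedding : Topology.IsEmbedding fun p => (j p, iM p)
  range_eq : ∀ s m, (∃ p, j p = s ∧ iM p = m) ↔ iN s = μ m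
  immersion : ∀ p u, mfderiv 𝓘(ℝ, E₁) 𝓘(ℝ, F₁) j p u = 0 →
    mfderiv 𝓘(ℝ, E₁) 𝓘(ℝ, E) iM p u = 0 → u = 0
  /-- the tangent space of the intersection is the intersection of the tangent spaces -/
  clean : ∀ p (v : TangentSpace 𝓘(ℝ, F₁) (j p)) (w : TangentSpace 𝓘(ℝ, E) (iM p)),
    (mfderiv 𝓘(ℝ, F₁) 𝓘(ℝ, F) iN (j p) v : F) = mfderiv 𝓘(ℝ, E) 𝓘(ℝ, F) μ (iM p) w →
    ∃ u, mfderiv 𝓘(ℝ, E₁) 𝓘(ℝ, F₁) j p u = v ∧ mfderiv 𝓘(ℝ, E₁) 𝓘(ℝ, E) iM p u = w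

/-- `(𝔠, S)` is reductive data for the morphism of Manin pairs `L` over `μ`. The submanifold `S` of
`N` is given by the injective immersion `iN`, and `μ⁻¹(S)` is the manifold `P`. -/
structure IsReductiveData (Q : QuadraticPairing 𝔡) (ρ : 𝔡 →ₗ[ℝ] Π n : N, TangentSpace 𝓘(ℝ, F) n)
    (𝔥 : LieSubalgebra ℝ 𝔡) (μ : M → N) (L : Π m : M, Submodule ℝ (CourantFibre 𝔡 E m))
    (𝔠 : LieSubalgebra ℝ 𝔡) (iN : S → N) (qN : S → N') (iM : P → M) (j : P → S)
    (qM : P → M') : Prop where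
  coisotropic : Q.IsCoisotropic 𝔠
  smooth_incl : ContMDiff 𝓘(ℝ, F₁) 𝓘(ℝ, F) ∞ iN
  injective_incl : Function.Injective iN
  immersion : ∀ s, Function.Injective (mfderiv 𝓘(ℝ, F₁) 𝓘(ℝ, F) iN s)
  invariant : ∀ ξ ∈ 𝔠, ∀ s, ∃ v, mfderiv 𝓘(ℝ, F₁) 𝓘(ℝ, F) iN s v = ρ ξ (iN s)
  quotient_N : IsRegularFoliationQuotient (E := F₁) (F := F₂)
    (perpVectorFields Q ρ 𝔠 iN) qN
  clean : IsCleanPreimage (E := E) (F := F) (E₁ := E₁) (F₁ := F₁) μ iN iM j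
  quotient_M : IsRegularFoliationQuotient (E := E₁) (F := E₂)
    (residualVectorFields Q 𝔥 𝔠 L iM) qM

/-- The infinitesimal action of `𝔠` on the submanifold `iN : S → N` is transitive. -/
def IsTransitiveOn (ρ : 𝔡 →ₗ[ℝ] Π n : N, TangentSpace 𝓘(ℝ, F) n)
    (𝔠 : LieSubalgebra ℝ 𝔡) (iN : S → N) : Prop :=
  ∀ s (v : TangentSpace 𝓘(ℝ, F₁) s), ∃ ξ ∈ 𝔠, mfderiv 𝓘(ℝ, F₁) 𝓘(ℝ, F) iN s v = ρ ξ (iN s)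

/-- `R₂ = R_𝔠 × (gr(qN) ∘ gr(iN)^⊤) : 𝔡 × N ⇢ 𝔡_𝔠 × N'`. -/
def targetReductionRel (Q : QuadraticPairing 𝔡) (𝔠 : LieSubalgebra ℝ 𝔡) (iN : S → N)
    (qN : S → N') : SetRel (𝔡 × N) (Q.Reduced 𝔠 × N') :=
  {p | (p.1.1, p.2.1) ∈ Q.reductionRel 𝔠 ∧
    (p.1.2, p.2.2) ∈ (Function.graph iN).inv.comp (Function.graph qN)}

/-- `R₁ = R_{qM} ∘ (R_{iM})^⊤ : 𝕋M ⇢ 𝕋M'`. -/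
def sourceReductionRel (iM : P → M) (qM : P → M') :
    SetRel (GenTangentBundle E M) (GenTangentBundle E₂ M') :=
  (standardLift (E := E₁) (F := E) iM).inv.comp (standardLift (E := E₁) (F := E₂) qM)

/-- The reduced relation `R₂ ∘ R ∘ R₁^⊤ : 𝕋M' ⇢ 𝔡_𝔠 × N'`. -/
def reducedRel (Q : QuadraticPairing 𝔡) (μ : M → N)
    (L : Π m : M, Submodule ℝ (CourantFibre 𝔡 E m)) (𝔠 : LieSubalgebra ℝ 𝔡)
    (iN : S → N) (qN : S → N') (iM : P → M) (qM : P → M') :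
    SetRel (GenTangentBundle E₂ M') (Q.Reduced 𝔠 × N') :=
  (sourceReductionRel (E := E) (E₁ := E₁) (E₂ := E₂) iM qM).inv.comp
    ((graphRel μ L).comp (targetReductionRel Q 𝔠 iN qN))

end Reduction

/-! Exactness makes the fibres of `L` rigid. At every point of `M` the action map `r : 𝔡 → TN` is
onto, and an element of `L` is the same thing as a pair `(ξ, X)` with `r ξ = D X`, where `D` is the
derivative of `μ`. A covector completing such a pair exists because `L` contains an element over
every tangent vector and one over every `ζ` in the stabilizer (`IsExactFibre.exists_covector`); it
is unique because `L` is isotropic and projects onto `TM` (`IsExactFibre.covector_unique`). Linear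
reduction by `𝔠` preserves this structure, (m1) and (m2) included (`IsReductionFibre.isExactFibre`);
transitivity on `S` makes the reduced action map surjective again.

The action and `μ` descend for elementary reasons. As `[𝔠^⊥, 𝔠] ⊆ 𝔠^⊥`, the image in `TN'` of the
vector field of `ξ ∈ 𝔠` does not change along integral curves of `𝔠^⊥` (`mfderiv_quotient_eq`), and
`j` carries residual orbits into orbits of `𝔠^⊥` (`quotient_restriction_eq`).

The main point is that the reduced fibres at two points of `P` with the same image in `M'` coincide.
A reduced fibre is determined by its covectors over the pairs `(ζ, X)`, so it suffices that these
have zero derivative along the fibres of `qM` (`hasFDerivAt_covector_zero`). This is involutivity of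
`L`, applied to a section `e₁` over `𝔠^⊥` with vertical vector part and to sections `e₂`, `e₃` over
`𝔠`: in `⟨⟦e₁, e₂⟧, e₃⟩ = 0` all terms pairing `𝔠` with `𝔠^⊥` drop out, and the rest is the required
derivative. The fibres of `qM` consist of chains of integral curves, so local constancy gives
equality (`reducedFamily_eq`).

Since only `P` relates `M` to `M'`, sections of `L` are handled along maps `φ : V → M` from a vector
space, with the derivative of `φ` in a constant direction as vector part. The Courant bracket
pairing can be computed from them (`courantBracketPairing_eq_parametricBracket`): isotropy makes the
answer independent of extensions, and constant directions commute, so no bracket of vector fields is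
left. Such sections come from linear systems of constant rank (`exists_smooth_solution`); the ranks
are constant because `𝔠` maps onto `TS` and `𝔠^⊥` onto the tangent spaces of the leaves. The
covector part is automatically smooth (`IsLagrangianOverGraph.isSmoothSectionAt`). A local section
of `qM` then yields sections of `L'` along `qM ∘ φ` and of `L` along `iM ∘ φ` with equal pairings
(`exists_reduced_section`), so `L'` inherits smoothness and involutivity.

If `𝔠` is Lagrangian, the reduced Lie algebra is zero, hence so are the tangent spaces of `N'` along
`μ'`, and `L'` is the graph of a bilinear form: isotropy makes it alternating, (m2) nondegenerate,
involutivity closed (`IsManinPairMorphism.isSymplecticForm`). -/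

set_option linter.unusedSectionVars false

/-! ### Smoothness of operator-valued maps and their inverses. -/

section LinearCalculus

open Filter Topology

variable {G H : Type*} [NormedAddCommGroup G] [NormedSpace ℝ G] [TopologicalSpace H]
  {I : ModelWithCorners ℝ G H} {Z : Type*} [TopologicalSpace Z] [ChartedSpace H Z]
  {A : Type*} [NormedAddCommGroup A] [NormedSpace ℝ A] [FiniteDimensional ℝ A]
  {B : Type*} [NormedAddCommGroup B] [NormedSpace ℝ B]

/-- In a basis of the finite-dimensional source, `T z` is a sum of rank-one operators with
coefficients `T z (b i)`, so strong smoothness implies smoothness in norm. -/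
lemma contMDiffAt_clm_of_apply {T : Z → A →L[ℝ] B} {z₀ : Z} {n : WithTop ℕ∞}
    (h : ∀ a, ContMDiffAt I 𝓘(ℝ, B) n (fun z => T z a) z₀) :
    ContMDiffAt I 𝓘(ℝ, A →L[ℝ] B) n T z₀ := by
  let b := Module.finBasis ℝ A
  have key : T = fun z => ∑ i, ((LinearMap.toContinuousLinearMap (b.coord i)).smulRight (T z (b i))) := by
    funext z
    ext a
    conv_lhs => rw [← b.sum_repr a]
    simp only [map_sum, map_smul, sum_apply,
      ContinuousLinearMap.smulRight_apply, LinearMap.coe_toContinuousLinearMap', b.coord_apply]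
  rw [key]
  have hs : ∀ i, ContMDiffAt I 𝓘(ℝ, A →L[ℝ] B) n
      (fun z => ((LinearMap.toContinuousLinearMap (b.coord i)).smulRight (T z (b i)))) z₀ := by
    intro i
    exact (ContinuousLinearMap.smulRightL ℝ A B
      (LinearMap.toContinuousLinearMap (b.coord i))).contDiff.contMDiff.contMDiffAt.comp z₀ (h (b i))
  exact ContMDiffAt.sum fun i _ => hs i

omit [FiniteDimensional ℝ A] in
lemma ContMDiffAt.clm_inverse [CompleteSpace A] {T : Z → A →L[ℝ] B} {z₀ : Z} {n : WithTop ℕ∞}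
    (h : ContMDiffAt I 𝓘(ℝ, A →L[ℝ] B) n T z₀) (h₀ : (T z₀).IsInvertible) :
    ContMDiffAt I 𝓘(ℝ, B →L[ℝ] A) n (fun z => (T z).inverse) z₀ := by
  obtain ⟨e, he⟩ := h₀
  have h1 : ContDiffAt ℝ n ContinuousLinearMap.inverse (T z₀) := by
    rw [← he]; exact contDiffAt_map_inverse e
  exact h1.contMDiffAt.comp z₀ h

omit [FiniteDimensional ℝ A] in
lemma ContMDiffAt.eventually_isInvertible [CompleteSpace A] {T : Z → A →L[ℝ] B} {z₀ : Z}
    {n : WithTop ℕ∞}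
    (h : ContMDiffAt I 𝓘(ℝ, A →L[ℝ] B) n T z₀) (h₀ : (T z₀).IsInvertible) :
    ∀ᶠ z in 𝓝 z₀, (T z).IsInvertible := by
  obtain ⟨e, he⟩ := h₀
  have := e.nhds
  rw [he] at this
  exact h.continuousAt this

-- Smoothness of the solution of a square linear system: near `z₀` it equals the inverse operator,
-- which is smooth, applied to the right-hand side.
omit [FiniteDimensional ℝ A] in
lemma ContMDiffAt.of_clm_apply [CompleteSpace A] {T : Z → A →L[ℝ] B} {x : Z → A} {z₀ : Z}
    {n : WithTop ℕ∞}
    (h : ContMDiffAt I 𝓘(ℝ, A →L[ℝ] B) n T z₀) (h₀ : (T z₀).IsInvertible)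
    (hx : ContMDiffAt I 𝓘(ℝ, B) n (fun z => T z (x z)) z₀) : ContMDiffAt I 𝓘(ℝ, A) n x z₀ := by
  refine ((h.clm_inverse h₀).clm_apply hx).congr_of_eventuallyEq ?_
  filter_upwards [h.eventually_isInvertible h₀] with z hz
  exact (hz.inverse_apply_eq.2 rfl).symm

omit [FiniteDimensional ℝ A] in
lemma ContMDiffAt.of_comp_clm [CompleteSpace A] {T : Z → A →L[ℝ] B} {x : Z → B →L[ℝ] ℝ} {z₀ : Z}
    {n : WithTop ℕ∞}
    (h : ContMDiffAt I 𝓘(ℝ, A →L[ℝ] B) n T z₀) (h₀ : (T z₀).IsInvertible)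
    (hx : ContMDiffAt I 𝓘(ℝ, A →L[ℝ] ℝ) n (fun z => (x z).comp (T z)) z₀) :
    ContMDiffAt I 𝓘(ℝ, B →L[ℝ] ℝ) n x z₀ := by
  refine (hx.clm_comp (h.clm_inverse h₀)).congr_of_eventuallyEq ?_
  filter_upwards [h.eventually_isInvertible h₀] with z hz
  obtain ⟨e, he⟩ := hz
  ext b
  simp [← he]

end LinearCalculus

/-! ### Linear systems of locally constant rank. -/

section Solve

open Filter Topology

variable {V : Type*} [NormedAddCommGroup V] [NormedSpace ℝ V]
  {A : Type*} [AddCommGroup A] [Module ℝ A] [FiniteDimensional ℝ A]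
  {B : Type*} [NormedAddCommGroup B] [NormedSpace ℝ B] [FiniteDimensional ℝ B]

/-- Smooth solutions of a linear system of locally constant rank. -/
theorem exists_smooth_solution (J : V → A →ₗ[ℝ] B) (y : V → B) (t₀ : V)
    (hJ : ∀ᶠ t in 𝓝 t₀, ∀ a, ContDiffAt ℝ ∞ (fun s => J s a) t)
    (hy : ∀ᶠ t in 𝓝 t₀, ContDiffAt ℝ ∞ y t)
    (hr : ∀ᶠ t in 𝓝 t₀, y t ∈ LinearMap.range (J t))
    (hrank : ∀ᶠ t in 𝓝 t₀, Module.finrank ℝ (LinearMap.range (J t)) =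
      Module.finrank ℝ (LinearMap.range (J t₀)))
    (a₀ : A) (h₀ : J t₀ a₀ = y t₀) :
    ∃ a : V → A, (∀ᶠ t in 𝓝 t₀, ∀ ℓ : Module.Dual ℝ A, ContDiffAt ℝ ∞ (fun s => ℓ (a s)) t) ∧
      a t₀ = a₀ ∧ ∀ᶠ t in 𝓝 t₀, J t (a t) = y t := by
  let W := LinearMap.range (J t₀)
  obtain ⟨pr, hpr⟩ := W.subtype.exists_leftInverse_of_injective (by simp)
  obtain ⟨s, hs⟩ := (J t₀).rangeRestrict.exists_rightInverse_of_surjective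
    (LinearMap.range_rangeRestrict _)
  let prc : B →L[ℝ] W := LinearMap.toContinuousLinearMap pr
  let T : V → W →L[ℝ] W := fun t => LinearMap.toContinuousLinearMap (pr ∘ₗ J t ∘ₗ s)
  have hTapp : ∀ t w, T t w = pr (J t (s w)) := fun t w => rfl
  have hT0 : T t₀ = ContinuousLinearMap.id ℝ W := by
    ext w
    have h1 : (J t₀) (s w) = (w : B) := congrArg Subtype.val (LinearMap.congr_fun hs w)
    rw [hTapp, h1]
    exact congrArg Subtype.val (LinearMap.congr_fun hpr w)
  have hT : ∀ᶠ t in 𝓝 t₀, ContDiffAt ℝ ∞ T t := by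
    filter_upwards [hJ] with t ht
    rw [← contMDiffAt_iff_contDiffAt]
    refine contMDiffAt_clm_of_apply fun w => ?_
    rw [contMDiffAt_iff_contDiffAt]
    exact prc.contDiff.contDiffAt.comp t (ht (s w))
  have hinv0 : (T t₀).IsInvertible := by rw [hT0]; exact ⟨ContinuousLinearEquiv.refl ℝ W, rfl⟩
  have hinv : ∀ᶠ t in 𝓝 t₀, (T t).IsInvertible :=
    (contMDiffAt_iff_contDiffAt.2 hT.self_of_nhds).eventually_isInvertible hinv0
  -- `T t` is the system cut down to a square one: restricted to a complement of the kernel by `s`,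
  -- projected to the range at `t₀` by `pr`. It is the identity at `t₀`. Solving for the correction
  -- to `a₀`, rather than from scratch, gives the prescribed value at `t₀`.
  refine ⟨fun t => a₀ + s ((T t).inverse (prc (y t - J t a₀))), ?_, ?_, ?_⟩
  · filter_upwards [hJ, hy, hT, hinv] with t h1 h2 h3 h4 ℓ
    have h5 : ContDiffAt ℝ ∞ (fun t => (T t).inverse (prc (y t - J t a₀))) t := by
      refine ContDiffAt.clm_apply ?_ (prc.contDiff.contDiffAt.comp t (h2.sub (h1 a₀)))
      exact contMDiffAt_iff_contDiffAt.1 ((contMDiffAt_iff_contDiffAt.2 h3).clm_inverse h4)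
    have h6 := ((LinearMap.toContinuousLinearMap (ℓ ∘ₗ s)).contDiff.contDiffAt (n := ∞)).comp t h5
    simp only [map_add]
    exact contDiffAt_const.add h6
  · simp [h₀]
  · filter_upwards [hr, hrank, hinv] with t h1 h2 h3
    set w := (T t).inverse (prc (y t - J t a₀)) with hw
    have h4 : T t w = prc (y t - J t a₀) := (h3.inverse_apply_eq.1 hw.symm).symm
    -- The cut-down system only makes the residual vanish after `pr`. The residual lies in the range
    -- of `J t`, where `pr` is onto `W`, hence injective by equality of dimensions; this is the use
    -- of constant rank.
    let f : LinearMap.range (J t) →ₗ[ℝ] W := pr ∘ₗ (LinearMap.range (J t)).subtype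
    have hsurj : Function.Surjective f := by
      intro x
      obtain ⟨e, he⟩ := h3
      refine ⟨⟨J t (s (e.symm x)), ⟨_, rfl⟩⟩, ?_⟩
      change T t (e.symm x) = x
      rw [← he]; simp
    have hinj : Function.Injective f :=
      (LinearMap.injective_iff_surjective_of_finrank_eq_finrank h2).2 hsurj
    have hmem : J t (a₀ + s w) - y t ∈ LinearMap.range (J t) :=
      Submodule.sub_mem _ ⟨_, rfl⟩ h1
    have h6 : f ⟨_, hmem⟩ = 0 := by
      change pr (J t (a₀ + s w) - y t) = 0
      have h7 : pr (J t (s w)) = pr (y t - J t a₀) := h4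
      rw [map_add, map_sub, map_add, h7, map_sub]
      abel
    have h8 := hinj (h6.trans (map_zero f).symm)
    exact sub_eq_zero.1 (congrArg Subtype.val h8)

end Solve

/-! ### Calculus with values in a Lie algebra without a chosen norm. -/

section Bilinear

variable {𝔡 : Type*} [AddCommGroup 𝔡] [Module ℝ 𝔡] [FiniteDimensional ℝ 𝔡]
  {G H : Type*} [NormedAddCommGroup G] [NormedSpace ℝ G] [TopologicalSpace H]
  {I : ModelWithCorners ℝ G H} {Z : Type*} [TopologicalSpace Z] [ChartedSpace H Z]

/-- `𝔡` carries no topology, so smoothness of `𝔡`-valued maps is tested by linear functionals.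
Expanding one argument in a basis reduces bilinear expressions to products of such scalar functions.
-/
lemma bilinForm_eq_sum (B : LinearMap.BilinForm ℝ 𝔡) (x y : 𝔡) :
    B x y = ∑ i, (Module.finBasis ℝ 𝔡).coord i x * B (Module.finBasis ℝ 𝔡 i) y := by
  conv_lhs => rw [← (Module.finBasis ℝ 𝔡).sum_repr x]
  simp only [map_sum, map_smul, LinearMap.sum_apply, LinearMap.smul_apply, smul_eq_mul,
    Module.Basis.coord_apply]

lemma ContMDiffAt.bilinForm (B : LinearMap.BilinForm ℝ 𝔡) {x y : Z → 𝔡} {z₀ : Z} {n : WithTop ℕ∞}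
    (hx : ∀ ℓ : Module.Dual ℝ 𝔡, ContMDiffAt I 𝓘(ℝ, ℝ) n (fun z => ℓ (x z)) z₀)
    (hy : ∀ ℓ : Module.Dual ℝ 𝔡, ContMDiffAt I 𝓘(ℝ, ℝ) n (fun z => ℓ (y z)) z₀) :
    ContMDiffAt I 𝓘(ℝ, ℝ) n (fun z => B (x z) (y z)) z₀ := by
  let b := Module.finBasis ℝ 𝔡
  have key : (fun z => B (x z) (y z)) = fun z => ∑ i, b.coord i (x z) * B (b i) (y z) :=
    funext fun z => bilinForm_eq_sum B _ _
  rw [key]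
  exact ContMDiffAt.sum fun i _ => (hx (b.coord i)).mul (hy (B (b i)))

variable {V : Type*} [NormedAddCommGroup V] [NormedSpace ℝ V]

lemma DifferentiableAt.bilinForm (B : LinearMap.BilinForm ℝ 𝔡) {x y : V → 𝔡} {t : V}
    (hx : ∀ ℓ : Module.Dual ℝ 𝔡, DifferentiableAt ℝ (fun z => ℓ (x z)) t)
    (hy : ∀ ℓ : Module.Dual ℝ 𝔡, DifferentiableAt ℝ (fun z => ℓ (y z)) t) :
    DifferentiableAt ℝ (fun z => B (x z) (y z)) t ∧
    ∀ v, fderiv ℝ (fun z => B (x z) (y z)) t v =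
      fderiv ℝ (fun z => B (x z) (y t)) t v + fderiv ℝ (fun z => B (x t) (y z)) t v := by
  let b := Module.finBasis ℝ 𝔡
  have key : (fun z => B (x z) (y z)) = fun z => ∑ i, b.coord i (x z) * B (b i) (y z) :=
    funext fun z => bilinForm_eq_sum B _ _
  have key1 : (fun z => B (x z) (y t)) = fun z => ∑ i, b.coord i (x z) * B (b i) (y t) :=
    funext fun z => bilinForm_eq_sum B _ _
  have key2 : (fun z => B (x t) (y z)) = fun z => ∑ i, b.coord i (x t) * B (b i) (y z) :=
    funext fun z => bilinForm_eq_sum B _ _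
  have hd : ∀ i, HasFDerivAt (fun z => b.coord i (x z) * B (b i) (y z))
      (b.coord i (x t) • fderiv ℝ (fun z => B (b i) (y z)) t
        + B (b i) (y t) • fderiv ℝ (fun z => b.coord i (x z)) t) t := fun i =>
    (hx (b.coord i)).hasFDerivAt.mul (hy (B (b i))).hasFDerivAt
  have h := HasFDerivAt.fun_sum (u := Finset.univ) fun i _ => hd i
  have h1 := HasFDerivAt.fun_sum (u := Finset.univ) fun i _ =>
    (hx (b.coord i)).hasFDerivAt.mul_const (B (b i) (y t))
  have h2 := HasFDerivAt.fun_sum (u := Finset.univ) fun i _ =>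
    (hy (B (b i))).hasFDerivAt.const_mul (b.coord i (x t))
  rw [key, key1, key2]
  refine ⟨h.differentiableAt, fun v => ?_⟩
  rw [h.fderiv, h1.fderiv, h2.fderiv]
  simp [Finset.sum_add_distrib, add_comm]

end Bilinear

/-! ### Tangent vectors and covectors in charts. -/

section Coordinates

open Filter Topology

variable {E : Type*} [NormedAddCommGroup E] [NormedSpace ℝ E]
  {M : Type*} [TopologicalSpace M] [ChartedSpace E M]

/-- The coordinates of tangent vectors at `m` in the preferred chart at `m₀`. -/
noncomputable def coordAt (m₀ m : M) : TangentSpace 𝓘(ℝ, E) m →L[ℝ] E :=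
  mfderiv 𝓘(ℝ, E) 𝓘(ℝ, E) (extChartAt 𝓘(ℝ, E) m₀) m

variable [IsManifold 𝓘(ℝ, E) ∞ M]

variable (E M) in
lemma isManifold_one_of_infty : IsManifold 𝓘(ℝ, E) 1 M := IsManifold.of_le (n := ∞) (by simp)

/-- Both sides live in the model space, which is what `TangentSpace` unfolds to; the preferred chart
at `m` has identity derivative at `m` itself. -/
lemma coordAt_self (m : M) (v : TangentSpace 𝓘(ℝ, E) m) : coordAt m m v = v := by
  have : IsManifold 𝓘(ℝ, E) 1 M := isManifold_one_of_infty E M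
  have h := mfderiv_extChartAt_self (I := 𝓘(ℝ, E)) (x := m)
  rw [coordAt, h]
  rfl

lemma coordAt_isInvertible {m₀ m : M} (h : m ∈ (chartAt E m₀).source) :
    (coordAt (E := E) m₀ m).IsInvertible := by
  have : IsManifold 𝓘(ℝ, E) 1 M := isManifold_one_of_infty E M
  exact isInvertible_mfderiv_extChartAt (by simpa using h)

lemma coordAt_injective {m₀ m : M} (h : m ∈ (chartAt E m₀).source) :
    Function.Injective (coordAt (E := E) m₀ m) :=
  (coordAt_isInvertible h).injective

variable {G H : Type*} [NormedAddCommGroup G] [NormedSpace ℝ G] [TopologicalSpace H]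
  {I : ModelWithCorners ℝ G H} {Z : Type*} [TopologicalSpace Z] [ChartedSpace H Z]

omit [NormedSpace ℝ E] [IsManifold 𝓘(ℝ, E) ∞ M] in
lemma eventually_mem_chartAt {f : Z → M} {z₀ : Z} (hf : ContinuousAt f z₀) :
    ∀ᶠ z in 𝓝 z₀, f z ∈ (chartAt E (f z₀)).source :=
  hf ((chartAt E (f z₀)).open_source.mem_nhds (mem_chart_source E (f z₀)))

/-- The preferred trivialization of the tangent bundle at `f z₀` is the derivative of the preferred
chart, so smoothness of a field along `f` can be read off from one vector-valued function. -/
lemma contMDiffAt_tangent_iff {f : Z → M} {X : Π z, TangentSpace 𝓘(ℝ, E) (f z)} {z₀ : Z} :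
    ContMDiffAt I 𝓘(ℝ, E).tangent ∞ (fun z => (⟨f z, X z⟩ : TangentBundle 𝓘(ℝ, E) M)) z₀ ↔
      ContMDiffAt I 𝓘(ℝ, E) ∞ f z₀ ∧
        ContMDiffAt I 𝓘(ℝ, E) ∞ (fun z => coordAt (E := E) (f z₀) (f z) (X z)) z₀ := by
  have : IsManifold 𝓘(ℝ, E) 1 M := isManifold_one_of_infty E M
  rw [contMDiffAt_totalSpace]
  refine and_congr_right fun hf => ?_
  refine Filter.EventuallyEq.contMDiffAt_iff ?_
  filter_upwards [eventually_mem_chartAt (E := E) hf.continuousAt] with z hz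
  have h := TangentBundle.continuousLinearMapAt_trivializationAt (I := 𝓘(ℝ, E)) (x₀ := f z₀) hz
  have h2 := congrArg (fun T : TangentSpace 𝓘(ℝ, E) (f z) →L[ℝ] E => T (X z)) h
  refine Eq.trans ?_ h2
  symm
  rw [Bundle.Trivialization.continuousLinearMapAt_apply,
    Bundle.Trivialization.linearMapAt_apply, if_pos (by simpa using hz)]

/-- Dual to `contMDiffAt_tangent_iff`: covectors transform by the inverse of the chart derivative,
and the trivial line bundle contributes the identity. -/
lemma contMDiffAt_cotangent_iff {f : Z → M} {α : Π z, TangentSpace 𝓘(ℝ, E) (f z) →L[ℝ] ℝ} {z₀ : Z} :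
    ContMDiffAt I (𝓘(ℝ, E).prod 𝓘(ℝ, E →L[ℝ] ℝ)) ∞
    (fun z => TotalSpace.mk' (E →L[ℝ] ℝ)
      (E := fun m : M => TangentSpace 𝓘(ℝ, E) m →L[ℝ] ℝ) (f z) (α z)) z₀ ↔
      ContMDiffAt I 𝓘(ℝ, E) ∞ f z₀ ∧
        ContMDiffAt I 𝓘(ℝ, E →L[ℝ] ℝ) ∞ 
          (fun z => ((α z).comp (coordAt (E := E) (f z₀) (f z)).inverse : E →L[ℝ] ℝ)) z₀ := by
  have : IsManifold 𝓘(ℝ, E) 1 M := isManifold_one_of_infty E M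
  rw [contMDiffAt_hom_bundle]
  refine and_congr_right fun hf => ?_
  refine Filter.EventuallyEq.contMDiffAt_iff ?_
  filter_upwards [eventually_mem_chartAt (E := E) hf.continuousAt] with z hz
  have h := TangentBundle.continuousLinearMapAt_trivializationAt (I := 𝓘(ℝ, E)) (x₀ := f z₀) hz
  have h2 : (trivializationAt E (TangentSpace 𝓘(ℝ, E)) (f z₀)).symmL ℝ (f z)
      = (coordAt (E := E) (f z₀) (f z)).inverse := by
    ext v
    refine ((coordAt_isInvertible hz).inverse_apply_eq.2 ?_).symm
    rw [coordAt, ← h]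
    exact ((trivializationAt E (TangentSpace 𝓘(ℝ, E)) (f z₀)).continuousLinearMapAt_symmL
      (by simpa using hz) v).symm
  rw [← h2, ContinuousLinearMap.inCoordinates]
  have h3 : (trivializationAt ℝ (fun _ : M => ℝ) (f z₀)).continuousLinearMapAt ℝ (f z) =
      ContinuousLinearMap.id ℝ ℝ := Bundle.Trivial.continuousLinearMapAt_trivialization ℝ M ℝ _
  ext v
  exact congrArg (fun T : ℝ →L[ℝ] ℝ => T (α z
    ((trivializationAt E (TangentSpace 𝓘(ℝ, E)) (f z₀)).symmL ℝ (f z) v))) h3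

lemma ContMDiffAt.cotangent_apply {f : Z → M} {α : Π z, TangentSpace 𝓘(ℝ, E) (f z) →L[ℝ] ℝ}
    {X : Π z, TangentSpace 𝓘(ℝ, E) (f z)} {z₀ : Z}
    (hα : ContMDiffAt I (𝓘(ℝ, E).prod 𝓘(ℝ, E →L[ℝ] ℝ)) ∞
      (fun z => TotalSpace.mk' (E →L[ℝ] ℝ)
        (E := fun m : M => TangentSpace 𝓘(ℝ, E) m →L[ℝ] ℝ) (f z) (α z)) z₀)
    (hX : ContMDiffAt I 𝓘(ℝ, E).tangent ∞
      (fun z => (⟨f z, X z⟩ : TangentBundle 𝓘(ℝ, E) M)) z₀) :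
    ContMDiffAt I 𝓘(ℝ, ℝ) ∞ (fun z => α z (X z)) z₀ := by
  rw [contMDiffAt_cotangent_iff] at hα
  rw [contMDiffAt_tangent_iff] at hX
  refine (hα.2.clm_apply hX.2).congr_of_eventuallyEq ?_
  filter_upwards [eventually_mem_chartAt (E := E) hα.1.continuousAt] with z hz
  obtain ⟨e, he⟩ := coordAt_isInvertible (E := E) hz
  rw [← he]
  simp

omit [IsManifold 𝓘(ℝ, E) ∞ M] in
lemma coordAt_mfderiv [IsManifold 𝓘(ℝ, E) 1 M] {φ : Z → M} {z : Z}
    (hφ : MDifferentiableAt I 𝓘(ℝ, E) φ z) {m₀ : M}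
    (hz : φ z ∈ (chartAt E m₀).source) (v : TangentSpace I z) :
    coordAt m₀ (φ z) (mfderiv I 𝓘(ℝ, E) φ z v) =
      mfderiv I 𝓘(ℝ, E) (extChartAt 𝓘(ℝ, E) m₀ ∘ φ) z v := by
  rw [mfderiv_comp z (mdifferentiableAt_extChartAt hz) hφ]
  rfl

variable {V : Type*} [NormedAddCommGroup V] [NormedSpace ℝ V]

lemma contDiffAt_extChartAt_comp {φ : V → M} {t : V} (hφ : ContMDiffAt 𝓘(ℝ, V) 𝓘(ℝ, E) ∞ φ t)
    {m₀ : M} (hz : φ t ∈ (chartAt E m₀).source) :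
    ContDiffAt ℝ ∞ (extChartAt 𝓘(ℝ, E) m₀ ∘ φ) t :=
  contMDiffAt_iff_contDiffAt.1 ((contMDiffAt_extChartAt' hz).comp t hφ)

omit [IsManifold 𝓘(ℝ, E) ∞ M] in
lemma ContMDiffAt.eventually_mdifferentiableAt [IsManifold 𝓘(ℝ, E) 1 M] {φ : V → M} {t : V}
    (hφ : ContMDiffAt 𝓘(ℝ, V) 𝓘(ℝ, E) ∞ φ t) :
    ∀ᶠ s in 𝓝 t, MDifferentiableAt 𝓘(ℝ, V) 𝓘(ℝ, E) φ s := by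
  have h1 : ContMDiffAt 𝓘(ℝ, V) 𝓘(ℝ, E) 1 φ t := hφ.of_le (by simp)
  filter_upwards [(contMDiffAt_iff_contMDiffAt_nhds (by simp)).1 h1] with s hs
  exact hs.mdifferentiableAt one_ne_zero

lemma eventually_coordAt_mfderiv {φ : V → M} {t : V} (hφ : ContMDiffAt 𝓘(ℝ, V) 𝓘(ℝ, E) ∞ φ t) :
    ∀ᶠ s in 𝓝 t, ∀ v : V, coordAt (φ t) (φ s) (mfderiv 𝓘(ℝ, V) 𝓘(ℝ, E) φ s v) =
      fderiv ℝ (extChartAt 𝓘(ℝ, E) (φ t) ∘ φ) s v := by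
  have : IsManifold 𝓘(ℝ, E) 1 M := isManifold_one_of_infty E M
  filter_upwards [hφ.eventually_mdifferentiableAt,
    eventually_mem_chartAt (E := E) hφ.continuousAt] with s hs hs' v
  exact (coordAt_mfderiv hs hs' v).trans (by rw [mfderiv_eq_fderiv]; rfl)

lemma contMDiffAt_mfderiv_apply {φ : V → M} {t : V} (hφ : ContMDiffAt 𝓘(ℝ, V) 𝓘(ℝ, E) ∞ φ t)
    (v : V) : ContMDiffAt 𝓘(ℝ, V) 𝓘(ℝ, E).tangent ∞
      (fun s => (⟨φ s, mfderiv 𝓘(ℝ, V) 𝓘(ℝ, E) φ s v⟩ : TangentBundle 𝓘(ℝ, E) M)) t := by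
  rw [contMDiffAt_tangent_iff]
  refine ⟨hφ, ?_⟩
  have h1 : ContDiffAt ℝ ∞ (fderiv ℝ (extChartAt 𝓘(ℝ, E) (φ t) ∘ φ)) t :=
    (contDiffAt_extChartAt_comp hφ (mem_chart_source E _)).fderiv_right (by simp)
  have h2 : ContDiffAt ℝ ∞ (fun s => fderiv ℝ (extChartAt 𝓘(ℝ, E) (φ t) ∘ φ) s v) t :=
    h1.clm_apply contDiffAt_const
  refine h2.contMDiffAt.congr_of_eventuallyEq ?_
  filter_upwards [eventually_coordAt_mfderiv hφ] with s hs
  exact hs v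

lemma ContMDiffAt.mfderiv_tangent {E' : Type*} [NormedAddCommGroup E'] [NormedSpace ℝ E']
    {M' : Type*} [TopologicalSpace M'] [ChartedSpace E' M'] [IsManifold 𝓘(ℝ, E') ∞ M']
    {φ : M → M'} (hφ : ContMDiff 𝓘(ℝ, E) 𝓘(ℝ, E') ∞ φ) {f : Z → M}
    {X : Π z, TangentSpace 𝓘(ℝ, E) (f z)} {z₀ : Z}
    (hX : ContMDiffAt I 𝓘(ℝ, E).tangent ∞
      (fun z => (⟨f z, X z⟩ : TangentBundle 𝓘(ℝ, E) M)) z₀) :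
    ContMDiffAt I 𝓘(ℝ, E').tangent ∞
      (fun z => (⟨φ (f z), mfderiv 𝓘(ℝ, E) 𝓘(ℝ, E') φ (f z) (X z)⟩ :
        TangentBundle 𝓘(ℝ, E') M')) z₀ :=
  (hφ.contMDiff_tangentMap (m := ∞) (by simp)).contMDiffAt.comp z₀ hX

end Coordinates

/-! ### Lie brackets as commutators of derivations. -/

section Brackets

open Filter Topology

variable {G H : Type*} [NormedAddCommGroup G] [NormedSpace ℝ G] [CompleteSpace G]
  [TopologicalSpace H]
  {I : ModelWithCorners ℝ G H} [I.Boundaryless] {Z : Type*} [TopologicalSpace Z] [ChartedSpace H Z]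
  [IsManifold I 2 Z]

/-- The Lie bracket of vector fields acts on functions as the commutator. -/
theorem mfderiv_mlieBracket_apply {f : Z → ℝ} {X Y : Π z : Z, TangentSpace I z} {z : Z}
    (hf : ContMDiffAt I 𝓘(ℝ, ℝ) 2 f z)
    (hX : MDifferentiableAt I I.tangent (fun z => (⟨z, X z⟩ : TangentBundle I Z)) z)
    (hY : MDifferentiableAt I I.tangent (fun z => (⟨z, Y z⟩ : TangentBundle I Z)) z) :
    dirDeriv I f z (VectorField.mlieBracket I X Y z) =
      dirDeriv I (fun y => dirDeriv I f y (Y y)) z (X z) -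
        dirDeriv I (fun y => dirDeriv I f y (X y)) z (Y z) := by
  have : IsManifold I 1 Z := IsManifold.of_le (n := 2) (by norm_num)
  set c := extChartAt I z with hc
  set f' : G → ℝ := f ∘ c.symm with hf'
  have hcs : ∀ᶠ y in 𝓝 z, y ∈ c.source := extChartAt_source_mem_nhds z
  have hct : ∀ᶠ x in 𝓝 (c z), x ∈ c.target := extChartAt_target_mem_nhds z
  have hsymm : ∀ x ∈ c.target, MDifferentiableAt 𝓘(ℝ, G) I c.symm x := fun x hx => by
    have := mdifferentiableWithinAt_extChartAt_symm (I := I) hx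
    rwa [I.range_eq_univ, mdifferentiableWithinAt_univ] at this
  have hinv : ∀ x ∈ c.target, (mfderiv 𝓘(ℝ, G) I c.symm x).IsInvertible := fun x hx => by
    have := isInvertible_mfderivWithin_extChartAt_symm (I := I) hx
    rwa [I.range_eq_univ, mfderivWithin_univ] at this
  have hcid : mfderiv I 𝓘(ℝ, G) c z = ContinuousLinearMap.id ℝ _ := mfderiv_extChartAt_self
  have hfd : ∀ᶠ y in 𝓝 z, MDifferentiableAt I 𝓘(ℝ, ℝ) f y := by
    filter_upwards [(contMDiffAt_iff_contMDiffAt_nhds (by simp)).1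
      (hf.of_le (m := 1) (by norm_num))] with y hy
    exact hy.mdifferentiableAt one_ne_zero
  have hf'2 : ContDiffAt ℝ 2 f' (c z) := by
    rw [← contMDiffAt_iff_contDiffAt]
    have h1 : ContMDiffAt I 𝓘(ℝ, ℝ) 2 f (c.symm (c z)) := by
      rw [hc, extChartAt_to_inv]; exact hf
    refine h1.comp (c z) ?_
    have h2 := contMDiffWithinAt_extChartAt_symm_range (I := I) (n := 2) z (mem_extChartAt_target z)
    rwa [I.range_eq_univ, contMDiffWithinAt_univ] at h2
  have pull : ∀ W : Π z : Z, TangentSpace I z, ∀ᶠ y in 𝓝 z, dirDeriv I f y (W y) =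
      fderiv ℝ f' (c y) (VectorField.mpullback 𝓘(ℝ, G) I c.symm W (c y)) := by
    intro W
    filter_upwards [hcs, hfd] with y hy hfy
    have hcy : c y ∈ c.target := c.map_source hy
    have h1 : mfderiv 𝓘(ℝ, G) 𝓘(ℝ, ℝ) f' (c y) =
        (mfderiv I 𝓘(ℝ, ℝ) f (c.symm (c y))).comp (mfderiv 𝓘(ℝ, G) I c.symm (c y)) :=
      mfderiv_comp (c y) (by rw [c.left_inv hy]; exact hfy) (hsymm _ hcy)
    rw [mfderiv_eq_fderiv] at h1
    rw [h1, VectorField.mpullback_apply]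
    obtain ⟨e, he⟩ := hinv _ hcy
    have h2 : (mfderiv 𝓘(ℝ, G) I c.symm (c y)) ((mfderiv 𝓘(ℝ, G) I c.symm (c y)).inverse
        (W (c.symm (c y)))) = W (c.symm (c y)) := by
      rw [← he]; simp
    refine Eq.trans ?_ (congrArg (mfderiv I 𝓘(ℝ, ℝ) f (c.symm (c y))) h2).symm
    rw [c.left_inv hy]
    rfl
  have hid : (ContinuousLinearMap.id ℝ G).inverse = ContinuousLinearMap.id ℝ G :=
    ContinuousLinearMap.inverse_id
  have val : ∀ W : Π z : Z, TangentSpace I z,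
      VectorField.mpullback 𝓘(ℝ, G) I c.symm W (c z) = W z := by
    intro W
    rw [VectorField.mpullback_apply]
    have h1 := mfderivWithin_range_extChartAt_symm (I := I) (x := z)
    rw [I.range_eq_univ, mfderivWithin_univ] at h1
    have h2 : (mfderiv 𝓘(ℝ, G) I c.symm (c z)).inverse = ContinuousLinearMap.id ℝ G :=
      (congrArg (ContinuousLinearMap.inverse (M := G) (M₂ := G)) h1).trans hid
    rw [h2, c.left_inv (mem_extChartAt_source z)]
    rfl
  have dif : ∀ W : Π z : Z, TangentSpace I z,
      MDifferentiableAt I I.tangent (fun z => (⟨z, W z⟩ : TangentBundle I Z)) z →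
      DifferentiableAt ℝ (VectorField.mpullback 𝓘(ℝ, G) I c.symm W : G → G) (c z) := by
    intro W hW
    have h1 := (mdifferentiableWithinAt_univ.2 hW).differentiableWithinAt_mpullbackWithin_vectorField
    rw [I.range_eq_univ, Set.preimage_univ, Set.inter_univ] at h1
    rw [VectorField.mpullbackWithin_univ] at h1
    exact differentiableWithinAt_univ.1 h1
  have der : ∀ (h : Z → ℝ) (h' : G → ℝ), (∀ᶠ y in 𝓝 z, h y = h' (c y)) →
      DifferentiableAt ℝ h' (c z) → ∀ v : G, dirDeriv I h z v = fderiv ℝ h' (c z) v := by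
    intro h h' he hd v
    have h1 : mfderiv I 𝓘(ℝ, ℝ) h z = mfderiv I 𝓘(ℝ, ℝ) (h' ∘ c) z :=
      Filter.EventuallyEq.mfderiv_eq he
    have h2 := h1.trans (mfderiv_comp z hd.mdifferentiableAt
      (mdifferentiableAt_extChartAt (mem_chart_source H z)))
    rw [hcid, mfderiv_eq_fderiv] at h2
    exact congrArg (fun T : G →L[ℝ] ℝ => T v) h2
  have hbr : VectorField.mlieBracket I X Y z =
      VectorField.lieBracket ℝ (VectorField.mpullback 𝓘(ℝ, G) I c.symm X)
        (VectorField.mpullback 𝓘(ℝ, G) I c.symm Y) (c z) := by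
    rw [← VectorField.mlieBracketWithin_univ, VectorField.mlieBracketWithin_apply]
    rw [I.range_eq_univ, Set.preimage_univ, Set.inter_univ,
      VectorField.mpullbackWithin_univ, VectorField.mpullbackWithin_univ]
    have h3 : (mfderiv I 𝓘(ℝ, G) c z).inverse = ContinuousLinearMap.id ℝ G :=
      (congrArg (ContinuousLinearMap.inverse (M := G) (M₂ := G)) hcid).trans hid
    refine (congrArg (fun T : G →L[ℝ] G => T (VectorField.lieBracketWithin ℝ
      (VectorField.mpullback 𝓘(ℝ, G) I c.symm X)
        (VectorField.mpullback 𝓘(ℝ, G) I c.symm Y) Set.univ (c z))) h3).trans ?_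
    exact congrFun VectorField.lieBracketWithin_univ (c z)
  have hD : DifferentiableAt ℝ (fderiv ℝ f') (c z) :=
    (hf'2.fderiv_right (m := 1) (by norm_num)).differentiableAt one_ne_zero
  -- In the chart, each iterated derivative is a second derivative of `f'` plus `f'` differentiated
  -- along the derivative of a field. The second derivatives cancel by symmetry, and the rest is the
  -- bracket.
  have hsymm2 := (hf'2.isSymmSndFDerivAt (by simp))
  have hff' := der f f' (by filter_upwards [hcs] with y hy; simp [hf', c.left_inv hy])
    (hf'2.differentiableAt (by norm_num))
  have term : ∀ (W : Π z : Z, TangentSpace I z) (W' : G → G) (v : G),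
      (∀ᶠ y in 𝓝 z, dirDeriv I f y (W y) = fderiv ℝ f' (c y) (W' (c y))) →
      DifferentiableAt ℝ W' (c z) →
      dirDeriv I (fun y => dirDeriv I f y (W y)) z v =
        fderiv ℝ (fderiv ℝ f') (c z) v (W' (c z)) + fderiv ℝ f' (c z) (fderiv ℝ W' (c z) v) := by
    intro W W' v hp hd
    have h1 := hD.hasFDerivAt.clm_apply hd.hasFDerivAt
    rw [der _ (fun x => fderiv ℝ f' x (W' x)) hp h1.differentiableAt, h1.fderiv]
    exact add_comm _ _
  -- The pulled-back fields are replaced by arbitrary maps `G → G`, so that the computation takes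
  -- place in one vector space instead of in varying tangent spaces.
  have final : ∀ X' Y' : G → G,
      (∀ᶠ y in 𝓝 z, dirDeriv I f y (X y) = fderiv ℝ f' (c y) (X' (c y))) →
      (∀ᶠ y in 𝓝 z, dirDeriv I f y (Y y) = fderiv ℝ f' (c y) (Y' (c y))) →
      X' (c z) = X z → Y' (c z) = Y z →
      DifferentiableAt ℝ X' (c z) → DifferentiableAt ℝ Y' (c z) →
      dirDeriv I f z (VectorField.lieBracket (E := G) ℝ X' Y' (c z)) =
      dirDeriv I (fun y => dirDeriv I f y (Y y)) z (X z) -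
        dirDeriv I (fun y => dirDeriv I f y (X y)) z (Y z) := by
    intro X' Y' pX pY vX vY dX dY
    refine (hff' _).trans ?_
    refine Eq.trans ?_ (congrArg₂ (· - ·) (term Y Y' (X z) pY dY) (term X X' (Y z) pX dX)).symm
    generalize hx : (X z : G) = x at *
    generalize hy : (Y z : G) = y at *
    have e1 : VectorField.lieBracket (E := G) ℝ X' Y' (c z) =
      fderiv ℝ Y' (c z) (X' (c z)) - fderiv ℝ X' (c z) (Y' (c z)) := rfl
    rw [e1, map_sub, vX, vY, hsymm2.eq x y]
    ring
  rw [hbr]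
  exact final _ _ (pull X) (pull Y) (val X) (val Y) (dif X hX) (dif Y hY)

end Brackets

/-! ### Vector fields related by a smooth map. -/

section Related

open Filter Topology

variable {E : Type*} [NormedAddCommGroup E] [NormedSpace ℝ E]
  {M : Type*} [TopologicalSpace M] [ChartedSpace E M] [IsManifold 𝓘(ℝ, E) ∞ M]

lemma contMDiffAt_dual_comp_extChartAt (ℓ : E →L[ℝ] ℝ) {m₀ m : M} (hm : m ∈ (chartAt E m₀).source) :
    ContMDiffAt 𝓘(ℝ, E) 𝓘(ℝ, ℝ) ∞ (fun r => ℓ (extChartAt 𝓘(ℝ, E) m₀ r)) m :=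
  ℓ.contDiff.contMDiff.contMDiffAt.comp m (contMDiffAt_extChartAt' hm)

lemma dirDeriv_dual_comp_extChartAt (ℓ : E →L[ℝ] ℝ) {m₀ m : M} (hm : m ∈ (chartAt E m₀).source)
    (v : TangentSpace 𝓘(ℝ, E) m) :
    dirDeriv 𝓘(ℝ, E) (fun r => ℓ (extChartAt 𝓘(ℝ, E) m₀ r)) m v = ℓ (coordAt m₀ m v) := by
  have : IsManifold 𝓘(ℝ, E) 1 M := isManifold_one_of_infty E M
  have h := mfderiv_comp m (ℓ.differentiableAt.mdifferentiableAt)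
    (mdifferentiableAt_extChartAt (I := 𝓘(ℝ, E)) hm)
  rw [mfderiv_eq_fderiv, ℓ.fderiv] at h
  exact congrArg (fun T : TangentSpace 𝓘(ℝ, E) m →L[ℝ] ℝ => T v) h

lemma dirDeriv_dual_comp_extChartAt_self (ℓ : E →L[ℝ] ℝ) (m : M) (v : TangentSpace 𝓘(ℝ, E) m) :
    dirDeriv 𝓘(ℝ, E) (fun r => ℓ (extChartAt 𝓘(ℝ, E) m r)) m v = ℓ v := by
  rw [dirDeriv_dual_comp_extChartAt ℓ (mem_chart_source E m), coordAt_self]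

variable {G H : Type*} [NormedAddCommGroup G] [NormedSpace ℝ G] [TopologicalSpace H]
  {I : ModelWithCorners ℝ G H} {Z : Type*} [TopologicalSpace Z] [ChartedSpace H Z]

omit [IsManifold 𝓘(ℝ, E) ∞ M] in
lemma dirDeriv_comp {f : M → ℝ} {φ : Z → M} {z : Z} (hf : MDifferentiableAt 𝓘(ℝ, E) 𝓘(ℝ, ℝ) f (φ z))
    (hφ : MDifferentiableAt I 𝓘(ℝ, E) φ z) (v : TangentSpace I z) :
    dirDeriv I (fun y => f (φ y)) z v = dirDeriv 𝓘(ℝ, E) f (φ z) (mfderiv I 𝓘(ℝ, E) φ z v) := by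
  have h := mfderiv_comp z hf hφ
  exact congrArg (fun T : TangentSpace I z →L[ℝ] ℝ => T v) h

lemma contMDiffAt_dirDeriv_dual (ℓ : E →L[ℝ] ℝ) {f : Z → M} {X : Π z, TangentSpace 𝓘(ℝ, E) (f z)}
    {z₀ : Z} (hX : ContMDiffAt I 𝓘(ℝ, E).tangent ∞
      (fun z => (⟨f z, X z⟩ : TangentBundle 𝓘(ℝ, E) M)) z₀) :
    ContMDiffAt I 𝓘(ℝ, ℝ) ∞ (fun z => dirDeriv 𝓘(ℝ, E)
      (fun r => ℓ (extChartAt 𝓘(ℝ, E) (f z₀) r)) (f z) (X z)) z₀ := by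
  rw [contMDiffAt_tangent_iff] at hX
  refine (ℓ.contDiff.contMDiff.contMDiffAt.comp z₀ hX.2).congr_of_eventuallyEq ?_
  filter_upwards [eventually_mem_chartAt (E := E) hX.1.continuousAt] with z hz
  exact dirDeriv_dual_comp_extChartAt ℓ hz _

variable {E' : Type*} [NormedAddCommGroup E'] [NormedSpace ℝ E']
  {M' : Type*} [TopologicalSpace M'] [ChartedSpace E' M'] [IsManifold 𝓘(ℝ, E') ∞ M']

/-- Brackets of related vector fields are related. -/
theorem mfderiv_mlieBracket_of_related [CompleteSpace E] [CompleteSpace E'] {φ : M → M'}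
    (hφ : ContMDiff 𝓘(ℝ, E) 𝓘(ℝ, E') ∞ φ) {X Y : Π m : M, TangentSpace 𝓘(ℝ, E) m}
    {X' Y' : Π m : M', TangentSpace 𝓘(ℝ, E') m}
    (hX : IsSmoothVectorField X) (hY : IsSmoothVectorField Y)
    (hX' : IsSmoothVectorField X') (hY' : IsSmoothVectorField Y')
    (rX : ∀ m, mfderiv 𝓘(ℝ, E) 𝓘(ℝ, E') φ m (X m) = X' (φ m))
    (rY : ∀ m, mfderiv 𝓘(ℝ, E) 𝓘(ℝ, E') φ m (Y m) = Y' (φ m)) (m : M) :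
    mfderiv 𝓘(ℝ, E) 𝓘(ℝ, E') φ m (VectorField.mlieBracket 𝓘(ℝ, E) X Y m) =
      VectorField.mlieBracket 𝓘(ℝ, E') X' Y' (φ m) := by
  have : IsManifold 𝓘(ℝ, E) 2 M := IsManifold.of_le (n := ∞) (WithTop.coe_le_coe.2 (le_top : (2 : ℕ∞) ≤ ⊤))
  have : IsManifold 𝓘(ℝ, E') 2 M' := IsManifold.of_le (n := ∞) (WithTop.coe_le_coe.2 (le_top : (2 : ℕ∞) ≤ ⊤))
  have : IsManifold 𝓘(ℝ, E) 1 M := isManifold_one_of_infty E M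
  have : IsManifold 𝓘(ℝ, E') 1 M' := isManifold_one_of_infty E' M'
  -- Tangent vectors at `φ m` are separated by derivatives of the coordinate functions `ℓ ∘ chart`.
  -- For those, the commutator formula upstairs and downstairs has the same terms, since derivatives
  -- along related fields commute with pull-back.
  refine (SeparatingDual.eq_iff_forall_dual_eq (R := ℝ) (V := E')).2 fun ℓ => ?_
  set f : M' → ℝ := fun r => ℓ (extChartAt 𝓘(ℝ, E') (φ m) r) with hf
  have hfs : ContMDiffAt 𝓘(ℝ, E') 𝓘(ℝ, ℝ) ∞ f (φ m) :=
    contMDiffAt_dual_comp_extChartAt ℓ (mem_chart_source E' _)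
  have h2 : (2 : WithTop ℕ∞) ≤ ∞ := WithTop.coe_le_coe.2 (le_top : (2 : ℕ∞) ≤ ⊤)
  have hφd : ∀ y, MDifferentiableAt 𝓘(ℝ, E) 𝓘(ℝ, E') φ y := fun y => hφ.mdifferentiable (by simp) y
  have hpull : ∀ (W : Π m : M, TangentSpace 𝓘(ℝ, E) m) (W' : Π m : M', TangentSpace 𝓘(ℝ, E') m),
      (∀ m, mfderiv 𝓘(ℝ, E) 𝓘(ℝ, E') φ m (W m) = W' (φ m)) → ∀ᶠ y in 𝓝 m,
      dirDeriv 𝓘(ℝ, E) (fun y => f (φ y)) y (W y) = dirDeriv 𝓘(ℝ, E') f (φ y) (W' (φ y)) := by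
    intro W W' hW
    filter_upwards [eventually_mem_chartAt (E := E') hφ.continuous.continuousAt] with y hy
    rw [dirDeriv_comp ((contMDiffAt_dual_comp_extChartAt ℓ hy).mdifferentiableAt (by simp)) (hφd y),
      hW]
  have key : ∀ (W U : Π m : M, TangentSpace 𝓘(ℝ, E) m) (W' U' : Π m : M', TangentSpace 𝓘(ℝ, E') m),
      (∀ m, mfderiv 𝓘(ℝ, E) 𝓘(ℝ, E') φ m (W m) = W' (φ m)) →
      (∀ m, mfderiv 𝓘(ℝ, E) 𝓘(ℝ, E') φ m (U m) = U' (φ m)) → IsSmoothVectorField W' →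
      dirDeriv 𝓘(ℝ, E) (fun y => dirDeriv 𝓘(ℝ, E) (fun y => f (φ y)) y (W y)) m (U m) =
      dirDeriv 𝓘(ℝ, E') (fun y => dirDeriv 𝓘(ℝ, E') f y (W' y)) (φ m) (U' (φ m)) := by
    intro W U W' U' hW hU hW'
    rw [← hU, ← dirDeriv_comp ((contMDiffAt_dirDeriv_dual ℓ
      (f := fun y : M' => y) (hW' (φ m))).mdifferentiableAt (by simp)) (hφd m)]
    have h := Filter.EventuallyEq.mfderiv_eq (I := 𝓘(ℝ, E)) (I' := 𝓘(ℝ, ℝ)) (hpull W W' hW)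
    exact congrArg (fun T : TangentSpace 𝓘(ℝ, E) m →L[ℝ] ℝ => T (U m)) h
  have e1 := dirDeriv_dual_comp_extChartAt_self ℓ (φ m)
    (mfderiv 𝓘(ℝ, E) 𝓘(ℝ, E') φ m (VectorField.mlieBracket 𝓘(ℝ, E) X Y m))
  have e2 := dirDeriv_dual_comp_extChartAt_self ℓ (φ m)
    (VectorField.mlieBracket 𝓘(ℝ, E') X' Y' (φ m))
  refine e1.symm.trans (Eq.trans ?_ e2)
  rw [← dirDeriv_comp (hfs.mdifferentiableAt (by simp)) (hφd m)]
  rw [mfderiv_mlieBracket_apply (f := fun y => f (φ y))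
      ((hfs.of_le h2).comp m (hφ.contMDiffAt.of_le h2)) ((hX m).mdifferentiableAt (by simp)) ((hY m).mdifferentiableAt (by simp)),
    mfderiv_mlieBracket_apply (f := f) (hfs.of_le h2)
      ((hX' (φ m)).mdifferentiableAt (by simp)) ((hY' (φ m)).mdifferentiableAt (by simp)),
    key Y X Y' X' rY rX hY', key X Y X' Y' rX rY hX']

end Related

/-! ### Extension of local sections. -/

section Extension

open Filter Topology

variable {𝔡 : Type*} [LieRing 𝔡] [LieAlgebra ℝ 𝔡]
  {E : Type*} [NormedAddCommGroup E] [NormedSpace ℝ E]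
  {M : Type*} [TopologicalSpace M] [ChartedSpace E M] [IsManifold 𝓘(ℝ, E) ∞ M]

/-- Smoothness at a point of a section of the pull-back of `𝔡 × 𝕋M`. -/
structure IsSmoothSectionAt {G H : Type*} [NormedAddCommGroup G]
    [NormedSpace ℝ G] [TopologicalSpace H] (I : ModelWithCorners ℝ G H)
    {Z : Type*} [TopologicalSpace Z] [ChartedSpace H Z]
    (f : Z → M) (e : Π z : Z, CourantFibre 𝔡 E (f z)) (z₀ : Z) : Prop where
  algebra : ∀ ℓ : Module.Dual ℝ 𝔡, ContMDiffAt I 𝓘(ℝ, ℝ) ∞ (fun z => ℓ (e z).1) z₀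
  vector : ContMDiffAt I 𝓘(ℝ, E).tangent ∞
    (fun z => (⟨f z, (e z).2.1⟩ : TangentBundle 𝓘(ℝ, E) M)) z₀
  covector : ContMDiffAt I (𝓘(ℝ, E).prod 𝓘(ℝ, E →L[ℝ] ℝ)) ∞
    (fun z => TotalSpace.mk' (E →L[ℝ] ℝ)
      (E := fun m : M => TangentSpace 𝓘(ℝ, E) m →L[ℝ] ℝ) (f z) (e z).2.2) z₀

/-- A local section of a family of subspaces extends, after shrinking, to a global one. -/
theorem exists_isSmoothSection_of_eventually [FiniteDimensional ℝ E] [T2Space M]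
    (L : Π m : M, Submodule ℝ (CourantFibre 𝔡 E m)) (m₀ : M) (e : Π m : M, CourantFibre 𝔡 E m)
    (he : ∀ᶠ m in 𝓝 m₀, IsSmoothSectionAt 𝓘(ℝ, E) id e m) (heL : ∀ᶠ m in 𝓝 m₀, e m ∈ L m) :
    ∃ e' : Π m : M, CourantFibre 𝔡 E m,
      IsSmoothSection 𝓘(ℝ, E) id e' ∧ (∀ m, e' m ∈ L m) ∧ e' m₀ = e m₀ := by
  have : IsManifold 𝓘(ℝ, E) 1 M := isManifold_one_of_infty E M
  obtain ⟨U, hUsub, hUo, hU0⟩ := mem_nhds_iff.1 (he.and heL)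
  -- Multiplication by a bump function supported in `U` keeps the values in `L`, whose fibres are
  -- subspaces, and makes the section zero where `e` is not controlled.
  obtain ⟨b, -, hb⟩ := (SmoothBumpFunction.nhds_basis_tsupport (I := 𝓘(ℝ, E)) m₀).mem_iff.1
    (hUo.mem_nhds hU0)
  refine ⟨fun m => b m • e m, ⟨fun ℓ => ?_, ?_, ?_⟩, fun m => ?_, ?_⟩
  · refine contMDiff_of_tsupport fun m hm => ?_
    have h1 : (fun m => ℓ (b m • e m).1) = fun m => b m • ℓ (e m).1 := by
      funext m; simp
    rw [h1] at hm ⊢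
    exact b.contMDiffAt.smul ((hUsub (hb (tsupport_smul_subset_left _ _ hm))).1.algebra ℓ)
  · have h := ContMDiffOn.smul_section_of_tsupport (V := fun m : M => TangentSpace 𝓘(ℝ, E) m)
      (b.contMDiff.contMDiffOn) hUo hb
      (fun m hm => ((hUsub hm).1.vector).contMDiffWithinAt)
    exact h
  · have h := ContMDiffOn.smul_section_of_tsupport (F := E →L[ℝ] ℝ)
      (V := fun m : M => TangentSpace 𝓘(ℝ, E) m →L[ℝ] ℝ)
      (b.contMDiff.contMDiffOn) hUo hb
      (fun m hm => ((hUsub hm).1.covector).contMDiffWithinAt)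
    exact h
  · by_cases hm : m ∈ tsupport b
    · exact (L m).smul_mem _ (hUsub (hb hm)).2
    · simp [image_eq_zero_of_notMem_tsupport hm]
  · simp

end Extension

/-! ### Vector fields on products and linear families of vector fields. -/

section Product

variable {E : Type*} [NormedAddCommGroup E] [NormedSpace ℝ E]
  {M : Type*} [TopologicalSpace M] [ChartedSpace E M] [IsManifold 𝓘(ℝ, E) ∞ M]
  {F : Type*} [NormedAddCommGroup F] [NormedSpace ℝ F]
  {N : Type*} [TopologicalSpace N] [ChartedSpace F N] [IsManifold 𝓘(ℝ, F) ∞ N]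
  {G H : Type*} [NormedAddCommGroup G] [NormedSpace ℝ G] [TopologicalSpace H]
  {I : ModelWithCorners ℝ G H} {Z : Type*} [TopologicalSpace Z] [ChartedSpace H Z]

lemma ContMDiffAt.tangentBundle_prodMk {f : Z → N} {g : Z → M}
    {X : Π z, TangentSpace 𝓘(ℝ, F) (f z)} {Y : Π z, TangentSpace 𝓘(ℝ, E) (g z)} {z₀ : Z}
    (hX : ContMDiffAt I 𝓘(ℝ, F).tangent ∞
      (fun z => (⟨f z, X z⟩ : TangentBundle 𝓘(ℝ, F) N)) z₀)
    (hY : ContMDiffAt I 𝓘(ℝ, E).tangent ∞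
      (fun z => (⟨g z, Y z⟩ : TangentBundle 𝓘(ℝ, E) M)) z₀) :
    ContMDiffAt I (𝓘(ℝ, F).prod 𝓘(ℝ, E)).tangent ∞
      (fun z => (⟨(f z, g z), (X z, Y z)⟩ :
        TangentBundle (𝓘(ℝ, F).prod 𝓘(ℝ, E)) (N × M))) z₀ := by
  have : IsManifold 𝓘(ℝ, E) 1 M := isManifold_one_of_infty E M
  have : IsManifold 𝓘(ℝ, F) 1 N := isManifold_one_of_infty F N
  have : IsManifold 𝓘(ℝ, E) (∞ + 1) M := inferInstanceAs (IsManifold 𝓘(ℝ, E) ∞ M)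
  have : IsManifold 𝓘(ℝ, F) (∞ + 1) N := inferInstanceAs (IsManifold 𝓘(ℝ, F) ∞ N)
  exact (contMDiff_equivTangentBundleProd_symm (I := 𝓘(ℝ, F)) (M := N) (I' := 𝓘(ℝ, E)) (M' := M)
    (n := ∞)).contMDiffAt.comp z₀ (hX.prodMk hY)

/-- A linear family of smooth vector fields, evaluated along smooth coefficients, is smooth. -/
lemma ContMDiffAt.linear_vectorField {A : Type*} [AddCommGroup A] [Module ℝ A]
    [FiniteDimensional ℝ A] {f : Z → M} (J : Π z, A →ₗ[ℝ] TangentSpace 𝓘(ℝ, E) (f z)) {z₀ : Z}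
    (hf : ContMDiffAt I 𝓘(ℝ, E) ∞ f z₀)
    (hJ : ∀ a, ContMDiffAt I 𝓘(ℝ, E).tangent ∞
      (fun z => (⟨f z, J z a⟩ : TangentBundle 𝓘(ℝ, E) M)) z₀) {a : Z → A}
    (ha : ∀ ℓ : Module.Dual ℝ A, ContMDiffAt I 𝓘(ℝ, ℝ) ∞ (fun z => ℓ (a z)) z₀) :
    ContMDiffAt I 𝓘(ℝ, E).tangent ∞
      (fun z => (⟨f z, J z (a z)⟩ : TangentBundle 𝓘(ℝ, E) M)) z₀ := by
  simp only [contMDiffAt_tangent_iff] at hJ ⊢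
  refine ⟨hf, ?_⟩
  let b := Module.finBasis ℝ A
  have key : (fun z => coordAt (E := E) (f z₀) (f z) (J z (a z))) =
      fun z => ∑ i, b.coord i (a z) • coordAt (E := E) (f z₀) (f z) (J z (b i)) := by
    funext z
    conv_lhs => rw [← b.sum_repr (a z)]
    simp only [map_sum, map_smul, Module.Basis.coord_apply]
  rw [key]
  exact ContMDiffAt.sum fun i _ => (ha (b.coord i)).smul (hJ (b i)).2

end Product

/-! ### Lagrangian families over a graph. -/

section LagrangianFamilies

open Filter Topology

variable {𝔡 : Type*} [LieRing 𝔡] [LieAlgebra ℝ 𝔡]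
  {E : Type*} [NormedAddCommGroup E] [NormedSpace ℝ E]
  {M : Type*} [TopologicalSpace M] [ChartedSpace E M] [IsManifold 𝓘(ℝ, E) ∞ M]
  {F : Type*} [NormedAddCommGroup F] [NormedSpace ℝ F]
  {N : Type*} [TopologicalSpace N] [ChartedSpace F N]

/-- A smooth family of Lagrangian subspaces over the graph of `μ` whose anchor maps onto the
tangent spaces of the graph. -/
structure IsLagrangianOverGraph (Q : QuadraticPairing 𝔡)
    (ρ : 𝔡 →ₗ[ℝ] Π n : N, TangentSpace 𝓘(ℝ, F) n) (μ : M → N)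
    (L : Π m : M, Submodule ℝ (CourantFibre 𝔡 E m)) : Prop where
  smooth : ∀ m, ∀ z ∈ L m, ∃ e : Π m : M, CourantFibre 𝔡 E m,
    IsSmoothSection 𝓘(ℝ, E) id e ∧ (∀ m', e m' ∈ L m') ∧ e m = z
  lagrangian : ∀ m z, z ∈ L m ↔ ∀ w ∈ L m, courantPairing Q z w = 0
  anchor_mem : ∀ m, ∀ z ∈ L m, ρ z.1 (μ m) = mfderiv 𝓘(ℝ, E) 𝓘(ℝ, F) μ m z.2.1
  anchor_surjective : ∀ m (v : TangentSpace 𝓘(ℝ, E) m), ∃ z ∈ L m, z.2.1 = v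

variable {Q : QuadraticPairing 𝔡} {ρ : 𝔡 →ₗ[ℝ] Π n : N, TangentSpace 𝓘(ℝ, F) n} {μ : M → N}
  {L : Π m : M, Submodule ℝ (CourantFibre 𝔡 E m)}

lemma IsDiracOnGraph.isLagrangianOverGraph (h : IsDiracOnGraph Q ρ μ L)
    (h' : IsExactOnGraph Q ρ μ L) : IsLagrangianOverGraph Q ρ μ L where
  smooth := h.smooth
  lagrangian := h.lagrangian
  anchor_mem := h'.anchor_mem
  anchor_surjective m v := by
    obtain ⟨z, hz, h1⟩ := h'.anchor_surjective m v
    exact ⟨z, hz, congrArg Prod.snd h1⟩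

lemma IsLagrangianOverGraph.form_eq (hL : IsLagrangianOverGraph Q ρ μ L) {m : M}
    {z w : CourantFibre 𝔡 E m} (hz : z ∈ L m) (hw : w ∈ L m) :
    Q.form z.1 w.1 = z.2.2 w.2.1 + w.2.2 z.2.1 :=
  sub_eq_zero.1 ((hL.lagrangian m z).1 hz w hw)

variable {G H : Type*} [NormedAddCommGroup G] [NormedSpace ℝ G] [TopologicalSpace H]
  {I : ModelWithCorners ℝ G H} {Z : Type*} [TopologicalSpace Z] [ChartedSpace H Z]

lemma contMDiffAt_coord_comp {f : Z → M} {s : Π m : M, TangentSpace 𝓘(ℝ, E) m} {z₀ : Z}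
    (hf : ContMDiffAt I 𝓘(ℝ, E) ∞ f z₀) (hs : IsSmoothVectorField s) :
    ContMDiffAt I 𝓘(ℝ, E) ∞ (fun z => coordAt (E := E) (f z₀) (f z) (s (f z))) z₀ :=
  (contMDiffAt_tangent_iff.1 ((hs (f z₀)).comp z₀ hf)).2

/-- The covector part of a section of a Lagrangian family is smooth if the other parts are. -/
theorem IsLagrangianOverGraph.isSmoothSectionAt [FiniteDimensional ℝ 𝔡] [FiniteDimensional ℝ E]
    (hL : IsLagrangianOverGraph Q ρ μ L) {f : Z → M} {e : Π z : Z, CourantFibre 𝔡 E (f z)} {z₀ : Z}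
    (hmem : ∀ᶠ z in 𝓝 z₀, e z ∈ L (f z))
    (halg : ∀ ℓ : Module.Dual ℝ 𝔡, ContMDiffAt I 𝓘(ℝ, ℝ) ∞ (fun z => ℓ (e z).1) z₀)
    (hvec : ContMDiffAt I 𝓘(ℝ, E).tangent ∞
      (fun z => (⟨f z, (e z).2.1⟩ : TangentBundle 𝓘(ℝ, E) M)) z₀) :
    IsSmoothSectionAt I f e z₀ := by
  refine ⟨halg, hvec, ?_⟩
  have hf := (contMDiffAt_tangent_iff.1 hvec).1
  rw [contMDiffAt_cotangent_iff]
  refine ⟨hf, ?_⟩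
  let b := Module.finBasis ℝ E
  -- Sections `s i` of `L` whose vector parts form a frame at `f z₀`, hence nearby. `T` writes this
  -- frame in coordinates and is the identity at the base point.
  choose w hw hwb using fun i => hL.anchor_surjective (f z₀) (b i)
  choose s hs hsL hsw using fun i => hL.smooth (f z₀) (w i) (hw i)
  let T : M → E →L[ℝ] E := fun m =>
    ∑ i, (LinearMap.toContinuousLinearMap (b.coord i)).smulRight
      (coordAt (E := E) (f z₀) m ((s i m).2.1))
  have hT : ∀ m a, T m a = coordAt (E := E) (f z₀) m (∑ i, b.repr a i • (s i m).2.1) := by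
    intro m a
    simp only [T, sum_apply, ContinuousLinearMap.smulRight_apply,
      LinearMap.coe_toContinuousLinearMap', b.coord_apply, map_sum, map_smul]
  have hTs : ContMDiffAt I 𝓘(ℝ, E →L[ℝ] E) ∞ (fun z => T (f z)) z₀ := by
    refine contMDiffAt_clm_of_apply fun a => ?_
    simp only [hT, map_sum, map_smul]
    have hterm : ∀ i, ContMDiffAt I 𝓘(ℝ, E) ∞
        (fun z => b.repr a i • coordAt (E := E) (f z₀) (f z) ((s i (f z)).2.1)) z₀ := fun i =>
      (contMDiffAt_const : ContMDiffAt I 𝓘(ℝ, ℝ) ∞ (fun _ => b.repr a i) z₀).smul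
        (contMDiffAt_coord_comp hf (hs i).vector)
    exact ContMDiffAt.sum fun i _ => hterm i
  have hT0 : T (f z₀) = ContinuousLinearMap.id ℝ E := by
    ext a
    rw [hT, coordAt_self]
    have h1 : ∀ i, (s i (f z₀)).2.1 = b i := fun i => by rw [hsw, hwb]
    simp only [h1]
    exact b.sum_repr a
  refine ContMDiffAt.of_comp_clm hTs (by rw [hT0]; exact ⟨ContinuousLinearEquiv.refl ℝ E, rfl⟩) ?_
  refine contMDiffAt_clm_of_apply fun a => ?_
  -- Isotropy expresses the covector part of `e` on the frame through data already known to be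
  -- smooth: the algebra parts, the covectors of the `s i`, and the vector part of `e`.
  have key : ∀ᶠ z in 𝓝 z₀, (((e z).2.2).comp (coordAt (E := E) (f z₀) (f z)).inverse).comp (T (f z)) a
      = ∑ i, b.repr a i • (Q.form (e z).1 (s i (f z)).1 - (s i (f z)).2.2 (e z).2.1) := by
    filter_upwards [hmem, eventually_mem_chartAt (E := E) hf.continuousAt] with z hz hz'
    obtain ⟨c, hc⟩ := coordAt_isInvertible (E := E) hz'
    rw [ContinuousLinearMap.comp_apply, hT, ← hc]
    simp only [ContinuousLinearMap.comp_apply, ContinuousLinearMap.inverse_equiv,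
      ContinuousLinearEquiv.coe_coe, ContinuousLinearEquiv.symm_apply_apply, map_sum, map_smul]
    refine Finset.sum_congr rfl fun i _ => ?_
    rw [hL.form_eq hz (hsL i (f z)), add_sub_cancel_right]
  have hterm : ∀ i, ContMDiffAt I 𝓘(ℝ, ℝ) ∞ (fun z => b.repr a i •
      (Q.form (e z).1 (s i (f z)).1 - (s i (f z)).2.2 (e z).2.1)) z₀ := fun i =>
    (contMDiffAt_const : ContMDiffAt I 𝓘(ℝ, ℝ) ∞ (fun _ => b.repr a i) z₀).smul (ContMDiffAt.sub
      (ContMDiffAt.bilinForm Q.form halg fun ℓ => ((hs i).algebra ℓ (f z₀)).comp z₀ hf)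
      (ContMDiffAt.cotangent_apply (((hs i).covector (f z₀)).comp z₀ hf) hvec))
  exact (ContMDiffAt.sum fun i _ => hterm i).congr_of_eventuallyEq key

end LagrangianFamilies

/-! ### The bracket pairing along a parametrized map. -/

section Parametric

variable {𝔡 : Type*} [LieRing 𝔡] [LieAlgebra ℝ 𝔡]
  {V : Type*} [NormedAddCommGroup V] [NormedSpace ℝ V]
  {E : Type*} [NormedAddCommGroup E] [NormedSpace ℝ E]

/-- The bracket pairing of three sections along a parametrized map whose vector parts are the
coordinate derivatives in the directions `v₁, v₂, v₃`; `aᵢⱼ` is the `i`-th covector part applied to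
the `j`-th vector part. -/
noncomputable def parametricBracket (Q : QuadraticPairing 𝔡) (t v₁ v₂ v₃ : V)
    (ξ₁ ξ₂ ξ₃ : V → 𝔡) (a₁₂ a₁₃ a₂₃ : V → ℝ) : ℝ :=
  Q.form ⁅ξ₁ t, ξ₂ t⁆ (ξ₃ t) + fderiv ℝ (fun s => Q.form (ξ₂ s) (ξ₃ t)) t v₁
    - fderiv ℝ (fun s => Q.form (ξ₁ s) (ξ₃ t)) t v₂ + fderiv ℝ (fun s => Q.form (ξ₁ s) (ξ₂ t)) t v₃
    - (fderiv ℝ a₂₃ t v₁ - fderiv ℝ a₁₃ t v₂ + fderiv ℝ a₁₂ t v₃)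

open Filter Topology

/-- Differentiate the isotropy relations of two sections, equal at `t`, against a common third
section, and subtract. Derivatives of the third section are multiplied by values at `t` of the first
two and cancel. -/
lemma fderiv_isotropy [FiniteDimensional ℝ 𝔡] (Q : QuadraticPairing 𝔡) {t : V}
    {ξ x η : V → 𝔡} {X Y W : V → E} {α β γ : V → E →L[ℝ] ℝ}
    (hξ : ∀ ℓ : Module.Dual ℝ 𝔡, DifferentiableAt ℝ (fun s => ℓ (ξ s)) t)
    (hx : ∀ ℓ : Module.Dual ℝ 𝔡, DifferentiableAt ℝ (fun s => ℓ (x s)) t)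
    (hη : ∀ ℓ : Module.Dual ℝ 𝔡, DifferentiableAt ℝ (fun s => ℓ (η s)) t)
    (hX : DifferentiableAt ℝ X t) (hY : DifferentiableAt ℝ Y t) (hW : DifferentiableAt ℝ W t)
    (hα : DifferentiableAt ℝ α t) (hβ : DifferentiableAt ℝ β t) (hγ : DifferentiableAt ℝ γ t)
    (e₁ : ξ t = x t) (e₂ : X t = Y t) (e₃ : α t = β t)
    (h₁ : ∀ᶠ s in 𝓝 t, Q.form (ξ s) (η s) = α s (W s) + γ s (X s))
    (h₂ : ∀ᶠ s in 𝓝 t, Q.form (x s) (η s) = β s (W s) + γ s (Y s)) (v : V) :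
    fderiv ℝ (fun s => Q.form (ξ s) (η t)) t v - fderiv ℝ (fun s => Q.form (x s) (η t)) t v =
      fderiv ℝ α t v (W t) - fderiv ℝ β t v (W t) + γ t (fderiv ℝ X t v) - γ t (fderiv ℝ Y t v) := by
  have d₁ := (DifferentiableAt.bilinForm Q.form hξ hη).2 v
  have d₂ := (DifferentiableAt.bilinForm Q.form hx hη).2 v
  rw [Filter.EventuallyEq.fderiv_eq h₁,
    ((hα.hasFDerivAt.clm_apply hW.hasFDerivAt).fun_add (hγ.hasFDerivAt.clm_apply hX.hasFDerivAt)).fderiv]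
    at d₁
  rw [Filter.EventuallyEq.fderiv_eq h₂,
    ((hβ.hasFDerivAt.clm_apply hW.hasFDerivAt).fun_add (hγ.hasFDerivAt.clm_apply hY.hasFDerivAt)).fderiv]
    at d₂
  simp only [add_apply, ContinuousLinearMap.comp_apply,
    ContinuousLinearMap.flip_apply] at d₁ d₂
  rw [e₁, e₂, e₃] at d₁
  linarith

/-- The bracket pairing does not depend on the way in which sections extend given values. -/
lemma parametricBracket_eq [FiniteDimensional ℝ 𝔡] (Q : QuadraticPairing 𝔡) {t v₁ v₂ v₃ : V}
    {ξ₁ ξ₂ ξ₃ x₁ x₂ x₃ : V → 𝔡} {X₁ X₂ X₃ Y₁ Y₂ Y₃ : V → E} {α₁ α₂ β₁ β₂ β₃ : V → E →L[ℝ] ℝ}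
    (hξ₁ : ∀ ℓ : Module.Dual ℝ 𝔡, DifferentiableAt ℝ (fun s => ℓ (ξ₁ s)) t)
    (hξ₂ : ∀ ℓ : Module.Dual ℝ 𝔡, DifferentiableAt ℝ (fun s => ℓ (ξ₂ s)) t)
    (hx₁ : ∀ ℓ : Module.Dual ℝ 𝔡, DifferentiableAt ℝ (fun s => ℓ (x₁ s)) t)
    (hx₂ : ∀ ℓ : Module.Dual ℝ 𝔡, DifferentiableAt ℝ (fun s => ℓ (x₂ s)) t)
    (hx₃ : ∀ ℓ : Module.Dual ℝ 𝔡, DifferentiableAt ℝ (fun s => ℓ (x₃ s)) t)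
    (hX₁ : DifferentiableAt ℝ X₁ t) (hX₂ : DifferentiableAt ℝ X₂ t) (hX₃ : DifferentiableAt ℝ X₃ t)
    (hY₁ : DifferentiableAt ℝ Y₁ t) (hY₂ : DifferentiableAt ℝ Y₂ t) (hY₃ : DifferentiableAt ℝ Y₃ t)
    (hα₁ : DifferentiableAt ℝ α₁ t) (hα₂ : DifferentiableAt ℝ α₂ t)
    (hβ₁ : DifferentiableAt ℝ β₁ t) (hβ₂ : DifferentiableAt ℝ β₂ t) (hβ₃ : DifferentiableAt ℝ β₃ t)
    (eξ₁ : ξ₁ t = x₁ t) (eξ₂ : ξ₂ t = x₂ t) (eξ₃ : ξ₃ t = x₃ t)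
    (eX₁ : X₁ t = Y₁ t) (eX₂ : X₂ t = Y₂ t) (eX₃ : X₃ t = Y₃ t)
    (eα₁ : α₁ t = β₁ t) (eα₂ : α₂ t = β₂ t)
    (s₁₂ : fderiv ℝ X₂ t v₁ = fderiv ℝ X₁ t v₂) (s₁₃ : fderiv ℝ X₃ t v₁ = fderiv ℝ X₁ t v₃)
    (s₂₃ : fderiv ℝ X₃ t v₂ = fderiv ℝ X₂ t v₃)
    (ef₁₂ : ∀ᶠ s in 𝓝 t, Q.form (ξ₁ s) (x₂ s) = α₁ s (Y₂ s) + β₂ s (X₁ s))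
    (ef₁₃ : ∀ᶠ s in 𝓝 t, Q.form (ξ₁ s) (x₃ s) = α₁ s (Y₃ s) + β₃ s (X₁ s))
    (ef₂₃ : ∀ᶠ s in 𝓝 t, Q.form (ξ₂ s) (x₃ s) = α₂ s (Y₃ s) + β₃ s (X₂ s))
    (ff₁₂ : ∀ᶠ s in 𝓝 t, Q.form (x₁ s) (x₂ s) = β₁ s (Y₂ s) + β₂ s (Y₁ s))
    (ff₁₃ : ∀ᶠ s in 𝓝 t, Q.form (x₁ s) (x₃ s) = β₁ s (Y₃ s) + β₃ s (Y₁ s))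
    (ff₂₃ : ∀ᶠ s in 𝓝 t, Q.form (x₂ s) (x₃ s) = β₂ s (Y₃ s) + β₃ s (Y₂ s)) :
    parametricBracket Q t v₁ v₂ v₃ ξ₁ ξ₂ ξ₃ (fun s => α₁ s (X₂ s)) (fun s => α₁ s (X₃ s))
      (fun s => α₂ s (X₃ s)) =
    Q.form ⁅x₁ t, x₂ t⁆ (x₃ t) + fderiv ℝ (fun s => Q.form (x₂ s) (x₃ t)) t v₁
    - fderiv ℝ (fun s => Q.form (x₁ s) (x₃ t)) t v₂ + fderiv ℝ (fun s => Q.form (x₁ s) (x₂ t)) t v₃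
    - (β₃ t (fderiv ℝ Y₂ t v₁ - fderiv ℝ Y₁ t v₂)
      + (fderiv ℝ (fun s => β₂ s (Y₃ s)) t v₁ - β₂ t (fderiv ℝ Y₃ t v₁ - fderiv ℝ Y₁ t v₃))
      - (fderiv ℝ (fun s => β₁ s (Y₃ s)) t v₂ - fderiv ℝ (fun s => β₁ s (Y₂ s)) t v₃
        - β₁ t (fderiv ℝ Y₃ t v₂ - fderiv ℝ Y₂ t v₃))) := by
  -- Each relation trades derivatives of a section along the map for those of an extended section
  -- with the same value. The covector derivatives then match, and the leftover derivatives of the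
  -- vector parts cancel by the symmetry hypotheses.
  have i₁ := fderiv_isotropy Q hξ₂ hx₂ hx₃ hX₂ hY₂ hY₃ hα₂ hβ₂ hβ₃ eξ₂ eX₂ eα₂ ef₂₃ ff₂₃ v₁
  have i₂ := fderiv_isotropy Q hξ₁ hx₁ hx₃ hX₁ hY₁ hY₃ hα₁ hβ₁ hβ₃ eξ₁ eX₁ eα₁ ef₁₃ ff₁₃ v₂
  have i₃ := fderiv_isotropy Q hξ₁ hx₁ hx₂ hX₁ hY₁ hY₂ hα₁ hβ₁ hβ₂ eξ₁ eX₁ eα₁ ef₁₂ ff₁₂ v₃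
  unfold parametricBracket
  rw [(hα₂.hasFDerivAt.clm_apply hX₃.hasFDerivAt).fderiv,
    (hα₁.hasFDerivAt.clm_apply hX₃.hasFDerivAt).fderiv,
    (hα₁.hasFDerivAt.clm_apply hX₂.hasFDerivAt).fderiv,
    (hβ₂.hasFDerivAt.clm_apply hY₃.hasFDerivAt).fderiv,
    (hβ₁.hasFDerivAt.clm_apply hY₃.hasFDerivAt).fderiv,
    (hβ₁.hasFDerivAt.clm_apply hY₂.hasFDerivAt).fderiv, eξ₁, eξ₂, eξ₃]
  simp only [add_apply, ContinuousLinearMap.comp_apply,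
    ContinuousLinearMap.flip_apply, map_sub, eX₂, eX₃, eα₁, eα₂, s₁₃, s₂₃]
  rw [s₁₂] at i₁
  linarith

end Parametric

/-! ### Comparison of the Courant bracket with the parametric bracket. -/

section Comparison

open Filter Topology

section

variable {V : Type*} [NormedAddCommGroup V] [NormedSpace ℝ V]
  {G H : Type*} [NormedAddCommGroup G] [NormedSpace ℝ G] [TopologicalSpace H]
  {I : ModelWithCorners ℝ G H} {Z : Type*} [TopologicalSpace Z] [ChartedSpace H Z]

lemma fderiv_comp_eq_dirDeriv {f : Z → ℝ} {g : V → Z} {t v : V} {w : TangentSpace I (g t)}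
    (hf : MDifferentiableAt I 𝓘(ℝ, ℝ) f (g t)) (hg : MDifferentiableAt 𝓘(ℝ, V) I g t)
    (hw : mfderiv 𝓘(ℝ, V) I g t v = w) :
    fderiv ℝ (fun s => f (g s)) t v = dirDeriv I f (g t) w := by
  have h := mfderiv_comp t hf hg
  rw [mfderiv_eq_fderiv] at h
  rw [← hw]
  exact congrArg (fun T : V →L[ℝ] ℝ => T v) h

end

variable {𝔡 : Type*} [LieRing 𝔡] [LieAlgebra ℝ 𝔡]
  {V : Type*} [NormedAddCommGroup V] [NormedSpace ℝ V]
  {E : Type*} [NormedAddCommGroup E] [NormedSpace ℝ E]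
  {M : Type*} [TopologicalSpace M] [ChartedSpace E M] [IsManifold 𝓘(ℝ, E) ∞ M]
  {F : Type*} [NormedAddCommGroup F] [NormedSpace ℝ F]
  {N : Type*} [TopologicalSpace N] [ChartedSpace F N] [IsManifold 𝓘(ℝ, F) ∞ N]

lemma dirDeriv_dual_comp_snd (ℓ : E →L[ℝ] ℝ) {m₀ : M} {r : N × M}
    (hr : r.2 ∈ (chartAt E m₀).source) (w : TangentSpace (𝓘(ℝ, F).prod 𝓘(ℝ, E)) r) :
    dirDeriv (𝓘(ℝ, F).prod 𝓘(ℝ, E)) (fun r : N × M => ℓ (extChartAt 𝓘(ℝ, E) m₀ r.2)) r w =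
      ℓ (coordAt (E := E) m₀ r.2 w.2) := by
  have h := dirDeriv_comp (I := 𝓘(ℝ, F).prod 𝓘(ℝ, E)) (φ := (Prod.snd : N × M → M)) (z := r)
    ((contMDiffAt_dual_comp_extChartAt ℓ hr).mdifferentiableAt (by simp)) mdifferentiableAt_snd w
  refine h.trans ?_
  rw [dirDeriv_dual_comp_extChartAt ℓ hr, mfderiv_snd]
  rfl

/-- The commutator formula for the test function `γ ∘ chart ∘ snd`. The outer derivatives are taken
in directions tangent to `g`, so they depend only on the restrictions of `A` and `B` to the image of
`g`. -/
lemma dual_mlieBracket_snd [CompleteSpace E] [CompleteSpace F]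
    {A B : Π r : N × M, TangentSpace (𝓘(ℝ, F).prod 𝓘(ℝ, E)) r}
    {g : V → N × M} {t v w : V} (γ : E →L[ℝ] ℝ)
    (hA : ContMDiffAt (𝓘(ℝ, F).prod 𝓘(ℝ, E)) (𝓘(ℝ, F).prod 𝓘(ℝ, E)).tangent ∞
      (fun r => (⟨r, A r⟩ : TangentBundle (𝓘(ℝ, F).prod 𝓘(ℝ, E)) (N × M))) (g t))
    (hB : ContMDiffAt (𝓘(ℝ, F).prod 𝓘(ℝ, E)) (𝓘(ℝ, F).prod 𝓘(ℝ, E)).tangent ∞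
      (fun r => (⟨r, B r⟩ : TangentBundle (𝓘(ℝ, F).prod 𝓘(ℝ, E)) (N × M))) (g t))
    (hA' : ContMDiffAt (𝓘(ℝ, F).prod 𝓘(ℝ, E)) 𝓘(ℝ, E).tangent ∞
      (fun r => (⟨r.2, (A r).2⟩ : TangentBundle 𝓘(ℝ, E) M)) (g t))
    (hB' : ContMDiffAt (𝓘(ℝ, F).prod 𝓘(ℝ, E)) 𝓘(ℝ, E).tangent ∞
      (fun r => (⟨r.2, (B r).2⟩ : TangentBundle 𝓘(ℝ, E) M)) (g t))
    (hg : MDifferentiableAt 𝓘(ℝ, V) (𝓘(ℝ, F).prod 𝓘(ℝ, E)) g t)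
    (hv : mfderiv 𝓘(ℝ, V) (𝓘(ℝ, F).prod 𝓘(ℝ, E)) g t v = A (g t))
    (hw : mfderiv 𝓘(ℝ, V) (𝓘(ℝ, F).prod 𝓘(ℝ, E)) g t w = B (g t)) :
    γ (VectorField.mlieBracket (𝓘(ℝ, F).prod 𝓘(ℝ, E)) A B (g t)).2 =
      γ (fderiv ℝ (fun s => coordAt (E := E) (g t).2 (g s).2 (B (g s)).2) t v
        - fderiv ℝ (fun s => coordAt (E := E) (g t).2 (g s).2 (A (g s)).2) t w) := by
  have h2 : (2 : WithTop ℕ∞) ≤ ∞ := WithTop.coe_le_coe.2 (le_top : (2 : ℕ∞) ≤ ⊤)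
  have : IsManifold 𝓘(ℝ, E) 2 M := IsManifold.of_le (n := ∞) h2
  have : IsManifold 𝓘(ℝ, F) 2 N := IsManifold.of_le (n := ∞) h2
  set f : N × M → ℝ := fun r => γ (extChartAt 𝓘(ℝ, E) (g t).2 r.2) with hf
  have hfs : ContMDiffAt (𝓘(ℝ, F).prod 𝓘(ℝ, E)) 𝓘(ℝ, ℝ) 2 f (g t) :=
    ((contMDiffAt_dual_comp_extChartAt γ (mem_chart_source E (g t).2)).of_le h2).comp (g t)
      contMDiffAt_snd
  have key : ∀ (C : Π r : N × M, TangentSpace (𝓘(ℝ, F).prod 𝓘(ℝ, E)) r) (u : V)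
      (W : TangentSpace (𝓘(ℝ, F).prod 𝓘(ℝ, E)) (g t)),
      ContMDiffAt (𝓘(ℝ, F).prod 𝓘(ℝ, E)) 𝓘(ℝ, E).tangent ∞
        (fun r => (⟨r.2, (C r).2⟩ : TangentBundle 𝓘(ℝ, E) M)) (g t) →
      mfderiv 𝓘(ℝ, V) (𝓘(ℝ, F).prod 𝓘(ℝ, E)) g t u = W →
      dirDeriv (𝓘(ℝ, F).prod 𝓘(ℝ, E)) (fun y => dirDeriv (𝓘(ℝ, F).prod 𝓘(ℝ, E)) f y (C y)) (g t) W
        = γ (fderiv ℝ (fun s => coordAt (E := E) (g t).2 (g s).2 (C (g s)).2) t u) := by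
    intro C u W hC hW
    have hC2 := (contMDiffAt_tangent_iff.1 hC).2
    have hev : (fun y => dirDeriv (𝓘(ℝ, F).prod 𝓘(ℝ, E)) f y (C y)) =ᶠ[𝓝 (g t)]
        fun y => γ (coordAt (E := E) (g t).2 y.2 (C y).2) := by
      filter_upwards [eventually_mem_chartAt (E := E) (f := (Prod.snd : N × M → M)) (z₀ := g t)
        continuousAt_snd] with y hy
      exact dirDeriv_dual_comp_snd γ hy (C y)
    have hd : MDifferentiableAt (𝓘(ℝ, F).prod 𝓘(ℝ, E)) 𝓘(ℝ, ℝ)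
        (fun y => dirDeriv (𝓘(ℝ, F).prod 𝓘(ℝ, E)) f y (C y)) (g t) :=
      ((γ.contDiff.contMDiff.contMDiffAt.comp (g t) hC2).congr_of_eventuallyEq
        hev).mdifferentiableAt (by simp)
    rw [← fderiv_comp_eq_dirDeriv hd hg hW]
    have hev' := hg.continuousAt.eventually hev
    rw [Filter.EventuallyEq.fderiv_eq (f := fun s => γ (coordAt (E := E) (g t).2 (g s).2 (C (g s)).2)) hev']
    have hdE : MDifferentiableAt 𝓘(ℝ, V) 𝓘(ℝ, E)
        (fun s => coordAt (E := E) (g t).2 (g s).2 (C (g s)).2) t :=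
      MDifferentiableAt.comp (I' := 𝓘(ℝ, F).prod 𝓘(ℝ, E))
        (g := fun y : N × M => (coordAt (E := E) (g t).2 y.2 (C y).2 : E)) t
        (hC2.mdifferentiableAt (by simp)) hg
    have := (γ.hasFDerivAt.comp t (mdifferentiableAt_iff_differentiableAt.1 hdE).hasFDerivAt).fderiv
    exact congrArg (fun T : V →L[ℝ] ℝ => T u) this
  have h1 := dirDeriv_dual_comp_snd (N := N) (F := F) γ (mem_chart_source E (g t).2)
    (VectorField.mlieBracket (𝓘(ℝ, F).prod 𝓘(ℝ, E)) A B (g t))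
  replace h1 := h1.trans (congrArg γ (coordAt_self (E := E) (g t).2 _))
  rw [← h1, mfderiv_mlieBracket_apply hfs (hA.mdifferentiableAt (by simp))
    (hB.mdifferentiableAt (by simp)), key B v _ hB' hv, key A w _ hA' hw, map_sub]

/-- `(ξ, dφ v, α)` is a section of the family `L` along `φ`, with smooth `ξ`, near `t`. -/
structure IsSectionAlong (L : Π m : M, Submodule ℝ (CourantFibre 𝔡 E m)) (φ : V → M) (t v : V)
    (ξ : V → 𝔡) (α : Π s, TangentSpace 𝓘(ℝ, E) (φ s) →L[ℝ] ℝ) : Prop where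
  smooth : ∀ ℓ : Module.Dual ℝ 𝔡, ContDiffAt ℝ ∞ (fun s => ℓ (ξ s)) t
  mem : ∀ᶠ s in 𝓝 t, ((ξ s, mfderiv 𝓘(ℝ, V) 𝓘(ℝ, E) φ s v, α s) : CourantFibre 𝔡 E (φ s)) ∈ L (φ s)

variable {Q : QuadraticPairing 𝔡} {ρ : 𝔡 →ₗ[ℝ] Π n : N, TangentSpace 𝓘(ℝ, F) n} {μ : M → N}
  {L : Π m : M, Submodule ℝ (CourantFibre 𝔡 E m)}

lemma IsSectionAlong.isSmoothSectionAt [FiniteDimensional ℝ 𝔡] [FiniteDimensional ℝ E]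
    (hL : IsLagrangianOverGraph Q ρ μ L) {φ : V → M} {t v : V}
    (hφ : ContMDiffAt 𝓘(ℝ, V) 𝓘(ℝ, E) ∞ φ t) {ξ : V → 𝔡}
    {α : Π s, TangentSpace 𝓘(ℝ, E) (φ s) →L[ℝ] ℝ} (h : IsSectionAlong L φ t v ξ α) :
    IsSmoothSectionAt 𝓘(ℝ, V) φ
      (fun s => ((ξ s, mfderiv 𝓘(ℝ, V) 𝓘(ℝ, E) φ s v, α s) : CourantFibre 𝔡 E (φ s))) t :=
  hL.isSmoothSectionAt h.mem (fun ℓ => (h.smooth ℓ).contMDiffAt) (contMDiffAt_mfderiv_apply hφ v)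

/-- In a chart, the isotropy of a Lagrangian family. -/
lemma IsLagrangianOverGraph.form_eq_coord (hL : IsLagrangianOverGraph Q ρ μ L) {m₀ m : M}
    (hm : m ∈ (chartAt E m₀).source)
    {z w : CourantFibre 𝔡 E m} (hz : z ∈ L m) (hw : w ∈ L m) :
    Q.form z.1 w.1 = (z.2.2.comp (coordAt (E := E) m₀ m).inverse : E →L[ℝ] ℝ) (coordAt (E := E) m₀ m w.2.1)
      + (w.2.2.comp (coordAt (E := E) m₀ m).inverse : E →L[ℝ] ℝ) (coordAt (E := E) m₀ m z.2.1) := by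
  obtain ⟨c, hc⟩ := coordAt_isInvertible (E := E) hm
  rw [hL.form_eq hz hw, ← hc]
  simp

lemma comp_inverse_coordAt {m₀ m : M} (hm : m ∈ (chartAt E m₀).source)
    (α : TangentSpace 𝓘(ℝ, E) m →L[ℝ] ℝ) (X : TangentSpace 𝓘(ℝ, E) m) :
    (α.comp (coordAt (E := E) m₀ m).inverse : E →L[ℝ] ℝ) (coordAt (E := E) m₀ m X) = α X := by
  obtain ⟨c, hc⟩ := coordAt_isInvertible (E := E) hm
  rw [← hc]
  simp

lemma contMDiffAt_courantAnchor [FiniteDimensional ℝ 𝔡] (hρ : ∀ ξ, IsSmoothVectorField (ρ ξ))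
    {f : Π q : N × M, CourantFibre 𝔡 E q.2}
    (hf : IsSmoothSection (𝓘(ℝ, F).prod 𝓘(ℝ, E)) Prod.snd f) (q : N × M) :
    ContMDiffAt (𝓘(ℝ, F).prod 𝓘(ℝ, E)) (𝓘(ℝ, F).prod 𝓘(ℝ, E)).tangent ∞
      (fun r => (⟨r, courantAnchor ρ r.1 r.2 (f r)⟩ :
        TangentBundle (𝓘(ℝ, F).prod 𝓘(ℝ, E)) (N × M))) q := by
  refine ContMDiffAt.tangentBundle_prodMk (f := Prod.fst) (g := Prod.snd) ?_ (hf.vector q)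
  exact ContMDiffAt.linear_vectorField (f := (Prod.fst : N × M → N))
    (fun r : N × M => (LinearMap.proj r.1).comp ρ) contMDiffAt_fst
    (fun a => (hρ a q.1).comp q contMDiffAt_fst) fun ℓ => hf.algebra ℓ q

/-- The anchor of an element of `L` is tangent to the graph of `μ`, hence determined by its
component in `TM`. This turns derivatives along anchors into directional derivatives in the
parameter space. -/
lemma mfderiv_graph_eq_anchor (hL : IsLagrangianOverGraph Q ρ μ L)
    (hμ : ContMDiff 𝓘(ℝ, E) 𝓘(ℝ, F) ∞ μ) {φ : V → M} {t v : V}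
    (hφ : ContMDiffAt 𝓘(ℝ, V) 𝓘(ℝ, E) ∞ φ t) {z : CourantFibre 𝔡 E (φ t)} (hz : z ∈ L (φ t))
    (hv : z.2.1 = mfderiv 𝓘(ℝ, V) 𝓘(ℝ, E) φ t v) :
    mfderiv 𝓘(ℝ, V) (𝓘(ℝ, F).prod 𝓘(ℝ, E)) (fun s => (μ (φ s), φ s)) t v =
      courantAnchor ρ (μ (φ t)) (φ t) z := by
  have hφd := hφ.mdifferentiableAt (by simp)
  have hμd : MDifferentiableAt 𝓘(ℝ, E) 𝓘(ℝ, F) μ (φ t) := hμ.mdifferentiable (by simp) _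
  have h1 := mfderiv_prodMk (hμd.comp t hφd) hφd
  have h2 := mfderiv_comp t hμd hφd
  have h3 : mfderiv 𝓘(ℝ, V) 𝓘(ℝ, F) (fun s => μ (φ s)) t v = ρ z.1 (μ (φ t)) := by
    rw [hL.anchor_mem _ z hz, hv]
    exact congrArg (fun T : V →L[ℝ] TangentSpace 𝓘(ℝ, F) (μ (φ t)) => T v) h2
  have h4 := congrArg (fun T : V →L[ℝ] TangentSpace (𝓘(ℝ, F).prod 𝓘(ℝ, E)) (μ (φ t), φ t) => T v) h1
  refine h4.trans ?_
  exact Prod.ext h3 hv.symm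

lemma IsSmoothSection.differentiableAt_graph [FiniteDimensional ℝ E]
    (hμ : ContMDiff 𝓘(ℝ, E) 𝓘(ℝ, F) ∞ μ)
    {f : Π q : N × M, CourantFibre 𝔡 E q.2}
    (hf : IsSmoothSection (𝓘(ℝ, F).prod 𝓘(ℝ, E)) Prod.snd f) {φ : V → M} {t : V}
    (hφ : ContMDiffAt 𝓘(ℝ, V) 𝓘(ℝ, E) ∞ φ t) :
    (∀ ℓ : Module.Dual ℝ 𝔡, DifferentiableAt ℝ (fun s => ℓ (f (μ (φ s), φ s)).1) t) ∧
    DifferentiableAt ℝ (fun s => coordAt (E := E) (φ t) (φ s) (f (μ (φ s), φ s)).2.1) t ∧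
    DifferentiableAt ℝ (fun s => ((f (μ (φ s), φ s)).2.2.comp
      (coordAt (E := E) (φ t) (φ s)).inverse : E →L[ℝ] ℝ)) t := by
  have hg : ContMDiffAt 𝓘(ℝ, V) (𝓘(ℝ, F).prod 𝓘(ℝ, E)) ∞ (fun s => (μ (φ s), φ s)) t :=
    ((hμ (φ t)).comp t hφ).prodMk hφ
  refine ⟨fun ℓ => ?_, ?_, ?_⟩
  · exact ((contMDiffAt_iff_contDiffAt.1 ((hf.algebra ℓ _).comp t hg))).differentiableAt (by simp)
  · have h := (contMDiffAt_tangent_iff.1 ((hf.vector _).comp t hg)).2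
    exact (contMDiffAt_iff_contDiffAt.1 h).differentiableAt (by simp)
  · have h := (contMDiffAt_cotangent_iff.1 ((hf.covector _).comp t hg)).2
    exact (contMDiffAt_iff_contDiffAt.1 h).differentiableAt (by simp)

/-- The Courant bracket pairing of sections of a Lagrangian family can be computed from any
sections along a map with the same values. -/
theorem courantBracketPairing_eq_parametricBracket [FiniteDimensional ℝ 𝔡] [FiniteDimensional ℝ E]
    [FiniteDimensional ℝ F]
    (hρ : ∀ ξ, IsSmoothVectorField (ρ ξ)) (hμ : ContMDiff 𝓘(ℝ, E) 𝓘(ℝ, F) ∞ μ)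
    (hL : IsLagrangianOverGraph Q ρ μ L)
    {f₁ f₂ f₃ : Π q : N × M, CourantFibre 𝔡 E q.2}
    (hf₁ : IsSmoothSection (𝓘(ℝ, F).prod 𝓘(ℝ, E)) Prod.snd f₁)
    (hf₂ : IsSmoothSection (𝓘(ℝ, F).prod 𝓘(ℝ, E)) Prod.snd f₂)
    (hf₃ : IsSmoothSection (𝓘(ℝ, F).prod 𝓘(ℝ, E)) Prod.snd f₃)
    (hfL₁ : ∀ m, f₁ (μ m, m) ∈ L m) (hfL₂ : ∀ m, f₂ (μ m, m) ∈ L m) (hfL₃ : ∀ m, f₃ (μ m, m) ∈ L m)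
    {φ : V → M} {t v₁ v₂ v₃ : V} (hφ : ContMDiffAt 𝓘(ℝ, V) 𝓘(ℝ, E) ∞ φ t)
    {ξ₁ ξ₂ ξ₃ : V → 𝔡} {α₁ α₂ α₃ : Π s, TangentSpace 𝓘(ℝ, E) (φ s) →L[ℝ] ℝ}
    (he₁ : IsSectionAlong L φ t v₁ ξ₁ α₁) (he₂ : IsSectionAlong L φ t v₂ ξ₂ α₂)
    (h₁ : f₁ (μ (φ t), φ t) = (ξ₁ t, mfderiv 𝓘(ℝ, V) 𝓘(ℝ, E) φ t v₁, α₁ t))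
    (h₂ : f₂ (μ (φ t), φ t) = (ξ₂ t, mfderiv 𝓘(ℝ, V) 𝓘(ℝ, E) φ t v₂, α₂ t))
    (h₃ : f₃ (μ (φ t), φ t) = (ξ₃ t, mfderiv 𝓘(ℝ, V) 𝓘(ℝ, E) φ t v₃, α₃ t)) :
    courantBracketPairing Q ρ f₁ f₂ f₃ (μ (φ t), φ t) =
      parametricBracket Q t v₁ v₂ v₃ ξ₁ ξ₂ ξ₃
        (fun s => α₁ s (mfderiv 𝓘(ℝ, V) 𝓘(ℝ, E) φ s v₂))
        (fun s => α₁ s (mfderiv 𝓘(ℝ, V) 𝓘(ℝ, E) φ s v₃))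
        (fun s => α₂ s (mfderiv 𝓘(ℝ, V) 𝓘(ℝ, E) φ s v₃)) := by
  have hφd := hφ.mdifferentiableAt (n := ∞) (by simp)
  have hμd : MDifferentiableAt 𝓘(ℝ, E) 𝓘(ℝ, F) μ (φ t) := hμ.mdifferentiable (by simp) _
  have hg : MDifferentiableAt 𝓘(ℝ, V) (𝓘(ℝ, F).prod 𝓘(ℝ, E)) (fun s => (μ (φ s), φ s)) t :=
    (hμd.comp t hφd).prodMk hφd
  have hchart : ∀ᶠ s in 𝓝 t, φ s ∈ (chartAt E (φ t)).source :=
    eventually_mem_chartAt (E := E) hφ.continuousAt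
  have w₁ := mfderiv_graph_eq_anchor hL hμ hφ (hfL₁ _) (congrArg (fun z => z.2.1) h₁)
  have w₂ := mfderiv_graph_eq_anchor hL hμ hφ (hfL₂ _) (congrArg (fun z => z.2.1) h₂)
  have w₃ := mfderiv_graph_eq_anchor hL hμ hφ (hfL₃ _) (congrArg (fun z => z.2.1) h₃)
  obtain ⟨dx₁, dY₁, dβ₁⟩ := hf₁.differentiableAt_graph hμ hφ
  obtain ⟨dx₂, dY₂, dβ₂⟩ := hf₂.differentiableAt_graph hμ hφ
  obtain ⟨dx₃, dY₃, dβ₃⟩ := hf₃.differentiableAt_graph hμ hφ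
  have s₁ := he₁.isSmoothSectionAt hL hφ
  have s₂ := he₂.isSmoothSectionAt hL hφ
  have dα₁ := (contMDiffAt_iff_contDiffAt.1 (contMDiffAt_cotangent_iff.1 s₁.covector).2).differentiableAt
    (by simp)
  have dα₂ := (contMDiffAt_iff_contDiffAt.1 (contMDiffAt_cotangent_iff.1 s₂.covector).2).differentiableAt
    (by simp)
  have hc := contDiffAt_extChartAt_comp hφ (mem_chart_source E (φ t))
  have hX := eventually_coordAt_mfderiv hφ
  have hXev : ∀ v, (fun s => (coordAt (E := E) (φ t) (φ s) (mfderiv 𝓘(ℝ, V) 𝓘(ℝ, E) φ s v) : E)) =ᶠ[𝓝 t]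
      fun s => fderiv ℝ (extChartAt 𝓘(ℝ, E) (φ t) ∘ φ) s v := fun v => by
    filter_upwards [hX] with s hs
    exact hs v
  have hdd : DifferentiableAt ℝ (fderiv ℝ (extChartAt 𝓘(ℝ, E) (φ t) ∘ φ)) t :=
    (hc.fderiv_right (m := ∞) (by simp)).differentiableAt (by simp)
  have dX : ∀ v, DifferentiableAt ℝ
      (fun s => (coordAt (E := E) (φ t) (φ s) (mfderiv 𝓘(ℝ, V) 𝓘(ℝ, E) φ s v) : E)) t := fun v =>
    (hdd.clm_apply (differentiableAt_const v)).congr_of_eventuallyEq (hXev v)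
  -- Symmetry of second derivatives of `φ` in the chart: the coordinate fields along `φ` commute,
  -- which is why `parametricBracket` contains no bracket of vector fields.
  have hsymm : ∀ v w, fderiv ℝ
      (fun s => (coordAt (E := E) (φ t) (φ s) (mfderiv 𝓘(ℝ, V) 𝓘(ℝ, E) φ s v) : E)) t w =
      fderiv ℝ (fun s => (coordAt (E := E) (φ t) (φ s) (mfderiv 𝓘(ℝ, V) 𝓘(ℝ, E) φ s w) : E)) t v := by
    intro v w
    rw [(hXev v).fderiv_eq, (hXev w).fderiv_eq,
      (hdd.hasFDerivAt.clm_apply (hasFDerivAt_const v t)).fderiv,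
      (hdd.hasFDerivAt.clm_apply (hasFDerivAt_const w t)).fderiv]
    have hs := hc.isSymmSndFDerivAt (by simpa using WithTop.coe_le_coe.2 (le_top : (2 : ℕ∞) ≤ ⊤))
    simpa using hs.eq w v
  have key := parametricBracket_eq Q (v₁ := v₁) (v₂ := v₂) (v₃ := v₃)
    (fun ℓ => (he₁.smooth ℓ).differentiableAt (by simp))
    (fun ℓ => (he₂.smooth ℓ).differentiableAt (by simp)) dx₁ dx₂ dx₃ (dX v₁) (dX v₂) (dX v₃)
    dY₁ dY₂ dY₃ dα₁ dα₂ dβ₁ dβ₂ dβ₃ (by rw [h₁]) (by rw [h₂])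
    (show ξ₃ t = _ by rw [h₃]) (by rw [h₁]) (by rw [h₂]) (by rw [h₃]) (by rw [h₁]) (by rw [h₂])
    (hsymm v₂ v₁) (hsymm v₃ v₁) (hsymm v₃ v₂)
    (by filter_upwards [he₁.mem, hchart] with s hs hs' using hL.form_eq_coord hs' hs (hfL₂ (φ s)))
    (by filter_upwards [he₁.mem, hchart] with s hs hs' using hL.form_eq_coord hs' hs (hfL₃ (φ s)))
    (by filter_upwards [he₂.mem, hchart] with s hs hs' using hL.form_eq_coord hs' hs (hfL₃ (φ s)))
    (by filter_upwards [hchart] with s hs' using hL.form_eq_coord hs' (hfL₁ (φ s)) (hfL₂ (φ s)))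
    (by filter_upwards [hchart] with s hs' using hL.form_eq_coord hs' (hfL₁ (φ s)) (hfL₃ (φ s)))
    (by filter_upwards [hchart] with s hs' using hL.form_eq_coord hs' (hfL₂ (φ s)) (hfL₃ (φ s)))
  have hpair : ∀ (α Y : Π s, CourantFibre 𝔡 E (φ s)),
      (fun s => ((α s).2.2.comp (coordAt (E := E) (φ t) (φ s)).inverse : E →L[ℝ] ℝ)
        (coordAt (E := E) (φ t) (φ s) (Y s).2.1)) =ᶠ[𝓝 t] fun s => (α s).2.2 (Y s).2.1 := by
    intro α Y
    filter_upwards [hchart] with s hs using comp_inverse_coordAt hs _ _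
  have hα : ∀ (α : Π s, TangentSpace 𝓘(ℝ, E) (φ s) →L[ℝ] ℝ) (v : V), fderiv ℝ
      (fun s => ((α s).comp (coordAt (E := E) (φ t) (φ s)).inverse : E →L[ℝ] ℝ)
        (coordAt (E := E) (φ t) (φ s) (mfderiv 𝓘(ℝ, V) 𝓘(ℝ, E) φ s v))) t =
      fderiv ℝ (fun s => α s (mfderiv 𝓘(ℝ, V) 𝓘(ℝ, E) φ s v)) t := fun α v =>
    (hpair (fun s => (0, 0, α s)) fun s => (0, mfderiv 𝓘(ℝ, V) 𝓘(ℝ, E) φ s v, 0)).fderiv_eq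
  have hlhs : ∀ a₁₂ a₁₃ a₂₃ b₁₂ b₁₃ b₂₃ : V → ℝ, fderiv ℝ a₁₂ t = fderiv ℝ b₁₂ t →
      fderiv ℝ a₁₃ t = fderiv ℝ b₁₃ t → fderiv ℝ a₂₃ t = fderiv ℝ b₂₃ t →
      parametricBracket Q t v₁ v₂ v₃ ξ₁ ξ₂ ξ₃ a₁₂ a₁₃ a₂₃ =
      parametricBracket Q t v₁ v₂ v₃ ξ₁ ξ₂ ξ₃ b₁₂ b₁₃ b₂₃ := by
    intro a₁₂ a₁₃ a₂₃ b₁₂ b₁₃ b₂₃ e₁ e₂ e₃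
    unfold parametricBracket
    rw [e₁, e₂, e₃]
  refine Eq.trans ?_ (key.symm.trans (hlhs _ _ _ _ _ _ (hα α₁ v₂) (hα α₁ v₃) (hα α₂ v₃)))
  have hform : ∀ {f : Π q : N × M, CourantFibre 𝔡 E q.2},
      IsSmoothSection (𝓘(ℝ, F).prod 𝓘(ℝ, E)) Prod.snd f → ∀ (η : 𝔡) (v : V)
      (w : TangentSpace (𝓘(ℝ, F).prod 𝓘(ℝ, E)) (μ (φ t), φ t)),
      mfderiv 𝓘(ℝ, V) (𝓘(ℝ, F).prod 𝓘(ℝ, E)) (fun s => (μ (φ s), φ s)) t v = w →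
      dirDeriv (𝓘(ℝ, F).prod 𝓘(ℝ, E)) (fun r => Q.form (f r).1 η) (μ (φ t), φ t) w =
      fderiv ℝ (fun s => Q.form (f (μ (φ s), φ s)).1 η) t v := fun hf η v w hw =>
    (fderiv_comp_eq_dirDeriv ((hf.algebra (Q.form.flip η) _).mdifferentiableAt (by simp)) hg hw).symm
  have hcov : ∀ {f f' : Π q : N × M, CourantFibre 𝔡 E q.2},
      IsSmoothSection (𝓘(ℝ, F).prod 𝓘(ℝ, E)) Prod.snd f →
      IsSmoothSection (𝓘(ℝ, F).prod 𝓘(ℝ, E)) Prod.snd f' → ∀ (v : V)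
      (w : TangentSpace (𝓘(ℝ, F).prod 𝓘(ℝ, E)) (μ (φ t), φ t)),
      mfderiv 𝓘(ℝ, V) (𝓘(ℝ, F).prod 𝓘(ℝ, E)) (fun s => (μ (φ s), φ s)) t v = w →
      dirDeriv (𝓘(ℝ, F).prod 𝓘(ℝ, E)) (fun r => (f r).2.2 (f' r).2.1) (μ (φ t), φ t) w =
      fderiv ℝ (fun s => ((f (μ (φ s), φ s)).2.2.comp (coordAt (E := E) (φ t) (φ s)).inverse : E →L[ℝ] ℝ)
        (coordAt (E := E) (φ t) (φ s) (f' (μ (φ s), φ s)).2.1)) t v := fun {f f'} hf hf' v w hw => by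
    rw [(hpair (fun s => f (μ (φ s), φ s)) fun s => f' (μ (φ s), φ s)).fderiv_eq]
    exact (fderiv_comp_eq_dirDeriv ((ContMDiffAt.cotangent_apply (hf.covector _)
      (hf'.vector _)).mdifferentiableAt (by simp)) hg hw).symm
  have hbr : ∀ {f f' : Π q : N × M, CourantFibre 𝔡 E q.2},
      IsSmoothSection (𝓘(ℝ, F).prod 𝓘(ℝ, E)) Prod.snd f →
      IsSmoothSection (𝓘(ℝ, F).prod 𝓘(ℝ, E)) Prod.snd f' → ∀ (γ : TangentSpace 𝓘(ℝ, E) (φ t) →L[ℝ] ℝ)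
      (v w : V),
      mfderiv 𝓘(ℝ, V) (𝓘(ℝ, F).prod 𝓘(ℝ, E)) (fun s => (μ (φ s), φ s)) t v =
        courantAnchor ρ (μ (φ t)) (φ t) (f (μ (φ t), φ t)) →
      mfderiv 𝓘(ℝ, V) (𝓘(ℝ, F).prod 𝓘(ℝ, E)) (fun s => (μ (φ s), φ s)) t w =
        courantAnchor ρ (μ (φ t)) (φ t) (f' (μ (φ t), φ t)) →
      γ (VectorField.mlieBracket (𝓘(ℝ, F).prod 𝓘(ℝ, E)) (fun r => courantAnchor ρ r.1 r.2 (f r))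
        (fun r => courantAnchor ρ r.1 r.2 (f' r)) (μ (φ t), φ t)).2 =
      (γ.comp (coordAt (E := E) (φ t) (φ t)).inverse : E →L[ℝ] ℝ)
        (fderiv ℝ (fun s => coordAt (E := E) (φ t) (φ s) (f' (μ (φ s), φ s)).2.1) t v -
          fderiv ℝ (fun s => coordAt (E := E) (φ t) (φ s) (f (μ (φ s), φ s)).2.1) t w) := by
    intro f f' hf hf' γ v w hv hw
    have h := dual_mlieBracket_snd (E := E) (F := F) (M := M) (N := N) (g := fun s => (μ (φ s), φ s))
      (show E →L[ℝ] ℝ from γ)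
      (contMDiffAt_courantAnchor hρ hf _) (contMDiffAt_courantAnchor hρ hf' _)
      (hf.vector _) (hf'.vector _) hg hv hw
    have h' : ∀ D : E, (γ.comp (coordAt (E := E) (φ t) (φ t)).inverse : E →L[ℝ] ℝ) D = γ D := fun D =>
      (congrArg (γ.comp (coordAt (E := E) (φ t) (φ t)).inverse : E →L[ℝ] ℝ)
        (coordAt_self (E := E) (φ t) D).symm).trans
        (comp_inverse_coordAt (mem_chart_source E (φ t)) γ D)
    exact h.trans (h' _).symm
  unfold courantBracketPairing
  simp only
  rw [hform hf₂ _ v₁ _ w₁, hform hf₁ _ v₂ _ w₂, hform hf₁ _ v₃ _ w₃, hcov hf₂ hf₃ v₁ _ w₁,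
    hcov hf₁ hf₃ v₂ _ w₂, hcov hf₁ hf₂ v₃ _ w₃, hbr hf₁ hf₂ _ v₁ v₂ w₁ w₂,
    hbr hf₁ hf₃ _ v₁ v₃ w₁ w₃, hbr hf₂ hf₃ _ v₂ v₃ w₂ w₃]

/-- Involutivity is stated for sections on all of `N × M`; a section over `M` is extended off the
graph as constant in the `N` direction. -/
lemma IsSmoothSection.comp_snd {e : Π m : M, CourantFibre 𝔡 E m} (h : IsSmoothSection 𝓘(ℝ, E) id e) :
    IsSmoothSection (𝓘(ℝ, F).prod 𝓘(ℝ, E)) (Prod.snd : N × M → M) (fun r => e r.2) :=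
  ⟨fun ℓ => (h.algebra ℓ).comp contMDiff_snd, h.vector.comp contMDiff_snd,
    h.covector.comp contMDiff_snd⟩

/-- Only the values at `t` have to be extended to sections of `L`; along `φ` the extensions may
differ from the given sections, by the comparison above. -/
theorem IsDiracOnGraph.parametricBracket_eq_zero [FiniteDimensional ℝ 𝔡] [FiniteDimensional ℝ E]
    [FiniteDimensional ℝ F]
    (hρ : ∀ ξ, IsSmoothVectorField (ρ ξ)) (hμ : ContMDiff 𝓘(ℝ, E) 𝓘(ℝ, F) ∞ μ)
    (hL : IsDiracOnGraph Q ρ μ L) (hL' : IsLagrangianOverGraph Q ρ μ L)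
    {φ : V → M} {t v₁ v₂ v₃ : V} (hφ : ContMDiffAt 𝓘(ℝ, V) 𝓘(ℝ, E) ∞ φ t)
    {ξ₁ ξ₂ ξ₃ : V → 𝔡} {α₁ α₂ α₃ : Π s, TangentSpace 𝓘(ℝ, E) (φ s) →L[ℝ] ℝ}
    (he₁ : IsSectionAlong L φ t v₁ ξ₁ α₁) (he₂ : IsSectionAlong L φ t v₂ ξ₂ α₂)
    (he₃ : IsSectionAlong L φ t v₃ ξ₃ α₃) :
    parametricBracket Q t v₁ v₂ v₃ ξ₁ ξ₂ ξ₃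
        (fun s => α₁ s (mfderiv 𝓘(ℝ, V) 𝓘(ℝ, E) φ s v₂))
        (fun s => α₁ s (mfderiv 𝓘(ℝ, V) 𝓘(ℝ, E) φ s v₃))
        (fun s => α₂ s (mfderiv 𝓘(ℝ, V) 𝓘(ℝ, E) φ s v₃)) = 0 := by
  obtain ⟨f₁, hf₁, hfL₁, h₁⟩ := hL.smooth (φ t) _ he₁.mem.self_of_nhds
  obtain ⟨f₂, hf₂, hfL₂, h₂⟩ := hL.smooth (φ t) _ he₂.mem.self_of_nhds
  obtain ⟨f₃, hf₃, hfL₃, h₃⟩ := hL.smooth (φ t) _ he₃.mem.self_of_nhds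
  rw [← courantBracketPairing_eq_parametricBracket hρ hμ hL' hf₁.comp_snd hf₂.comp_snd hf₃.comp_snd
    hfL₁ hfL₂ hfL₃ hφ he₁ he₂ h₁ h₂ h₃]
  exact hL.involutive _ _ _ hf₁.comp_snd hf₂.comp_snd hf₃.comp_snd hfL₁ hfL₂ hfL₃ (φ t)

end Comparison

/-! ### Linear algebra of exact fibres and of their reduction. -/

section Fibres

/-- The annihilator of a kernel is the range of the dual map, so `g` factors through `f` even if `f`
is not onto. -/
lemma LinearMap.exists_comp_eq_of_ker_le {U V : Type*} [AddCommGroup U] [Module ℝ U] [AddCommGroup V]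
    [Module ℝ V] (f : U →ₗ[ℝ] V) (g : U →ₗ[ℝ] ℝ) (h : ∀ u, f u = 0 → g u = 0) :
    ∃ ℓ : V →ₗ[ℝ] ℝ, ∀ u, ℓ (f u) = g u := by
  have hg : g ∈ (LinearMap.ker f).dualAnnihilator :=
    (Submodule.mem_dualAnnihilator g).2 fun u hu => h u hu
  rw [← LinearMap.range_dualMap_eq_dualAnnihilator_ker] at hg
  obtain ⟨ℓ, rfl⟩ := hg
  exact ⟨ℓ, fun u => rfl⟩

lemma LinearMap.exists_comp_eq_clm {U V : Type*} [AddCommGroup U] [Module ℝ U] [NormedAddCommGroup V]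
    [NormedSpace ℝ V] [FiniteDimensional ℝ V] (f : U →ₗ[ℝ] V) (g : U →ₗ[ℝ] ℝ)
    (h : ∀ u, f u = 0 → g u = 0) :
    ∃ ℓ : V →L[ℝ] ℝ, ∀ u, ℓ (f u) = g u := by
  obtain ⟨ℓ, hℓ⟩ := f.exists_comp_eq_of_ker_le g h
  exact ⟨LinearMap.toContinuousLinearMap ℓ, hℓ⟩

variable {𝔡 : Type*} [LieRing 𝔡] [LieAlgebra ℝ 𝔡] [FiniteDimensional ℝ 𝔡]

lemma QuadraticPairing.exists_form_eq (Q : QuadraticPairing 𝔡) (g : 𝔡 →ₗ[ℝ] ℝ) :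
    ∃ ζ, ∀ η, Q.form ζ η = g η :=
  ⟨(Q.form.toDual Q.nondegenerate).symm g, fun η =>
    LinearMap.BilinForm.apply_toDual_symm_apply g η⟩

lemma QuadraticPairing.orthogonal_orthogonal (Q : QuadraticPairing 𝔡) (W : Submodule ℝ 𝔡) :
    Q.form.orthogonal (Q.form.orthogonal W) = W :=
  LinearMap.BilinForm.orthogonal_orthogonal Q.nondegenerate
    (fun x y h => by rw [Q.symm, h]) W

lemma QuadraticPairing.form_eq_zero {Q : QuadraticPairing 𝔡} {W : Submodule ℝ 𝔡} {x y : 𝔡}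
    (hx : x ∈ W) (hy : y ∈ Q.form.orthogonal W) : Q.form x y = 0 :=
  LinearMap.BilinForm.mem_orthogonal_iff.1 hy x hx

lemma QuadraticPairing.form_eq_zero' {Q : QuadraticPairing 𝔡} {W : Submodule ℝ 𝔡} {x y : 𝔡}
    (hx : x ∈ W) (hy : y ∈ Q.form.orthogonal W) : Q.form y x = 0 := by
  rw [Q.symm, Q.form_eq_zero hx hy]

lemma QuadraticPairing.proj_eq_zero_iff (Q : QuadraticPairing 𝔡) (𝔠 : LieSubalgebra ℝ 𝔡) (x : 𝔠) :
    Q.proj 𝔠 x = 0 ↔ (x : 𝔡) ∈ Q.form.orthogonal 𝔠.toSubmodule := by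
  rw [LinearMap.BilinForm.mem_orthogonal_iff]
  constructor
  · intro h y hy
    have := (Submodule.Quotient.mk_eq_zero (Q.perpIdeal 𝔠).toSubmodule).1 h
    exact this ⟨y, hy⟩
  · exact fun h => Q.proj_eq_zero 𝔠 x fun y => h y y.2

variable {A : Type*} [NormedAddCommGroup A] [NormedSpace ℝ A] [FiniteDimensional ℝ A]
  {B : Type*} [NormedAddCommGroup B] [NormedSpace ℝ B] [FiniteDimensional ℝ B]

/-- A fibre of an exact morphism of Manin pairs: `r` is the infinitesimal action on the target and
`D` the derivative of the base map. -/
structure IsExactFibre (Q : QuadraticPairing 𝔡) (𝔥 : LieSubalgebra ℝ 𝔡) (r : 𝔡 →ₗ[ℝ] B)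
    (D : A →L[ℝ] B) (L : Submodule ℝ (𝔡 × A × (A →L[ℝ] ℝ))) : Prop where
  lagrangian : ∀ z, z ∈ L ↔ ∀ w ∈ L, Q.form z.1 w.1 - (z.2.2 w.2.1 + w.2.2 z.2.1) = 0
  anchor_mem : ∀ z ∈ L, r z.1 = D z.2.1
  anchor_surjective : ∀ v, ∃ z ∈ L, z.2.1 = v
  middle : ∀ ζ α, (ζ, 0, α) ∈ L → ∃ ℓ : B →L[ℝ] ℝ, (∀ η, Q.form ζ η = ℓ (r η)) ∧ α = ℓ.comp D
  surjective : Function.Surjective r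
  range_le : ∀ ξ X, (ξ, X, 0) ∈ L → ξ ∈ 𝔥
  ker_inter : ∀ X, (0, X, 0) ∈ L → X = 0

namespace IsExactFibre

variable {Q : QuadraticPairing 𝔡} {𝔥 : LieSubalgebra ℝ 𝔡} {r : 𝔡 →ₗ[ℝ] B}
    {D : A →L[ℝ] B} {L : Submodule ℝ (𝔡 × A × (A →L[ℝ] ℝ))}

lemma form_eq (h : IsExactFibre Q 𝔥 r D L) {z w : 𝔡 × A × (A →L[ℝ] ℝ)} (hz : z ∈ L) (hw : w ∈ L) :
    Q.form z.1 w.1 = z.2.2 w.2.1 + w.2.2 z.2.1 :=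
  sub_eq_zero.1 ((h.lagrangian z).1 hz w hw)

/-- Against `w ∈ L` the pairing is `ℓ` of `r w.1 - D w.2.1`, which vanishes because the anchor of
`w` is tangent to the graph; maximality of `L` does the rest. -/
lemma coanchor_mem (h : IsExactFibre Q 𝔥 r D L) {ζ : 𝔡} {ℓ : B →L[ℝ] ℝ}
    (hζ : ∀ η, Q.form ζ η = ℓ (r η)) : (ζ, (0 : A), ℓ.comp D) ∈ L := by
  rw [h.lagrangian]
  intro w hw
  simp [hζ, h.anchor_mem w hw]

lemma exists_coanchor (Q : QuadraticPairing 𝔡) (r : 𝔡 →ₗ[ℝ] B) (ℓ : B →L[ℝ] ℝ) :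
    ∃ ζ, ∀ η, Q.form ζ η = ℓ (r η) :=
  Q.exists_form_eq ((ℓ : B →ₗ[ℝ] ℝ).comp r)

/-- On `L`, the functional `Q.form ζ` of the algebra part vanishes when the vector part does: such
elements are coanchors `a^*(ℓ)`, and they pair with `ζ` to `ℓ (r ζ) = 0`. So it factors through the
vector part, and the factor is the required covector because `L` contains its own orthogonal. -/
lemma exists_of_ker (h : IsExactFibre Q 𝔥 r D L) {ζ : 𝔡} (hζ : r ζ = 0) :
    ∃ α, (ζ, (0 : A), α) ∈ L := by
  let f : L →ₗ[ℝ] A := ((LinearMap.fst ℝ A (A →L[ℝ] ℝ)).comp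
    (LinearMap.snd ℝ 𝔡 (A × (A →L[ℝ] ℝ)))).comp L.subtype
  let g : L →ₗ[ℝ] ℝ := ((Q.form ζ).comp (LinearMap.fst ℝ 𝔡 (A × (A →L[ℝ] ℝ)))).comp L.subtype
  obtain ⟨α, hα⟩ := LinearMap.exists_comp_eq_clm (U := L) f g fun w h0 => by
    obtain ⟨⟨η, Y, γ⟩, hw⟩ := w
    change Y = 0 at h0
    subst h0
    obtain ⟨ℓ, hℓ, -⟩ := h.middle η γ hw
    change Q.form ζ η = 0
    rw [Q.symm, hℓ, hζ, map_zero]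
  refine ⟨α, (h.lagrangian _).2 fun w hw => ?_⟩
  have h1 : α w.2.1 = Q.form ζ w.1 := hα ⟨w, hw⟩
  simp [h1]

/-- Take any element of `L` over `X`. Its algebra part differs from `ξ` by an element of the kernel
of `r`, and this is corrected by `exists_of_ker`. -/
theorem exists_covector (h : IsExactFibre Q 𝔥 r D L) {ξ : 𝔡} {X : A} (hX : r ξ = D X) :
    ∃ α, (ξ, X, α) ∈ L := by
  obtain ⟨⟨η, Y, γ⟩, hz, hzX⟩ := h.anchor_surjective X
  change Y = X at hzX
  subst hzX
  obtain ⟨α, hα⟩ := h.exists_of_ker (ζ := ξ - η) (by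
    have := h.anchor_mem _ hz
    rw [map_sub, hX, this, sub_self])
  refine ⟨γ + α, ?_⟩
  have := L.add_mem hz hα
  simpa using this

/-- Pairing with elements of `L` over all tangent vectors determines a covector, by isotropy. -/
theorem covector_unique (h : IsExactFibre Q 𝔥 r D L) {ξ : 𝔡} {X : A} {α β : A →L[ℝ] ℝ}
    (hα : (ξ, X, α) ∈ L) (hβ : (ξ, X, β) ∈ L) : α = β := by
  ext v
  obtain ⟨z, hz, rfl⟩ := h.anchor_surjective v
  have h1 := h.form_eq hα hz
  have h2 := h.form_eq hβ hz
  simp only at h1 h2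
  linarith

/-- By (m1), elements of `L` without covector lie over `𝔥 = 𝔥^⊥`, so on `L` the functional `Q.form
ξ` factors through the covector part. By finite-dimensional biduality the factor is evaluation at a
vector `X`. -/
theorem exists_vector (h : IsExactFibre Q 𝔥 r D L) (h𝔥 : Q.IsLagrangian 𝔥) {ξ : 𝔡} (hξ : ξ ∈ 𝔥) :
    ∃ X, (ξ, X, (0 : A →L[ℝ] ℝ)) ∈ L := by
  have hperp : ∀ w ∈ L, w.2.2 = 0 → Q.form ξ w.1 = 0 := by
    rintro ⟨η, Y, γ⟩ hw h0
    change γ = 0 at h0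
    subst h0
    exact Q.form_eq_zero' (h.range_le _ _ hw) (by rw [h𝔥]; exact hξ)
  let f : L →ₗ[ℝ] (A →L[ℝ] ℝ) := ((LinearMap.snd ℝ A (A →L[ℝ] ℝ)).comp
    (LinearMap.snd ℝ 𝔡 (A × (A →L[ℝ] ℝ)))).comp L.subtype
  let g : L →ₗ[ℝ] ℝ := ((Q.form ξ).comp (LinearMap.fst ℝ 𝔡 (A × (A →L[ℝ] ℝ)))).comp L.subtype
  obtain ⟨T, hT⟩ := LinearMap.exists_comp_eq_of_ker_le (U := L) f g fun w hw => hperp w.1 w.2 hw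
  let T' : Module.Dual ℝ (Module.Dual ℝ A) :=
    T.comp (LinearMap.toContinuousLinearMap (𝕜 := ℝ) (E := A) (F' := ℝ)).toLinearMap
  let X := (Module.evalEquiv ℝ A).symm T'
  have hX : ∀ γ : A →L[ℝ] ℝ, T γ = γ X := by
    intro γ
    have h1 : Module.evalEquiv ℝ A X = T' := LinearEquiv.apply_symm_apply _ _
    have h2 : Module.evalEquiv ℝ A X (γ : A →ₗ[ℝ] ℝ) = T' (γ : A →ₗ[ℝ] ℝ) := by rw [h1]
    exact h2.symm
  refine ⟨X, (h.lagrangian _).2 fun w hw => ?_⟩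
  have h1 : T w.2.2 = Q.form ξ w.1 := hT ⟨w, hw⟩
  simp [← h1, hX]

theorem vector_unique (h : IsExactFibre Q 𝔥 r D L) {ξ : 𝔡} {X Y : A}
    (hX : (ξ, X, (0 : A →L[ℝ] ℝ)) ∈ L) (hY : (ξ, Y, (0 : A →L[ℝ] ℝ)) ∈ L) : X = Y := by
  refine sub_eq_zero.1 (h.ker_inter _ ?_)
  have := L.sub_mem hX hY
  simpa using this

end IsExactFibre

/-- The pointwise reduction of a Lagrangian subspace. -/
def reducedFibre (Q : QuadraticPairing 𝔡) (𝔠 : LieSubalgebra ℝ 𝔡)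
    (L : Submodule ℝ (𝔡 × A × (A →L[ℝ] ℝ)))
    {A₁ : Type*} [NormedAddCommGroup A₁] [NormedSpace ℝ A₁]
    {A₂ : Type*} [NormedAddCommGroup A₂] [NormedSpace ℝ A₂]
    (i : A₁ →L[ℝ] A) (q : A₁ →L[ℝ] A₂) : Submodule ℝ (Q.Reduced 𝔠 × A₂ × (A₂ →L[ℝ] ℝ)) where
  carrier := {z | ∃ (ξ : 𝔠) (u : A₁) (α : A →L[ℝ] ℝ), ((ξ : 𝔡), i u, α) ∈ L ∧
    Q.proj 𝔠 ξ = z.1 ∧ q u = z.2.1 ∧ ∀ v, α (i v) = z.2.2 (q v)}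
  add_mem' := by
    rintro z w ⟨ξ, u, α, h1, h2, h3, h4⟩ ⟨ξ', u', α', h1', h2', h3', h4'⟩
    refine ⟨ξ + ξ', u + u', α + α', ?_, by simp [h2, h2'], by simp [h3, h3'],
      fun v => by simp [h4, h4']⟩
    simpa using L.add_mem h1 h1'
  zero_mem' := ⟨0, 0, 0, by rw [map_zero]; exact L.zero_mem, by simp, by simp, by simp⟩
  smul_mem' := by
    rintro c z ⟨ξ, u, α, h1, h2, h3, h4⟩
    refine ⟨c • ξ, c • u, c • α, ?_, by simp [h2], by simp [h3], fun v => by simp [h4]⟩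
    simpa using L.smul_mem c h1

/-- The form `ℓ` on the reduced space corresponds to an element of `𝔠` that represents the pull-back
of `ℓ` under the reduced action. -/
theorem QuadraticPairing.exists_reducible_coanchor {B₁ B₂ : Type*} [NormedAddCommGroup B₁]
    [NormedSpace ℝ B₁] [NormedAddCommGroup B₂] [NormedSpace ℝ B₂] (Q : QuadraticPairing 𝔡)
    {𝔠 : LieSubalgebra ℝ 𝔡} {r : 𝔡 →ₗ[ℝ] B} {iB : B₁ →L[ℝ] B} {qB : B₁ →L[ℝ] B₂}
    {r' : Q.Reduced 𝔠 →ₗ[ℝ] B₂} (hc : Q.IsCoisotropic 𝔠) (hinj : Function.Injective iB)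
    (hinv : ∀ ξ ∈ 𝔠, ∃ v, iB v = r ξ)
    (hker : ∀ v, qB v = 0 ↔ ∃ ξ ∈ Q.form.orthogonal 𝔠.toSubmodule, iB v = r ξ)
    (hr : ∀ (ξ : 𝔠) v, iB v = r ξ → r' (Q.proj 𝔠 ξ) = qB v) (ℓ : B₂ →L[ℝ] ℝ) :
    ∃ (ξ : 𝔠) (ν : B →L[ℝ] ℝ), (∀ η, Q.form ξ η = ν (r η)) ∧ (∀ v, ν (iB v) = ℓ (qB v)) ∧
      ∀ η, (Q.reduce 𝔠).form (Q.proj 𝔠 ξ) η = ℓ (r' η) := by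
  obtain ⟨ν, hν⟩ := (iB : B₁ →ₗ[ℝ] B).exists_comp_eq_clm ((ℓ : B₂ →ₗ[ℝ] ℝ).comp (qB : B₁ →ₗ[ℝ] B₂))
    fun u hu => by
      have : u = 0 := hinj (by rw [map_zero]; exact hu)
      rw [this, map_zero]
  change ∀ v, ν (iB v) = ℓ (qB v) at hν
  obtain ⟨ξ, hξ⟩ := IsExactFibre.exists_coanchor Q r ν
  -- `ν` extends `ℓ ∘ qB` from `B₁` to `B`. It vanishes on the image of `𝔠^⊥`, which `qB` kills, so
  -- its dual element lies in `𝔠^⊥⊥ = 𝔠`.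
  have hξc : ξ ∈ 𝔠 := by
    have : ξ ∈ Q.form.orthogonal (Q.form.orthogonal 𝔠.toSubmodule) := by
      rw [LinearMap.BilinForm.mem_orthogonal_iff]
      intro η hη
      obtain ⟨v, hv⟩ := hinv η (hc hη)
      rw [Q.symm, hξ, ← hv, hν, (hker v).2 ⟨η, hη, hv⟩, map_zero]
    rw [Q.orthogonal_orthogonal] at this
    exact this
  refine ⟨⟨ξ, hξc⟩, ν, hξ, hν, fun η => ?_⟩
  obtain ⟨η, rfl⟩ := Q.proj_surjective 𝔠 η
  obtain ⟨v, hv⟩ := hinv η η.2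
  rw [hr η v hv, ← hν, hv]
  exact hξ η

/-- The derivatives, at a point, of the maps in reductive data. -/
structure IsReductionFibre {A₁ A₂ B₁ B₂ : Type*} [NormedAddCommGroup A₁] [NormedSpace ℝ A₁]
    [NormedAddCommGroup A₂] [NormedSpace ℝ A₂] [NormedAddCommGroup B₁] [NormedSpace ℝ B₁]
    [NormedAddCommGroup B₂] [NormedSpace ℝ B₂]
    (Q : QuadraticPairing 𝔡) (𝔥 𝔠 : LieSubalgebra ℝ 𝔡) (r : 𝔡 →ₗ[ℝ] B)
    (D : A →L[ℝ] B) (L : Submodule ℝ (𝔡 × A × (A →L[ℝ] ℝ)))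
    (iB : B₁ →L[ℝ] B) (qB : B₁ →L[ℝ] B₂) (iA : A₁ →L[ℝ] A) (j : A₁ →L[ℝ] B₁)
    (qA : A₁ →L[ℝ] A₂) : Prop where
  exact : IsExactFibre Q 𝔥 r D L
  coisotropic : Q.IsCoisotropic 𝔠
  comm : ∀ u, D (iA u) = iB (j u)
  injective : Function.Injective iB
  clean : ∀ v w, iB v = D w → ∃ u, j u = v ∧ iA u = w
  invariant : ∀ ξ ∈ 𝔠, ∃ v, iB v = r ξ
  transitive : ∀ v, ∃ ξ ∈ 𝔠, iB v = r ξ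
  surjective : Function.Surjective qB
  surjective_source : Function.Surjective qA
  ker : ∀ v, qB v = 0 ↔ ∃ ξ ∈ Q.form.orthogonal 𝔠.toSubmodule, iB v = r ξ
  ker_source : ∀ u, qA u = 0 ↔ ∃ ξ ∈ 𝔥, ξ ∈ Q.form.orthogonal 𝔠.toSubmodule ∧ (ξ, iA u, 0) ∈ L

namespace IsReductionFibre

variable {A₁ A₂ B₁ B₂ : Type*} [NormedAddCommGroup A₁] [NormedSpace ℝ A₁] [FiniteDimensional ℝ A₁]
    [NormedAddCommGroup A₂] [NormedSpace ℝ A₂] [FiniteDimensional ℝ A₂]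
    [NormedAddCommGroup B₁] [NormedSpace ℝ B₁] [FiniteDimensional ℝ B₁]
    [NormedAddCommGroup B₂] [NormedSpace ℝ B₂] [FiniteDimensional ℝ B₂]
    {Q : QuadraticPairing 𝔡} {𝔥 𝔠 : LieSubalgebra ℝ 𝔡} {r : 𝔡 →ₗ[ℝ] B}
    {D : A →L[ℝ] B} {L : Submodule ℝ (𝔡 × A × (A →L[ℝ] ℝ))}
    {iB : B₁ →L[ℝ] B} {qB : B₁ →L[ℝ] B₂} {iA : A₁ →L[ℝ] A} {j : A₁ →L[ℝ] B₁}
    {qA : A₁ →L[ℝ] A₂} {r' : Q.Reduced 𝔠 →ₗ[ℝ] B₂} {D' : A₂ →L[ℝ] B₂}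

/-- A covector at a point of the preimage that lies over a reducible element descends. -/
theorem exists_descend (h : IsReductionFibre Q 𝔥 𝔠 r D L iB qB iA j qA) {ξ : 𝔡} (hξ : ξ ∈ 𝔠)
    {u : A₁} {α : A →L[ℝ] ℝ} (hα : (ξ, iA u, α) ∈ L) :
    ∃ α' : A₂ →L[ℝ] ℝ, ∀ v, α' (qA v) = α (iA v) := by
  refine (qA : A₁ →ₗ[ℝ] A₂).exists_comp_eq_clm ((α : A →ₗ[ℝ] ℝ).comp (iA : A₁ →ₗ[ℝ] A)) fun v hv => ?_
  -- A vertical vector comes from some `ξ₀ ∈ 𝔥 ∩ 𝔠^⊥` with zero covector; its isotropy relation with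
  -- the given element reduces to the vanishing of `α`.
  obtain ⟨ξ₀, -, h0, hL⟩ := (h.ker_source v).1 hv
  have := h.exact.form_eq hα hL
  simp only [Q.form_eq_zero (W := 𝔠.toSubmodule) hξ h0] at this
  simpa using this.symm

/-- The element of `𝔠` over a reduced element can be chosen to act by a given tangent vector. -/
theorem exists_lift (h : IsReductionFibre Q 𝔥 𝔠 r D L iB qB iA j qA)
    (hr : ∀ (ξ : 𝔠) v, iB v = r ξ → r' (Q.proj 𝔠 ξ) = qB v)
    (hD : ∀ u, D' (qA u) = qB (j u)) {ζ : Q.Reduced 𝔠} {u : A₁} (hζ : r' ζ = D' (qA u)) :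
    ∃ ξ : 𝔠, Q.proj 𝔠 ξ = ζ ∧ r ξ = D (iA u) := by
  obtain ⟨ξ, rfl⟩ := Q.proj_surjective 𝔠 ζ
  obtain ⟨v, hv⟩ := h.invariant ξ ξ.2
  rw [hr ξ v hv, hD] at hζ
  -- An arbitrary lift moves along `S` in a direction that is correct modulo the kernel of `qB`; the
  -- error is produced by an element of `𝔠^⊥`, which may be subtracted without changing the class.
  obtain ⟨η, hη, hη'⟩ := (h.ker (v - j u)).1 (by rw [map_sub, hζ, sub_self])
  have h0 : Q.proj 𝔠 ⟨η, h.coisotropic hη⟩ = 0 := (Q.proj_eq_zero_iff 𝔠 _).2 hη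
  refine ⟨ξ - ⟨η, h.coisotropic hη⟩, by rw [map_sub, h0, sub_zero], ?_⟩
  have : r ((ξ : 𝔡) - η) = D (iA u) := by
    rw [map_sub, ← hv, ← hη', h.comm, map_sub, sub_sub_cancel]
  exact this

theorem exists_mem (h : IsReductionFibre Q 𝔥 𝔠 r D L iB qB iA j qA)
    (hr : ∀ (ξ : 𝔠) v, iB v = r ξ → r' (Q.proj 𝔠 ξ) = qB v)
    (hD : ∀ u, D' (qA u) = qB (j u)) {ζ : Q.Reduced 𝔠} {X : A₂} (hζ : r' ζ = D' X) :
    ∃ α, (ζ, X, α) ∈ reducedFibre Q 𝔠 L iA qA := by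
  obtain ⟨u, rfl⟩ := h.surjective_source X
  obtain ⟨ξ, rfl, hξ⟩ := h.exists_lift hr hD hζ
  obtain ⟨α, hα⟩ := h.exact.exists_covector hξ
  obtain ⟨α', hα'⟩ := h.exists_descend ξ.2 hα
  exact ⟨α', ξ, u, α, hα, rfl, rfl, fun v => (hα' v).symm⟩

theorem anchor_mem (h : IsReductionFibre Q 𝔥 𝔠 r D L iB qB iA j qA)
    (hr : ∀ (ξ : 𝔠) v, iB v = r ξ → r' (Q.proj 𝔠 ξ) = qB v)
    (hD : ∀ u, D' (qA u) = qB (j u)) {z : Q.Reduced 𝔠 × A₂ × (A₂ →L[ℝ] ℝ)}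
    (hz : z ∈ reducedFibre Q 𝔠 L iA qA) : r' z.1 = D' z.2.1 := by
  obtain ⟨ξ, u, α, h1, h2, h3, -⟩ := hz
  rw [← h2, ← h3, hD]
  refine hr ξ _ ?_
  rw [← h.comm]
  exact (h.exact.anchor_mem _ h1).symm

theorem form_eq (h : IsReductionFibre Q 𝔥 𝔠 r D L iB qB iA j qA)
    {z w : Q.Reduced 𝔠 × A₂ × (A₂ →L[ℝ] ℝ)}
    (hz : z ∈ reducedFibre Q 𝔠 L iA qA) (hw : w ∈ reducedFibre Q 𝔠 L iA qA) :
    (Q.reduce 𝔠).form z.1 w.1 = z.2.2 w.2.1 + w.2.2 z.2.1 := by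
  obtain ⟨ξ, u, α, h1, h2, h3, h4⟩ := hz
  obtain ⟨η, v, β, h1', h2', h3', h4'⟩ := hw
  rw [← h2, ← h2', ← h3, ← h3', ← h4, ← h4']
  exact h.exact.form_eq h1 h1'

theorem surjective_action (h : IsReductionFibre Q 𝔥 𝔠 r D L iB qB iA j qA)
    (hr : ∀ (ξ : 𝔠) v, iB v = r ξ → r' (Q.proj 𝔠 ξ) = qB v) : Function.Surjective r' := by
  intro x
  obtain ⟨v, rfl⟩ := h.surjective x
  obtain ⟨ξ, hξ, hv⟩ := h.transitive v
  exact ⟨Q.proj 𝔠 ⟨ξ, hξ⟩, hr _ v hv⟩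

theorem coanchor_mem (h : IsReductionFibre Q 𝔥 𝔠 r D L iB qB iA j qA)
    (hr : ∀ (ξ : 𝔠) v, iB v = r ξ → r' (Q.proj 𝔠 ξ) = qB v)
    (hD : ∀ u, D' (qA u) = qB (j u)) {ζ : Q.Reduced 𝔠} {ℓ : B₂ →L[ℝ] ℝ}
    (hζ : ∀ η, (Q.reduce 𝔠).form ζ η = ℓ (r' η)) :
    (ζ, (0 : A₂), ℓ.comp D') ∈ reducedFibre Q 𝔠 L iA qA := by
  obtain ⟨ξ, ν, h1, h2, h3⟩ := Q.exists_reducible_coanchor h.coisotropic h.injective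
    h.invariant h.ker hr ℓ
  refine ⟨ξ, 0, ν.comp D, ?_, ?_, map_zero _, fun v => ?_⟩
  · rw [map_zero]
    exact h.exact.coanchor_mem h1
  · refine sub_eq_zero.1 ((Q.reduce 𝔠).nondegenerate.1 _ fun η => ?_)
    rw [map_sub, LinearMap.sub_apply, h3, hζ, sub_self]
  · simp [h.comm, h2, hD]

/-- The reduction of a fibre of an exact morphism of Manin pairs is again such a fibre. -/
theorem isExactFibre (h : IsReductionFibre Q 𝔥 𝔠 r D L iB qB iA j qA)
    (hr : ∀ (ξ : 𝔠) v, iB v = r ξ → r' (Q.proj 𝔠 ξ) = qB v)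
    (hD : ∀ u, D' (qA u) = qB (j u)) :
    IsExactFibre (Q.reduce 𝔠) (Q.reduceSubalgebra 𝔠 𝔥) r' D' (reducedFibre Q 𝔠 L iA qA) := by
  have hsurj : ∀ v, ∃ z ∈ reducedFibre Q 𝔠 L iA qA, z.2.1 = v := fun v => by
    obtain ⟨ζ, hζ⟩ := h.surjective_action hr (D' v)
    obtain ⟨α, hα⟩ := h.exists_mem hr hD hζ
    exact ⟨_, hα, rfl⟩
  have huniq : ∀ α : A₂ →L[ℝ] ℝ,
      (∀ w ∈ reducedFibre Q 𝔠 L iA qA, α w.2.1 = 0) → α = 0 := fun α hα => by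
    ext v
    obtain ⟨z, hz, rfl⟩ := hsurj v
    exact hα z hz
  -- A covector vanishing along the preimage can be removed at the cost of an element of `𝔠^⊥`. By
  -- cleanness `α` factors as `ν' ∘ D` with `ν'` zero on `iB`; its dual `η` is orthogonal to `𝔠`,
  -- and `(η, 0, α)` is a coanchor, hence in `L`. This is the source of (m1) and (m2) for the
  -- reduction.
  have hvanish : ∀ (ξ : 𝔠) (u : A₁) (α : A →L[ℝ] ℝ), ((ξ : 𝔡), iA u, α) ∈ L →
      (∀ v, α (iA v) = 0) → ∃ η ∈ Q.form.orthogonal 𝔠.toSubmodule,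
        ((ξ : 𝔡) - η, iA u, (0 : A →L[ℝ] ℝ)) ∈ L := by
    intro ξ u α hα h0
    obtain ⟨ν, hν⟩ := (((LinearMap.range (iB : B₁ →ₗ[ℝ] B)).mkQ).comp
      (D : A →ₗ[ℝ] B)).exists_comp_eq_of_ker_le (α : A →ₗ[ℝ] ℝ) fun w hw => by
        obtain ⟨v, hv⟩ := (Submodule.Quotient.mk_eq_zero _).1 hw
        obtain ⟨u', -, rfl⟩ := h.clean v w hv
        exact h0 u'
    let ν' : B →L[ℝ] ℝ := LinearMap.toContinuousLinearMap
      (ν.comp (LinearMap.range (iB : B₁ →ₗ[ℝ] B)).mkQ)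
    have hνi : ∀ v, ν' (iB v) = 0 := fun v => by
      have : (LinearMap.range (iB : B₁ →ₗ[ℝ] B)).mkQ (iB v) = 0 :=
        (Submodule.Quotient.mk_eq_zero _).2 ⟨v, rfl⟩
      change ν ((LinearMap.range (iB : B₁ →ₗ[ℝ] B)).mkQ (iB v)) = 0
      rw [this, map_zero]
    obtain ⟨η, hη⟩ := IsExactFibre.exists_coanchor Q r ν'
    refine ⟨η, ?_, ?_⟩
    · rw [LinearMap.BilinForm.mem_orthogonal_iff]
      intro ξ' hξ'
      obtain ⟨v, hv⟩ := h.invariant ξ' hξ'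
      rw [Q.symm, hη, ← hv, hνi]
    · have h1 := L.sub_mem hα (h.exact.coanchor_mem hη)
      have h2 : ν'.comp D = α := by
        ext w
        exact hν w
      rw [h2] at h1
      simpa using h1
  refine ⟨fun z => ⟨fun hz w hw => sub_eq_zero.2 (h.form_eq hz hw), fun hz => ?_⟩,
    fun z hz => h.anchor_mem hr hD hz, hsurj, fun ζ α' hζ => ?_, h.surjective_action hr,
    fun ζ X hζ => ?_, fun X hX => ?_⟩
  -- Maximality: orthogonality to the reduced coanchors forces `r' ζ = D' X`. Then some covector
  -- over `(ζ, X)` lies in the reduction, and orthogonality to everything identifies it with `α`.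
  · obtain ⟨ζ, X, α⟩ := z
    have hr' : r' ζ = D' X := by
      refine (SeparatingDual.eq_iff_forall_dual_eq (R := ℝ) (V := B₂)).2 fun ℓ => ?_
      obtain ⟨η, hη⟩ := IsExactFibre.exists_coanchor (Q.reduce 𝔠) r' ℓ
      have h1 := hz _ (h.coanchor_mem hr hD hη)
      simp only [map_zero, ContinuousLinearMap.comp_apply, zero_add] at h1
      rw [← hη, (Q.reduce 𝔠).symm]
      exact sub_eq_zero.1 h1
    obtain ⟨β, hβ⟩ := h.exists_mem hr hD hr'
    have : α - β = 0 := huniq _ fun w hw => by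
      have h1 := hz w hw
      have h2 := h.form_eq hβ hw
      simp only at h1 h2
      rw [sub_apply]
      linarith
    rwa [sub_eq_zero.1 this]
  -- An element without vector part: lift `ζ` into the kernel of `r`, where exactness upstairs
  -- provides `ν`. It descends along `qB` since `ξ ∈ 𝔠` is orthogonal to `𝔠^⊥`.
  · have h1 := h.anchor_mem hr hD hζ
    simp only [map_zero] at h1
    obtain ⟨ξ, hξζ, hξ⟩ := h.exists_lift hr hD (u := 0) (by simpa using h1)
    simp only [map_zero] at hξ
    obtain ⟨β, hβ⟩ := h.exact.exists_of_ker hξ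
    obtain ⟨ν, hν, -⟩ := h.exact.middle _ _ hβ
    obtain ⟨ℓ, hℓ⟩ := (qB : B₁ →ₗ[ℝ] B₂).exists_comp_eq_clm ((ν : B →ₗ[ℝ] ℝ).comp (iB : B₁ →ₗ[ℝ] B))
      fun v hv => by
        obtain ⟨η, hη, hvη⟩ := (h.ker v).1 hv
        change ν (iB v) = 0
        rw [hvη, ← hν]
        exact Q.form_eq_zero (W := 𝔠.toSubmodule) ξ.2 hη
    have hζℓ : ∀ η, (Q.reduce 𝔠).form ζ η = ℓ (r' η) := by
      intro η
      obtain ⟨η, rfl⟩ := Q.proj_surjective 𝔠 η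
      obtain ⟨v, hv⟩ := h.invariant η η.2
      rw [← hξζ, hr η v hv]
      exact (hν η).trans ((congrArg ν hv.symm).trans (hℓ v).symm)
    refine ⟨ℓ, hζℓ, sub_eq_zero.1 (huniq _ fun w hw => ?_)⟩
    have h2 := h.form_eq hζ hw
    have h3 := h.form_eq (h.coanchor_mem hr hD hζℓ) hw
    simp only [map_zero, add_zero] at h2 h3
    rw [sub_apply, ← h2, ← h3, sub_self]
  · obtain ⟨ξ, u, α, h1, h2, h3, h4⟩ := hζ
    obtain ⟨η, hη, hmem⟩ := hvanish ξ u α h1 (by simpa using h4)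
    have h0 : Q.proj 𝔠 ⟨η, h.coisotropic hη⟩ = 0 := (Q.proj_eq_zero_iff 𝔠 _).2 hη
    refine ⟨ξ - ⟨η, h.coisotropic hη⟩, h.exact.range_le _ _ hmem, ?_⟩
    change Q.proj 𝔠 (ξ - ⟨η, h.coisotropic hη⟩) = ζ
    rw [map_sub, h0, sub_zero, h2]
  -- As the class of `ξ` is zero, `ξ - η` lies in `𝔠^⊥`, and in `𝔥` by (m1). So `u` is tangent to a
  -- residual orbit and maps to zero.
  · obtain ⟨ξ, u, α, h1, h2, h3, h4⟩ := hX
    obtain ⟨η, hη, hmem⟩ := hvanish ξ u α h1 (by simpa using h4)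
    simp only at h2 h3
    rw [← h3]
    exact (h.ker_source u).2 ⟨_, h.exact.range_le _ _ hmem,
      Submodule.sub_mem _ ((Q.proj_eq_zero_iff 𝔠 ξ).1 h2) hη, hmem⟩

end IsReductionFibre

end Fibres

/-! ### From manifolds to fibres. -/

section PointwiseReduction

variable {𝔡 : Type*} [LieRing 𝔡] [LieAlgebra ℝ 𝔡]
  {E : Type*} [NormedAddCommGroup E] [NormedSpace ℝ E]
  {M : Type*} [TopologicalSpace M] [ChartedSpace E M] [IsManifold 𝓘(ℝ, E) ∞ M]
  {F : Type*} [NormedAddCommGroup F] [NormedSpace ℝ F]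
  {N : Type*} [TopologicalSpace N] [ChartedSpace F N] [IsManifold 𝓘(ℝ, F) ∞ N]

/-- The value at the point `n` of an infinitesimal action. -/
noncomputable def actionAt (ρ : 𝔡 →ₗ[ℝ] Π n : N, TangentSpace 𝓘(ℝ, F) n) (n : N) : 𝔡 →ₗ[ℝ] F :=
  (LinearMap.proj (R := ℝ) (φ := fun n : N => TangentSpace 𝓘(ℝ, F) n) n).comp ρ

/-- Base points such as `iN (j p)` and `μ (iM p)` agree only propositionally; viewing tangent
vectors in the model space makes their comparison possible. -/
lemma actionAt_congr (ρ : 𝔡 →ₗ[ℝ] Π n : N, TangentSpace 𝓘(ℝ, F) n) {n n' : N} (h : n = n') (ξ : 𝔡) :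
    (ρ ξ n : F) = (ρ ξ n' : F) := by
  subst h; rfl

variable {Q : QuadraticPairing 𝔡} {ρ : 𝔡 →ₗ[ℝ] Π n : N, TangentSpace 𝓘(ℝ, F) n}
  {𝔥 𝔠 : LieSubalgebra ℝ 𝔡} {μ : M → N} {L : Π m : M, Submodule ℝ (CourantFibre 𝔡 E m)}

theorem IsManinPairMorphism.isExactFibre [FiniteDimensional ℝ F] (hL : IsManinPairMorphism Q ρ 𝔥 μ L)
    (hex : IsExactOnGraph Q ρ μ L) (m : M) :
    IsExactFibre (A := E) (B := F) Q 𝔥 (actionAt ρ (μ m)) (mfderiv 𝓘(ℝ, E) 𝓘(ℝ, F) μ m : E →L[ℝ] F)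
      (L m : Submodule ℝ (𝔡 × E × (E →L[ℝ] ℝ))) where
  lagrangian := hL.dirac.lagrangian m
  anchor_mem := hex.anchor_mem m
  anchor_surjective v := by
    obtain ⟨z, hz, h⟩ := hex.anchor_surjective m v
    exact ⟨z, hz, congrArg Prod.snd h⟩
  middle ζ α h := by
    have h0 : courantAnchor ρ (μ m) m (ζ, 0, α) = 0 := by
      have := hex.anchor_mem m _ h
      exact Prod.ext (this.trans (map_zero _)) rfl
    obtain ⟨(ℓ : F →L[ℝ] ℝ), (β : E →L[ℝ] ℝ), h1, h2⟩ := (hex.exact_middle m _).1 ⟨h, h0⟩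
    have hα : ∀ v : E, α v = -β v := fun v => by
      have h4 : Q.form ζ 0 - (α v + (0 : E →L[ℝ] ℝ) 0) = ℓ (actionAt ρ (μ m) 0) + β v :=
        h2 (0, v, 0)
      simp only [map_zero, zero_add, add_zero, zero_sub] at h4
      linarith
    refine ⟨ℓ, fun η => ?_, ?_⟩
    · have h4 : Q.form ζ η - (α 0 + (0 : E →L[ℝ] ℝ) 0) = ℓ (actionAt ρ (μ m) η) + β 0 :=
        h2 (η, 0, 0)
      simpa using h4
    · ext v
      exact (hα v).trans (neg_eq_of_add_eq_zero_left (h1 v))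
  -- A covector that kills the image of the action also kills the image of `dμ`, since every tangent
  -- vector of `M` lifts to `L`. Then `(ℓ, 0)` annihilates the graph and has zero coanchor, so it is
  -- zero by injectivity of `a^*`.
  surjective := by
    rw [← LinearMap.dualMap_injective_iff, injective_iff_map_eq_zero]
    intro ℓ hℓ
    have hℓ' : ∀ η, ℓ (ρ η (μ m)) = 0 := fun η => LinearMap.congr_fun hℓ η
    have h := (hex.coanchor_injective m (LinearMap.toContinuousLinearMap ℓ : F →L[ℝ] ℝ) 0 (fun v => by
      obtain ⟨z, hz, h⟩ := hex.anchor_surjective m v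
      have h2 := hℓ' z.1
      rw [hex.anchor_mem m z hz] at h2
      have h3 : z.2.1 = v := congrArg Prod.snd h
      rw [h3] at h2
      exact (add_zero _).trans h2) (fun w => by
      refine Eq.trans ?_ (((add_zero _).trans (hℓ' w.1)).symm)
      simp [courantPairing])).1
    ext x
    exact congrArg (fun T : F →L[ℝ] ℝ => T x) h
  range_le := hL.range_le m
  ker_inter := hL.ker_inter m

variable {E₁ : Type*} [NormedAddCommGroup E₁] [NormedSpace ℝ E₁]
  {P : Type*} [TopologicalSpace P] [ChartedSpace E₁ P]
  {F₁ : Type*} [NormedAddCommGroup F₁] [NormedSpace ℝ F₁]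
  {S : Type*} [TopologicalSpace S] [ChartedSpace F₁ S]
  {E₂ : Type*} [NormedAddCommGroup E₂] [NormedSpace ℝ E₂]
  {M' : Type*} [TopologicalSpace M'] [ChartedSpace E₂ M']
  {F₂ : Type*} [NormedAddCommGroup F₂] [NormedSpace ℝ F₂]
  {N' : Type*} [TopologicalSpace N'] [ChartedSpace F₂ N']
  {iN : S → N} {qN : S → N'} {iM : P → M} {j : P → S} {qM : P → M'}

variable (E E₁ E₂ F F₁ F₂) in
/-- Reductive data for an exact morphism of Manin pairs, with a transitive action on `S`. -/
structure IsExactReduction (Q : QuadraticPairing 𝔡)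
    (ρ : 𝔡 →ₗ[ℝ] Π n : N, TangentSpace 𝓘(ℝ, F) n)
    (𝔥 : LieSubalgebra ℝ 𝔡) (μ : M → N) (L : Π m : M, Submodule ℝ (CourantFibre 𝔡 E m))
    (𝔠 : LieSubalgebra ℝ 𝔡) (iN : S → N) (qN : S → N') (iM : P → M) (j : P → S)
    (qM : P → M') : Prop where
  pair : IsActionManinPair Q ρ 𝔥
  morphism : IsManinPairMorphism Q ρ 𝔥 μ L
  data : IsReductiveData (E := E) (F := F) (E₁ := E₁) (F₁ := F₁) (E₂ := E₂) (F₂ := F₂)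
      Q ρ 𝔥 μ L 𝔠 iN qN iM j qM
  transitive : IsTransitiveOn (F := F) (F₁ := F₁) ρ 𝔠 iN
  exact : IsExactOnGraph Q ρ μ L

namespace IsExactReduction

lemma base_eq (h : IsExactReduction E F E₁ F₁ E₂ F₂ Q ρ 𝔥 μ L 𝔠 iN qN iM j qM) (p : P) :
    iN (j p) = μ (iM p) :=
  (h.data.clean.range_eq (j p) (iM p)).1 ⟨p, rfl, rfl⟩

lemma lagrangian (h : IsExactReduction E F E₁ F₁ E₂ F₂ Q ρ 𝔥 μ L 𝔠 iN qN iM j qM) :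
    IsLagrangianOverGraph Q ρ μ L :=
  h.morphism.dirac.isLagrangianOverGraph h.exact

lemma comm (h : IsExactReduction E F E₁ F₁ E₂ F₂ Q ρ 𝔥 μ L 𝔠 iN qN iM j qM) (p : P) (u : E₁) :
    (mfderiv 𝓘(ℝ, E) 𝓘(ℝ, F) μ (iM p) (mfderiv 𝓘(ℝ, E₁) 𝓘(ℝ, E) iM p u) : F) =
      mfderiv 𝓘(ℝ, F₁) 𝓘(ℝ, F) iN (j p) (mfderiv 𝓘(ℝ, E₁) 𝓘(ℝ, F₁) j p u) := by
  have h1 := mfderiv_comp p (h.morphism.smooth_map.mdifferentiable (by simp) (iM p))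
    (h.data.clean.smooth_incl.mdifferentiable (by simp) p)
  have h2 := mfderiv_comp p (h.data.smooth_incl.mdifferentiable (by simp) (j p))
    (h.data.clean.smooth_restr.mdifferentiable (by simp) p)
  have h3 : μ ∘ iM = iN ∘ j := funext fun p => (h.base_eq p).symm
  have h4 : ∀ f g : P → N, f = g → ∀ u : E₁, (mfderiv 𝓘(ℝ, E₁) 𝓘(ℝ, F) f p u : F) =
      mfderiv 𝓘(ℝ, E₁) 𝓘(ℝ, F) g p u := by
    rintro f _ rfl u
    rfl
  exact (congrArg (fun T : E₁ →L[ℝ] F => T u) h1).symm.trans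
    ((h4 _ _ h3 u).trans (congrArg (fun T : E₁ →L[ℝ] F => T u) h2))

/-- A vector killed by `iM` is sent by `j` into the kernel of the immersion `iN`; hence it is killed
by both `j` and `iM`, against the embedding condition on `P`. -/
lemma injective_source (h : IsExactReduction E F E₁ F₁ E₂ F₂ Q ρ 𝔥 μ L 𝔠 iN qN iM j qM) (p : P) :
    Function.Injective (mfderiv 𝓘(ℝ, E₁) 𝓘(ℝ, E) iM p : E₁ →L[ℝ] E) := by
  rw [injective_iff_map_eq_zero]
  intro u hu
  refine h.data.clean.immersion p u (h.data.immersion (j p) ?_) hu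
  have h1 := h.comm p u
  refine Eq.trans ?_ (map_zero (mfderiv 𝓘(ℝ, F₁) 𝓘(ℝ, F) iN (j p))).symm
  refine Eq.trans h1.symm ?_
  exact (congrArg (mfderiv 𝓘(ℝ, E) 𝓘(ℝ, F) μ (iM p) : E →L[ℝ] F) hu).trans (map_zero _)

lemma ker_target (h : IsExactReduction E F E₁ F₁ E₂ F₂ Q ρ 𝔥 μ L 𝔠 iN qN iM j qM) (s : S) (v : F₁) :
    (mfderiv 𝓘(ℝ, F₁) 𝓘(ℝ, F₂) qN s v : F₂) = 0 ↔ ∃ ξ ∈ Q.form.orthogonal 𝔠.toSubmodule,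
      (mfderiv 𝓘(ℝ, F₁) 𝓘(ℝ, F) iN s v : F) = actionAt ρ (iN s) ξ := by
  refine (h.data.quotient_N.tangent s v).trans ⟨?_, ?_⟩
  · rintro ⟨X, ⟨ξ, hξ, hX⟩, rfl⟩
    exact ⟨ξ, hξ, hX s⟩
  · rintro ⟨ξ, hξ, hv⟩
    choose X hX using h.data.invariant ξ (h.data.coisotropic hξ)
    exact ⟨X, ⟨ξ, hξ, hX⟩, h.data.immersion s ((hX s).trans hv.symm)⟩

/-- For `ξ ∈ 𝔥 ∩ 𝔠`, `dμ` maps `ρ_R(ξ)` to the value of `ξ` at `iN (j p)`, which is tangent to `S`,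
so cleanness makes `ρ_R(ξ)` tangent to the preimage. -/
lemma exists_residual [FiniteDimensional ℝ 𝔡] [FiniteDimensional ℝ E] [FiniteDimensional ℝ F]
    (h : IsExactReduction E F E₁ F₁ E₂ F₂ Q ρ 𝔥 μ L 𝔠 iN qN iM j qM) (p : P) {ξ : 𝔡}
    (h𝔥 : ξ ∈ 𝔥) (h𝔠 : ξ ∈ 𝔠) :
    ∃ u : E₁, ((ξ, mfderiv 𝓘(ℝ, E₁) 𝓘(ℝ, E) iM p u, 0) : CourantFibre 𝔡 E (iM p)) ∈ L (iM p) := by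
  have hfib := h.morphism.isExactFibre h.exact (iM p)
  obtain ⟨X, hX⟩ := hfib.exists_vector h.pair.lagrangian h𝔥
  obtain ⟨v, hv⟩ := h.data.invariant ξ h𝔠 (j p)
  obtain ⟨u, -, hu⟩ := h.data.clean.clean p v X
    (Eq.trans hv ((actionAt_congr ρ (h.base_eq p) ξ).trans (hfib.anchor_mem _ hX)))
  refine ⟨u, ?_⟩
  have : mfderiv 𝓘(ℝ, E₁) 𝓘(ℝ, E) iM p u = X := hu
  rw [this]
  exact hX

/-- The regular foliation condition speaks of vector fields on all of `P`. A single `ξ` generates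
such a field by `exists_residual`, and its value at `p` is the given vector because `ρ_R(ξ)` is
unique. -/
lemma ker_source [FiniteDimensional ℝ 𝔡] [FiniteDimensional ℝ E] [FiniteDimensional ℝ F]
    (h : IsExactReduction E F E₁ F₁ E₂ F₂ Q ρ 𝔥 μ L 𝔠 iN qN iM j qM) (p : P) (u : E₁) :
    (mfderiv 𝓘(ℝ, E₁) 𝓘(ℝ, E₂) qM p u : E₂) = 0 ↔ ∃ ξ ∈ 𝔥, ξ ∈ Q.form.orthogonal 𝔠.toSubmodule ∧
      ((ξ, mfderiv 𝓘(ℝ, E₁) 𝓘(ℝ, E) iM p u, 0) : CourantFibre 𝔡 E (iM p)) ∈ L (iM p) := by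
  refine (h.data.quotient_M.tangent p u).trans ⟨?_, ?_⟩
  · rintro ⟨X, ⟨ξ, hξ, hξ', hX⟩, rfl⟩
    exact ⟨ξ, hξ, hξ', hX p⟩
  · rintro ⟨ξ, hξ, hξ', hu⟩
    choose X hX using fun p => h.exists_residual p hξ (h.data.coisotropic hξ')
    exact ⟨X, ⟨ξ, hξ, hξ', hX⟩, h.injective_source p
      ((h.morphism.isExactFibre h.exact (iM p)).vector_unique (hX p) hu)⟩

theorem isReductionFibre [FiniteDimensional ℝ 𝔡] [FiniteDimensional ℝ E] [FiniteDimensional ℝ F]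
    (h : IsExactReduction E F E₁ F₁ E₂ F₂ Q ρ 𝔥 μ L 𝔠 iN qN iM j qM) (p : P) :
    IsReductionFibre (A := E) (B := F) (A₁ := E₁) (A₂ := E₂) (B₁ := F₁) (B₂ := F₂) Q 𝔥 𝔠 (actionAt ρ (μ (iM p)))
      (mfderiv 𝓘(ℝ, E) 𝓘(ℝ, F) μ (iM p) : E →L[ℝ] F)
      (L (iM p) : Submodule ℝ (𝔡 × E × (E →L[ℝ] ℝ)))
      (mfderiv 𝓘(ℝ, F₁) 𝓘(ℝ, F) iN (j p) : F₁ →L[ℝ] F)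
      (mfderiv 𝓘(ℝ, F₁) 𝓘(ℝ, F₂) qN (j p) : F₁ →L[ℝ] F₂)
      (mfderiv 𝓘(ℝ, E₁) 𝓘(ℝ, E) iM p : E₁ →L[ℝ] E)
      (mfderiv 𝓘(ℝ, E₁) 𝓘(ℝ, F₁) j p : E₁ →L[ℝ] F₁)
      (mfderiv 𝓘(ℝ, E₁) 𝓘(ℝ, E₂) qM p : E₁ →L[ℝ] E₂) where
  exact := h.morphism.isExactFibre h.exact (iM p)
  coisotropic := h.data.coisotropic
  comm := h.comm p
  injective := h.data.immersion (j p)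
  clean := h.data.clean.clean p
  invariant ξ hξ := by
    obtain ⟨v, hv⟩ := h.data.invariant ξ hξ (j p)
    exact ⟨v, Eq.trans hv (actionAt_congr ρ (h.base_eq p) ξ)⟩
  transitive v := by
    obtain ⟨ξ, hξ, hv⟩ := h.transitive (j p) v
    exact ⟨ξ, hξ, Eq.trans hv (actionAt_congr ρ (h.base_eq p) ξ)⟩
  surjective := h.data.quotient_N.submersion (j p)
  surjective_source := h.data.quotient_M.submersion p
  ker v := by
    refine (h.ker_target (j p) v).trans (exists_congr fun ξ => and_congr_right fun _ => ?_)
    have : actionAt ρ (iN (j p)) ξ = actionAt ρ (μ (iM p)) ξ := actionAt_congr ρ (h.base_eq p) ξ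
    exact ⟨fun h => h.trans this, fun h => h.trans this.symm⟩
  ker_source := h.ker_source p

end IsExactReduction

end PointwiseReduction

/-! ### Local normal form and local sections of submersions. -/

section Submersions

open Filter Topology

/-- The inverse function theorem, with smoothness near the point. -/
lemma exists_openPartialHomeomorph {A B : Type*} [NormedAddCommGroup A] [NormedSpace ℝ A]
    [NormedAddCommGroup B] [NormedSpace ℝ B] [CompleteSpace A] {f : A → B} {a : A} (e : A ≃L[ℝ] B)
    (hf : ∀ᶠ x in 𝓝 a, ContDiffAt ℝ ∞ f x) (he : fderiv ℝ f a = e) :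
    ∃ g : OpenPartialHomeomorph A B, a ∈ g.source ∧ (∀ x, g x = f x) ∧
      ∀ᶠ y in 𝓝 (f a), ContDiffAt ℝ ∞ g.symm y := by
  have hfa := hf.self_of_nhds
  have hd : HasFDerivAt f (e : A →L[ℝ] B) a := by
    rw [← he]
    exact (hfa.differentiableAt (by simp)).hasFDerivAt
  have hn : (∞ : WithTop ℕ∞) ≠ 0 := by simp
  refine ⟨hfa.toOpenPartialHomeomorph f hd hn, hfa.mem_toOpenPartialHomeomorph_source hd hn,
    fun x => rfl, ?_⟩
  set g := hfa.toOpenPartialHomeomorph f hd hn with hg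
  have hmem : f a ∈ g.target := g.map_source (hfa.mem_toOpenPartialHomeomorph_source hd hn)
  have hga : g.symm (f a) = a := g.left_inv (hfa.mem_toOpenPartialHomeomorph_source hd hn)
  have hcont : Tendsto g.symm (𝓝 (f a)) (𝓝 a) := by
    have := g.continuousAt_symm hmem
    rwa [ContinuousAt, hga] at this
  have hinv : ∀ᶠ x in 𝓝 a, ∃ e' : A ≃L[ℝ] B, (e' : A →L[ℝ] B) = fderiv ℝ f x := by
    have hc : ContinuousAt (fderiv ℝ f) a :=
      (hfa.fderiv_right (m := ∞) (by simp)).continuousAt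
    have := e.nhds
    rw [← he] at this
    filter_upwards [hc this] with x hx using hx
  filter_upwards [hcont.eventually hf, hcont.eventually hinv, g.open_target.mem_nhds hmem]
    with y hy ⟨e', he'⟩ hyt
  refine g.contDiffAt_symm hyt (f₀' := e') ?_ hy
  rw [he']
  exact (hy.differentiableAt (by simp)).hasFDerivAt

variable {E₁ : Type*} [NormedAddCommGroup E₁] [NormedSpace ℝ E₁] [FiniteDimensional ℝ E₁]
  {P : Type*} [TopologicalSpace P] [ChartedSpace E₁ P] [IsManifold 𝓘(ℝ, E₁) ∞ P]
  {E₂ : Type*} [NormedAddCommGroup E₂] [NormedSpace ℝ E₂] [FiniteDimensional ℝ E₂]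
  {Y : Type*} [TopologicalSpace Y] [ChartedSpace E₂ Y] [IsManifold 𝓘(ℝ, E₂) ∞ Y]

/-- Local normal form of a submersion. -/
theorem exists_submersion_chart {q : P → Y} (hq : ContMDiff 𝓘(ℝ, E₁) 𝓘(ℝ, E₂) ∞ q) (p₀ : P)
    (hs : Function.Surjective (mfderiv 𝓘(ℝ, E₁) 𝓘(ℝ, E₂) q p₀)) :
    ∃ (G : Submodule ℝ E₁) (Ψ : E₂ × G → P) (r : ℝ), 0 < r ∧
      Ψ (extChartAt 𝓘(ℝ, E₂) (q p₀) (q p₀), 0) = p₀ ∧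
      (∀ z ∈ Metric.ball (extChartAt 𝓘(ℝ, E₂) (q p₀) (q p₀), (0 : G)) r,
        ContMDiffAt 𝓘(ℝ, E₂ × G) 𝓘(ℝ, E₁) ∞ Ψ z ∧
        z.1 ∈ (extChartAt 𝓘(ℝ, E₂) (q p₀)).target ∧
        q (Ψ z) = (extChartAt 𝓘(ℝ, E₂) (q p₀)).symm z.1) ∧
      ∀ᶠ p in 𝓝 p₀, ∃ z ∈ Metric.ball (extChartAt 𝓘(ℝ, E₂) (q p₀) (q p₀), (0 : G)) r, Ψ z = p := by
  have : IsManifold 𝓘(ℝ, E₁) 1 P := isManifold_one_of_infty E₁ P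
  have : IsManifold 𝓘(ℝ, E₂) 1 Y := isManifold_one_of_infty E₂ Y
  set c := extChartAt 𝓘(ℝ, E₁) p₀ with hc
  set d := extChartAt 𝓘(ℝ, E₂) (q p₀) with hd
  let f : E₁ → E₂ := fun x => d (q (c.symm x))
  have hcp : c.symm (c p₀) = p₀ := extChartAt_to_inv p₀
  have hct : ∀ᶠ x in 𝓝 (c p₀), x ∈ c.target := extChartAt_target_mem_nhds p₀
  have hsymm : ∀ x ∈ c.target, ContMDiffAt 𝓘(ℝ, E₁) 𝓘(ℝ, E₁) ∞ c.symm x := fun x hx =>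
    (contMDiffOn_extChartAt_symm p₀).contMDiffAt ((isOpen_extChartAt_target p₀).mem_nhds hx)
  have hctend : Tendsto c.symm (𝓝 (c p₀)) (𝓝 p₀) := by
    have := (hsymm _ (mem_extChartAt_target p₀)).continuousAt
    rwa [ContinuousAt, hcp] at this
  have hqs : ∀ᶠ x in 𝓝 (c p₀), q (c.symm x) ∈ (chartAt E₂ (q p₀)).source :=
    hctend.eventually (eventually_mem_chartAt (E := E₂) hq.continuous.continuousAt)
  have hf : ∀ᶠ x in 𝓝 (c p₀), ContDiffAt ℝ ∞ f x := by
    filter_upwards [hct, hqs] with x hx hx'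
    exact contDiffAt_extChartAt_comp (φ := fun x => q (c.symm x))
      ((hq _).comp x (hsymm x hx)) hx'
  have hcm : MDifferentiableAt 𝓘(ℝ, E₁) 𝓘(ℝ, E₁) c.symm (c p₀) :=
    (hsymm _ (mem_extChartAt_target p₀)).mdifferentiableAt (by simp)
  have hfs : Function.Surjective (fderiv ℝ f (c p₀)) := by
    intro y
    obtain ⟨w, hw⟩ := hs y
    have h1 : MDifferentiableAt 𝓘(ℝ, E₁) 𝓘(ℝ, E₁) c p₀ :=
      mdifferentiableAt_extChartAt (mem_chart_source E₁ p₀)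
    have hfd : MDifferentiableAt 𝓘(ℝ, E₁) 𝓘(ℝ, E₂) f (c p₀) :=
      mdifferentiableAt_iff_differentiableAt.2 (hf.self_of_nhds.differentiableAt (by simp))
    have h2 := mfderiv_comp p₀ hfd h1
    have h3 : f ∘ c =ᶠ[𝓝 p₀] fun p => d (q p) := by
      filter_upwards [extChartAt_source_mem_nhds (I := 𝓘(ℝ, E₁)) p₀] with p hp
      exact congrArg (fun p => d (q p)) (c.left_inv hp)
    have h4 : mfderiv 𝓘(ℝ, E₁) 𝓘(ℝ, E₂) (f ∘ c) p₀ w = y := by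
      rw [h3.mfderiv_eq]
      have h5 := coordAt_mfderiv (hq.mdifferentiable (by simp) p₀) (mem_chart_source E₂ (q p₀)) w
      refine Eq.trans h5.symm ?_
      rw [coordAt_self, hw]
    refine ⟨mfderiv 𝓘(ℝ, E₁) 𝓘(ℝ, E₁) c p₀ w, ?_⟩
    rw [← mfderiv_eq_fderiv, ← h4]
    exact (congrArg (fun T : E₁ →L[ℝ] E₂ => T w) h2).symm
  -- `G` is the vertical space. Adding to `f` a projection onto `G` gives a map with bijective
  -- derivative, and its local inverse is the adapted parametrization.
  let G : Submodule ℝ E₁ := LinearMap.ker (fderiv ℝ f (c p₀) : E₁ →ₗ[ℝ] E₂)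
  obtain ⟨A, hA⟩ := G.subtype.exists_leftInverse_of_injective (by simp)
  have hA' : ∀ w : G, A w = w := fun w => LinearMap.congr_fun hA w
  let A' : E₁ →L[ℝ] G := LinearMap.toContinuousLinearMap A
  let g : E₁ → E₂ × G := fun x => (f x, A' (x - c p₀))
  have hg : ∀ᶠ x in 𝓝 (c p₀), ContDiffAt ℝ ∞ g x := by
    filter_upwards [hf] with x hx
    exact hx.prodMk (A'.contDiff.contDiffAt.comp x (contDiffAt_id.sub contDiffAt_const))
  have hgd : fderiv ℝ g (c p₀) = (fderiv ℝ f (c p₀)).prod A' := by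
    have h1 : HasFDerivAt (fun x => A' (x - c p₀)) A' (c p₀) := by
      have := A'.hasFDerivAt.comp (c p₀) ((hasFDerivAt_id (𝕜 := ℝ) (c p₀)).sub_const (c p₀))
      exact this
    exact ((hf.self_of_nhds.differentiableAt (by simp)).hasFDerivAt.prodMk h1).fderiv
  have hbij : Function.Bijective ((fderiv ℝ f (c p₀)).prod A' : E₁ →ₗ[ℝ] E₂ × G) := by
    constructor
    · rw [injective_iff_map_eq_zero]
      intro v hv
      have h1 : fderiv ℝ f (c p₀) v = 0 := congrArg Prod.fst hv
      have h2 : A v = 0 := congrArg Prod.snd hv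
      have h3 := hA' ⟨v, h1⟩
      rw [h2] at h3
      exact (congrArg Subtype.val h3).symm
    · rintro ⟨y, w⟩
      obtain ⟨v, hv⟩ := hfs y
      refine ⟨v + (w - A v : G), Prod.ext ?_ ?_⟩
      · have : fderiv ℝ f (c p₀) ((w - A v : G) : E₁) = 0 := (w - A v : G).2
        change fderiv ℝ f (c p₀) (v + ((w - A v : G) : E₁)) = y
        rw [map_add, this, hv, add_zero]
      · change A (v + ((w - A v : G) : E₁)) = w
        rw [map_add, hA', add_sub_cancel]
  let e : E₁ ≃L[ℝ] E₂ × G := (LinearEquiv.ofBijective _ hbij).toContinuousLinearEquiv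
  obtain ⟨k, hk0, hk, hks⟩ := exists_openPartialHomeomorph e hg (by
    rw [hgd]
    ext v <;> rfl)
  have hg0 : g (c p₀) = (d (q p₀), 0) := by
    simp only [g, f, hcp, sub_self, map_zero]
  rw [hg0] at hks
  have hkt : (d (q p₀), (0 : G)) ∈ k.target := by
    rw [← hg0, ← hk]
    exact k.map_source hk0
  have hk1 : k.symm (d (q p₀), 0) = c p₀ := by
    rw [← hg0, ← hk, k.left_inv hk0]
  have hktend : Tendsto k.symm (𝓝 (d (q p₀), 0)) (𝓝 (c p₀)) := by
    have := k.continuousAt_symm hkt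
    rwa [ContinuousAt, hk1] at this
  have hall : ∀ᶠ z in 𝓝 (d (q p₀), (0 : G)), ContDiffAt ℝ ∞ k.symm z ∧ z ∈ k.target ∧
      k.symm z ∈ c.target ∧ q (c.symm (k.symm z)) ∈ (chartAt E₂ (q p₀)).source := by
    filter_upwards [hks, k.open_target.mem_nhds hkt, hktend.eventually hct,
      hktend.eventually hqs] with z h1 h2 h3 h4 using ⟨h1, h2, h3, h4⟩
  obtain ⟨r, hr, hball⟩ := Metric.eventually_nhds_iff_ball.1 hall
  refine ⟨G, fun z => c.symm (k.symm z), r, hr, by simp only [hk1, hcp], fun z hz => ?_, ?_⟩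
  · obtain ⟨h1, h2, h3, h4⟩ := hball z hz
    have h5 : f (k.symm z) = z.1 := by
      have := k.right_inv h2
      rw [hk] at this
      exact congrArg Prod.fst this
    have h6 : q (c.symm (k.symm z)) ∈ d.source := by rwa [hd, extChartAt_source]
    refine ⟨(hsymm _ h3).comp z h1.contMDiffAt, ?_, ?_⟩
    · rw [← h5]
      exact d.map_source h6
    · rw [← h5]
      exact (d.left_inv h6).symm
  · have hctd : Tendsto c (𝓝 p₀) (𝓝 (c p₀)) := continuousAt_extChartAt p₀
    have hgc : Tendsto (fun p => k (c p)) (𝓝 p₀) (𝓝 (d (q p₀), 0)) := by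
      have := (k.continuousAt hk0).tendsto.comp hctd
      rwa [hk, hg0] at this
    filter_upwards [hgc.eventually (Metric.ball_mem_nhds _ hr),
      extChartAt_source_mem_nhds (I := 𝓘(ℝ, E₁)) p₀,
      hctd.eventually (k.open_source.mem_nhds hk0)] with p h1 h2 h3
    refine ⟨k (c p), h1, ?_⟩
    simp only [k.left_inv h3]
    exact c.left_inv h2

/-- A submersion has smooth local sections. -/
theorem exists_local_section {q : P → Y} (hq : ContMDiff 𝓘(ℝ, E₁) 𝓘(ℝ, E₂) ∞ q) (p₀ : P)
    (hs : Function.Surjective (mfderiv 𝓘(ℝ, E₁) 𝓘(ℝ, E₂) q p₀)) :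
    ∃ σ : Y → P, σ (q p₀) = p₀ ∧ ∀ᶠ y in 𝓝 (q p₀), ContMDiffAt 𝓘(ℝ, E₂) 𝓘(ℝ, E₁) ∞ σ y ∧
      q (σ y) = y := by
  obtain ⟨G, Ψ, r, hr, h0, hΨ, -⟩ := exists_submersion_chart hq p₀ hs
  set d := extChartAt 𝓘(ℝ, E₂) (q p₀) with hd
  refine ⟨fun y => Ψ (d y, 0), h0, ?_⟩
  have hdt : Tendsto (fun y => (d y, (0 : G))) (𝓝 (q p₀)) (𝓝 (d (q p₀), 0)) :=
    (continuousAt_extChartAt (q p₀)).tendsto.prodMk_nhds tendsto_const_nhds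
  filter_upwards [hdt.eventually (Metric.ball_mem_nhds _ hr),
    extChartAt_source_mem_nhds (I := 𝓘(ℝ, E₂)) (q p₀)] with y hy hy'
  obtain ⟨h1, -, h3⟩ := hΨ _ hy
  refine ⟨?_, h3.trans (d.left_inv hy')⟩
  refine ContMDiffAt.comp (I' := 𝓘(ℝ, E₂ × G)) y h1 ?_
  rw [modelWithCornersSelf_prod, ← chartedSpaceSelf_prod]
  exact (contMDiffAt_extChartAt' (by rwa [extChartAt_source] at hy')).prodMk contMDiffAt_const

end Submersions

/-! ### Smoothness of vector fields through an immersion. -/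

section Immersions

open Filter Topology

variable {E : Type*} [NormedAddCommGroup E] [NormedSpace ℝ E] [FiniteDimensional ℝ E]
  {M : Type*} [TopologicalSpace M] [ChartedSpace E M] [IsManifold 𝓘(ℝ, E) ∞ M]
  {F : Type*} [NormedAddCommGroup F] [NormedSpace ℝ F] [FiniteDimensional ℝ F]
  {N : Type*} [TopologicalSpace N] [ChartedSpace F N] [IsManifold 𝓘(ℝ, F) ∞ N]
  {G H : Type*} [NormedAddCommGroup G] [NormedSpace ℝ G] [TopologicalSpace H]
  {I : ModelWithCorners ℝ G H} {Z : Type*} [TopologicalSpace Z] [ChartedSpace H Z]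

lemma contMDiffAt_inverse_coordAt {f : Z → M} {z₀ : Z} (hf : ContMDiffAt I 𝓘(ℝ, E) ∞ f z₀)
    (a : E) : ContMDiffAt I 𝓘(ℝ, E).tangent ∞
      (fun z => (⟨f z, (coordAt (E := E) (f z₀) (f z)).inverse a⟩ : TangentBundle 𝓘(ℝ, E) M)) z₀ := by
  rw [contMDiffAt_tangent_iff]
  refine ⟨hf, (contMDiffAt_const (c := a)).congr_of_eventuallyEq ?_⟩
  filter_upwards [eventually_mem_chartAt (E := E) hf.continuousAt] with z hz
  obtain ⟨e, he⟩ := coordAt_isInvertible (E := E) hz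
  rw [← he]
  simp

/-- A vector field along a map into the source of an immersion is smooth if its image is. -/
theorem ContMDiffAt.of_mfderiv_immersion {φ : M → N} (hφ : ContMDiff 𝓘(ℝ, E) 𝓘(ℝ, F) ∞ φ) {f : Z → M}
    {X : Π z, TangentSpace 𝓘(ℝ, E) (f z)} {z₀ : Z} (hf : ContMDiffAt I 𝓘(ℝ, E) ∞ f z₀)
    (hinj : Function.Injective (mfderiv 𝓘(ℝ, E) 𝓘(ℝ, F) φ (f z₀)))
    (hX : ContMDiffAt I 𝓘(ℝ, F).tangent ∞
      (fun z => (⟨φ (f z), mfderiv 𝓘(ℝ, E) 𝓘(ℝ, F) φ (f z) (X z)⟩ :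
        TangentBundle 𝓘(ℝ, F) N)) z₀) :
    ContMDiffAt I 𝓘(ℝ, E).tangent ∞
      (fun z => (⟨f z, X z⟩ : TangentBundle 𝓘(ℝ, E) M)) z₀ := by
  rw [contMDiffAt_tangent_iff]
  refine ⟨hf, ?_⟩
  let T : Z → E →L[ℝ] F := fun z => (coordAt (E := F) (φ (f z₀)) (φ (f z))).comp
    ((mfderiv 𝓘(ℝ, E) 𝓘(ℝ, F) φ (f z)).comp (coordAt (E := E) (f z₀) (f z)).inverse)
  have hT : ContMDiffAt I 𝓘(ℝ, E →L[ℝ] F) ∞ T z₀ := contMDiffAt_clm_of_apply fun a =>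
    (contMDiffAt_tangent_iff.1 (ContMDiffAt.mfderiv_tangent hφ (contMDiffAt_inverse_coordAt hf a))).2
  have hc0 : ∀ v : E, (coordAt (E := E) (f z₀) (f z₀)).inverse v = v := fun v => by
    obtain ⟨e, he⟩ := coordAt_isInvertible (E := E) (mem_chart_source E (f z₀))
    have h1 : e v = v := by
      have := coordAt_self (f z₀) v
      rw [← he] at this
      exact this
    rw [← he]
    have h2 : e.symm v = v := e.symm_apply_eq.2 h1.symm
    exact (congrArg (fun T : E →L[ℝ] TangentSpace 𝓘(ℝ, E) (f z₀) => T v)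
      (ContinuousLinearMap.inverse_equiv e)).trans h2
  have hT0 : Function.Injective (T z₀) := by
    intro v w hvw
    have h1 : ∀ v : E, T z₀ v = mfderiv 𝓘(ℝ, E) 𝓘(ℝ, F) φ (f z₀) v := fun v =>
      (coordAt_self _ _).trans (congrArg (mfderiv 𝓘(ℝ, E) 𝓘(ℝ, F) φ (f z₀)) (hc0 v))
    rw [h1, h1] at hvw
    exact hinj hvw
  -- `T` is the derivative of `φ` in charts. A left inverse `A` of its value at `z₀` makes `A ∘ T z`
  -- invertible near `z₀`, so the field can be solved for smoothly.
  obtain ⟨A, hA⟩ := (T z₀ : E →ₗ[ℝ] F).exists_leftInverse_of_injective (LinearMap.ker_eq_bot.2 hT0)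
  let A' : F →L[ℝ] E := LinearMap.toContinuousLinearMap A
  refine ContMDiffAt.of_clm_apply (T := fun z => A'.comp (T z))
    ((contMDiffAt_const (c := A')).clm_comp hT) ?_ ?_
  · refine ⟨ContinuousLinearEquiv.refl ℝ E, ?_⟩
    ext v
    exact (LinearMap.congr_fun hA v).symm
  · have h1 := (contMDiffAt_tangent_iff.1 hX).2
    refine ((A'.contDiff.contMDiff.contMDiffAt).comp z₀ h1).congr_of_eventuallyEq ?_
    filter_upwards [eventually_mem_chartAt (E := E) hf.continuousAt] with z hz
    obtain ⟨e, he⟩ := coordAt_isInvertible (E := E) hz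
    simp only [T, ← he, Function.comp_apply, ContinuousLinearMap.comp_apply,
      ContinuousLinearMap.inverse_equiv, ContinuousLinearEquiv.coe_coe,
      ContinuousLinearEquiv.symm_apply_apply]

end Immersions

/-! ### The induced action of `𝔠 / 𝔠^⊥` on the quotient of `S`. -/

section ReducedAction

open Filter Topology Set

lemma eq_of_hasDerivWithinAt_zero {f : ℝ → ℝ} {a b : ℝ}
    (h : ∀ t ∈ Icc a b, HasDerivWithinAt f 0 (Icc a b) t) : ∀ t ∈ Icc a b, f t = f a := by
  refine constant_of_derivWithin_zero (fun t ht => (h t ht).differentiableWithinAt) fun t ht => ?_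
  exact (h t (Ico_subset_Icc_self ht)).derivWithin
    (uniqueDiffOn_Icc (lt_of_le_of_lt ht.1 ht.2) t (Ico_subset_Icc_self ht))

section

variable {E : Type*} [NormedAddCommGroup E] [NormedSpace ℝ E]
  {M : Type*} [TopologicalSpace M] [ChartedSpace E M]

lemma sameOrbit_of_mem_Icc {V : Set (Π m : M, TangentSpace 𝓘(ℝ, E) m)}
    {X : Π m : M, TangentSpace 𝓘(ℝ, E) m} (hX : X ∈ V) {γ : ℝ → M} {a b t : ℝ}
    (hγ : IsMIntegralCurveOn γ X (Icc a b)) (ht : t ∈ Icc a b) : SameOrbit V (γ a) (γ t) :=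
  Relation.EqvGen.rel _ _ ⟨X, hX, γ, a, t, ht.1, hγ.mono (Icc_subset_Icc_right ht.2), rfl, rfl⟩

end

variable {𝔡 : Type*} [LieRing 𝔡] [LieAlgebra ℝ 𝔡]
  {F : Type*} [NormedAddCommGroup F] [NormedSpace ℝ F] [FiniteDimensional ℝ F]
  {N : Type*} [TopologicalSpace N] [ChartedSpace F N] [IsManifold 𝓘(ℝ, F) ∞ N]
  {F₁ : Type*} [NormedAddCommGroup F₁] [NormedSpace ℝ F₁] [FiniteDimensional ℝ F₁]
  {S : Type*} [TopologicalSpace S] [ChartedSpace F₁ S] [IsManifold 𝓘(ℝ, F₁) ∞ S]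
  {F₂ : Type*} [NormedAddCommGroup F₂] [NormedSpace ℝ F₂] [FiniteDimensional ℝ F₂]
  {N' : Type*} [TopologicalSpace N'] [ChartedSpace F₂ N'] [IsManifold 𝓘(ℝ, F₂) ∞ N']

/-- A left inverse of an injective linear map. -/
noncomputable def ContinuousLinearMap.linearLeftInverse {A B : Type*} [NormedAddCommGroup A]
    [NormedSpace ℝ A] [NormedAddCommGroup B] [NormedSpace ℝ B] (T : A →L[ℝ] B) : B →ₗ[ℝ] A :=
  LinearMap.leftInverse (T : A →ₗ[ℝ] B)

lemma ContinuousLinearMap.linearLeftInverse_apply {A B : Type*} [NormedAddCommGroup A]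
    [NormedSpace ℝ A] [NormedAddCommGroup B] [NormedSpace ℝ B] {T : A →L[ℝ] B}
    (hT : Function.Injective T) {v : A} {w : B} (hv : T v = w) : T.linearLeftInverse w = v := by
  rw [← hv]
  exact LinearMap.leftInverse_apply_of_inj (f := (T : A →ₗ[ℝ] B)) (LinearMap.ker_eq_bot.2 hT) v

/-- The action on a submanifold, for the elements that act by tangent vector fields. -/
noncomputable def restrictedAction (ρ : 𝔡 →ₗ[ℝ] Π n : N, TangentSpace 𝓘(ℝ, F) n) (iN : S → N) :
    𝔡 →ₗ[ℝ] Π s : S, TangentSpace 𝓘(ℝ, F₁) s :=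
  LinearMap.pi fun s => (ContinuousLinearMap.linearLeftInverse (A := F₁) (B := F)
    (mfderiv 𝓘(ℝ, F₁) 𝓘(ℝ, F) iN s)).comp (actionAt ρ (iN s))

/-- A coisotropic subalgebra that acts on an immersed submanifold, with regular quotient by the
action of its orthogonal. -/
structure IsReducibleAction (Q : QuadraticPairing 𝔡)
    (ρ : 𝔡 →ₗ[ℝ] Π n : N, TangentSpace 𝓘(ℝ, F) n) (𝔠 : LieSubalgebra ℝ 𝔡) (iN : S → N)
    (qN : S → N') : Prop where
  action : IsLieAlgebraAction ρ
  coisotropic : Q.IsCoisotropic 𝔠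
  smooth_incl : ContMDiff 𝓘(ℝ, F₁) 𝓘(ℝ, F) ∞ iN
  immersion : ∀ s, Function.Injective (mfderiv 𝓘(ℝ, F₁) 𝓘(ℝ, F) iN s)
  invariant : ∀ ξ ∈ 𝔠, ∀ s, ∃ v, mfderiv 𝓘(ℝ, F₁) 𝓘(ℝ, F) iN s v = ρ ξ (iN s)
  quotient : IsRegularFoliationQuotient (E := F₁) (F := F₂) (perpVectorFields Q ρ 𝔠 iN) qN

variable {Q : QuadraticPairing 𝔡} {ρ : 𝔡 →ₗ[ℝ] Π n : N, TangentSpace 𝓘(ℝ, F) n}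
  {𝔥 𝔠 : LieSubalgebra ℝ 𝔡} {iN : S → N} {qN : S → N'}

lemma mfderiv_restrictedAction {s : S} (hinj : Function.Injective (mfderiv 𝓘(ℝ, F₁) 𝓘(ℝ, F) iN s))
    {ξ : 𝔡} {v : TangentSpace 𝓘(ℝ, F₁) s} (hv : mfderiv 𝓘(ℝ, F₁) 𝓘(ℝ, F) iN s v = ρ ξ (iN s)) :
    restrictedAction (F₁ := F₁) ρ iN ξ s = v :=
  ContinuousLinearMap.linearLeftInverse_apply (A := F₁) (B := F) hinj hv

namespace IsReducibleAction

variable (h : IsReducibleAction (F₁ := F₁) (F₂ := F₂) Q ρ 𝔠 iN qN)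
include h

lemma mfderiv_restricted {ξ : 𝔡} (hξ : ξ ∈ 𝔠) (s : S) :
    mfderiv 𝓘(ℝ, F₁) 𝓘(ℝ, F) iN s (restrictedAction (F₁ := F₁) ρ iN ξ s) = ρ ξ (iN s) := by
  obtain ⟨v, hv⟩ := h.invariant ξ hξ s
  rw [mfderiv_restrictedAction (h.immersion s) hv, hv]

lemma smooth_restricted {ξ : 𝔡} (hξ : ξ ∈ 𝔠) :
    IsSmoothVectorField (restrictedAction (F₁ := F₁) ρ iN ξ) := by
  intro s
  refine ContMDiffAt.of_mfderiv_immersion h.smooth_incl (f := fun s => s) contMDiffAt_id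
    (h.immersion s) ?_
  simp only [h.mfderiv_restricted hξ]
  exact (h.action.smooth ξ (iN s)).comp s (h.smooth_incl s)

lemma restricted_lie {ξ η : 𝔡} (hξ : ξ ∈ 𝔠) (hη : η ∈ 𝔠) :
    restrictedAction (F₁ := F₁) ρ iN ⁅ξ, η⁆ = VectorField.mlieBracket 𝓘(ℝ, F₁)
      (restrictedAction (F₁ := F₁) ρ iN ξ) (restrictedAction (F₁ := F₁) ρ iN η) := by
  funext s
  refine mfderiv_restrictedAction (h.immersion s) ?_
  rw [mfderiv_mlieBracket_of_related h.smooth_incl (h.smooth_restricted hξ)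
    (h.smooth_restricted hη) (h.action.smooth ξ) (h.action.smooth η) (h.mfderiv_restricted hξ)
    (h.mfderiv_restricted hη), h.action.map_lie]

lemma mfderiv_quotient_restricted {η : 𝔡} (hη : η ∈ Q.form.orthogonal 𝔠.toSubmodule) (s : S) :
    mfderiv 𝓘(ℝ, F₁) 𝓘(ℝ, F₂) qN s (restrictedAction (F₁ := F₁) ρ iN η s) = 0 :=
  (h.quotient.tangent s _).2 ⟨restrictedAction ρ iN η,
    ⟨η, hη, h.mfderiv_restricted (h.coisotropic hη)⟩, rfl⟩

/-- Invariance of the pairing moves the bracket with `ξ` onto the test element, which stays in `𝔠`.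
-/
lemma lie_mem_orthogonal {ξ η : 𝔡} (hη : η ∈ Q.form.orthogonal 𝔠.toSubmodule) (hξ : ξ ∈ 𝔠) :
    ⁅η, ξ⁆ ∈ Q.form.orthogonal 𝔠.toSubmodule := by
  rw [LinearMap.BilinForm.mem_orthogonal_iff] at hη ⊢
  intro ζ hζ
  have h1 := Q.invariant ξ ζ η
  rw [hη ⁅ξ, ζ⁆ (𝔠.lie_mem hξ hζ)] at h1
  rw [← lie_skew, map_neg, ← h1]

/-- A function `f` pulled back from `N'` is killed by the fields of `η` and of `[η, ξ]`, both from
`𝔠^⊥`; so `η (ξ f) = [η, ξ] f + ξ (η f) = 0`. The centre `y` of the chart is separate from `qN s₀`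
so that one and the same `f` serves along a whole integral curve. -/
lemma dirDeriv_quotient_action {ξ η : 𝔡} (hξ : ξ ∈ 𝔠) (hη : η ∈ Q.form.orthogonal 𝔠.toSubmodule)
    (ℓ : F₂ →L[ℝ] ℝ) {s₀ : S} {y : N'} (hy : qN s₀ = y) :
    MDifferentiableAt 𝓘(ℝ, F₁) 𝓘(ℝ, ℝ) (fun s => dirDeriv 𝓘(ℝ, F₁)
      (fun s => ℓ (extChartAt 𝓘(ℝ, F₂) y (qN s))) s (restrictedAction (F₁ := F₁) ρ iN ξ s)) s₀ ∧
    dirDeriv 𝓘(ℝ, F₁) (fun s => dirDeriv 𝓘(ℝ, F₁)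
      (fun s => ℓ (extChartAt 𝓘(ℝ, F₂) y (qN s))) s (restrictedAction (F₁ := F₁) ρ iN ξ s)) s₀
      (restrictedAction (F₁ := F₁) ρ iN η s₀) = 0 ∧
    dirDeriv 𝓘(ℝ, F₁) (fun s => ℓ (extChartAt 𝓘(ℝ, F₂) y (qN s))) s₀
      (restrictedAction (F₁ := F₁) ρ iN ξ s₀) =
      ℓ (mfderiv 𝓘(ℝ, F₁) 𝓘(ℝ, F₂) qN s₀ (restrictedAction (F₁ := F₁) ρ iN ξ s₀) : F₂) := by
  subst hy
  have h2 : (2 : WithTop ℕ∞) ≤ ∞ := WithTop.coe_le_coe.2 (le_top : (2 : ℕ∞) ≤ ⊤)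
  have : IsManifold 𝓘(ℝ, F₁) 2 S := IsManifold.of_le (n := ∞) h2
  have hq := h.quotient.smooth
  have hdir : ∀ᶠ s in 𝓝 s₀, ∀ v : TangentSpace 𝓘(ℝ, F₁) s,
      dirDeriv 𝓘(ℝ, F₁) (fun s => ℓ (extChartAt 𝓘(ℝ, F₂) (qN s₀) (qN s))) s v =
        ℓ (coordAt (E := F₂) (qN s₀) (qN s) (mfderiv 𝓘(ℝ, F₁) 𝓘(ℝ, F₂) qN s v)) := by
    filter_upwards [eventually_mem_chartAt (E := F₂) hq.continuous.continuousAt] with s hs v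
    rw [dirDeriv_comp ((contMDiffAt_dual_comp_extChartAt ℓ hs).mdifferentiableAt (by simp))
      (hq.mdifferentiable (by simp) s), dirDeriv_dual_comp_extChartAt ℓ hs]
  have hsm : ∀ ζ ∈ 𝔠, ContMDiffAt 𝓘(ℝ, F₁) 𝓘(ℝ, ℝ) ∞ (fun s => dirDeriv 𝓘(ℝ, F₁)
      (fun s => ℓ (extChartAt 𝓘(ℝ, F₂) (qN s₀) (qN s))) s (restrictedAction (F₁ := F₁) ρ iN ζ s)) s₀ := by
    intro ζ hζ
    have h1 := (contMDiffAt_tangent_iff.1 (ContMDiffAt.mfderiv_tangent hq (f := fun s => s)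
      (h.smooth_restricted hζ s₀))).2
    refine (ℓ.contDiff.contMDiff.contMDiffAt.comp s₀ h1).congr_of_eventuallyEq ?_
    filter_upwards [hdir] with s hs
    exact hs _
  have hzero : ∀ ζ ∈ Q.form.orthogonal 𝔠.toSubmodule, (fun s => dirDeriv 𝓘(ℝ, F₁)
      (fun s => ℓ (extChartAt 𝓘(ℝ, F₂) (qN s₀) (qN s))) s (restrictedAction (F₁ := F₁) ρ iN ζ s))
      =ᶠ[𝓝 s₀] fun _ => 0 := by
    intro ζ hζ
    filter_upwards [hdir] with s hs
    rw [hs, h.mfderiv_quotient_restricted hζ, map_zero, map_zero]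
  refine ⟨(hsm ξ hξ).mdifferentiableAt (by simp), ?_, ?_⟩
  · have h1 := mfderiv_mlieBracket_apply (I := 𝓘(ℝ, F₁))
      (f := fun s => ℓ (extChartAt 𝓘(ℝ, F₂) (qN s₀) (qN s)))
      (((contMDiffAt_dual_comp_extChartAt ℓ (mem_chart_source F₂ (qN s₀))).comp s₀ (hq s₀)).of_le h2)
      ((h.smooth_restricted (h.coisotropic hη) s₀).mdifferentiableAt (by simp))
      ((h.smooth_restricted hξ s₀).mdifferentiableAt (by simp))
    rw [← h.restricted_lie (h.coisotropic hη) hξ] at h1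
    have h3 := (hzero _ (h.lie_mem_orthogonal hη hξ)).self_of_nhds
    have h4 : dirDeriv 𝓘(ℝ, F₁) (fun s => dirDeriv 𝓘(ℝ, F₁)
        (fun s => ℓ (extChartAt 𝓘(ℝ, F₂) (qN s₀) (qN s))) s (restrictedAction (F₁ := F₁) ρ iN η s)) s₀
        (restrictedAction (F₁ := F₁) ρ iN ξ s₀) = 0 := by
      have h5 := Filter.EventuallyEq.mfderiv_eq (I := 𝓘(ℝ, F₁)) (I' := 𝓘(ℝ, ℝ)) (hzero η hη)
      rw [mfderiv_const] at h5
      exact congrArg (fun T : F₁ →L[ℝ] ℝ => T (restrictedAction (F₁ := F₁) ρ iN ξ s₀)) h5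
    rw [h4, sub_zero] at h1
    exact h1.symm.trans h3
  · rw [hdir.self_of_nhds]
    exact congrArg ℓ (coordAt_self _ _)

/-- Points of a fibre are joined by integral curves of `𝔠^⊥`, and along each of them the coordinates
of the pushed-forward vector have zero derivative. -/
theorem mfderiv_quotient_eq {ξ : 𝔡} (hξ : ξ ∈ 𝔠) {s s' : S} (hs : qN s = qN s') :
    (mfderiv 𝓘(ℝ, F₁) 𝓘(ℝ, F₂) qN s (restrictedAction (F₁ := F₁) ρ iN ξ s) : F₂) =
      mfderiv 𝓘(ℝ, F₁) 𝓘(ℝ, F₂) qN s' (restrictedAction (F₁ := F₁) ρ iN ξ s') := by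
  rw [h.quotient.fibres] at hs
  induction hs with
  | refl => rfl
  | symm _ _ _ ih => exact ih.symm
  | trans _ _ _ _ _ ih₁ ih₂ => exact ih₁.trans ih₂
  | rel s s' hss =>
    obtain ⟨X, hX, γ, a, b, hab, hγ, rfl, rfl⟩ := hss
    have hc : ∀ t ∈ Icc a b, qN (γ t) = qN (γ a) := fun t ht =>
      ((h.quotient.fibres _ _).2 (sameOrbit_of_mem_Icc hX hγ ht)).symm
    obtain ⟨η, hη, hXη⟩ := hX
    refine (SeparatingDual.eq_iff_forall_dual_eq (R := ℝ) (V := F₂)).2 fun ℓ => ?_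
    let k : ℝ → ℝ := fun t => dirDeriv 𝓘(ℝ, F₁)
      (fun s => ℓ (extChartAt 𝓘(ℝ, F₂) (qN (γ a)) (qN s))) (γ t)
      (restrictedAction (F₁ := F₁) ρ iN ξ (γ t))
    have key : k b = k a := by
      refine eq_of_hasDerivWithinAt_zero (fun t ht => ?_) b ⟨hab, le_rfl⟩
      obtain ⟨h1, h2, -⟩ := h.dirDeriv_quotient_action hξ hη ℓ (hc t ht)
      have h3 := h1.hasMFDerivAt.comp_hasMFDerivWithinAt t (hγ t ht)
      rw [← mfderiv_restrictedAction (h.immersion (γ t)) (hXη (γ t))] at h3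
      have h4 : HasFDerivWithinAt k (_ : ℝ →L[ℝ] ℝ) (Icc a b) t :=
        hasMFDerivWithinAt_iff_hasFDerivWithinAt.1 h3
      refine h4.hasDerivWithinAt.congr_deriv (Eq.trans ?_ h2)
      exact congrArg (fun v => dirDeriv 𝓘(ℝ, F₁) (fun s => dirDeriv 𝓘(ℝ, F₁)
        (fun s => ℓ (extChartAt 𝓘(ℝ, F₂) (qN (γ a)) (qN s))) s
          (restrictedAction (F₁ := F₁) ρ iN ξ s)) (γ t) v) (one_smul ℝ _)
    have hb := (h.dirDeriv_quotient_action hξ hη ℓ (hc b ⟨hab, le_rfl⟩)).2.2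
    have ha := (h.dirDeriv_quotient_action hξ hη ℓ (s₀ := γ a) rfl).2.2
    exact ha.symm.trans (key.symm.trans hb)

/-- The action of `𝔠` descends to an action of `𝔠 / 𝔠^⊥` on the quotient. -/
theorem exists_quotientAction :
    ∃ ρ' : Q.Reduced 𝔠 →ₗ[ℝ] Π n : N', TangentSpace 𝓘(ℝ, F₂) n,
      ∀ (ξ : 𝔠) (s : S) (v : TangentSpace 𝓘(ℝ, F₁) s),
        mfderiv 𝓘(ℝ, F₁) 𝓘(ℝ, F) iN s v = ρ (ξ : 𝔡) (iN s) →
          ρ' (Q.proj 𝔠 ξ) (qN s) = mfderiv 𝓘(ℝ, F₁) 𝓘(ℝ, F₂) qN s v := by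
  choose pick hpick using h.quotient.surjective
  let T : N' → 𝔠 →ₗ[ℝ] F₂ := fun n =>
    (show F₁ →ₗ[ℝ] F₂ from (mfderiv 𝓘(ℝ, F₁) 𝓘(ℝ, F₂) qN (pick n)).toLinearMap).comp
      ((actionAt (restrictedAction (F₁ := F₁) ρ iN) (pick n)).comp 𝔠.toSubmodule.subtype)
  have hT : ∀ n, (Q.perpIdeal 𝔠).toSubmodule ≤ LinearMap.ker (T n) := by
    intro n ξ hξ
    exact h.mfderiv_quotient_restricted
      (LinearMap.BilinForm.mem_orthogonal_iff.2 fun y hy => hξ ⟨y, hy⟩) (pick n)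
  refine ⟨LinearMap.pi fun n => (Q.perpIdeal 𝔠).toSubmodule.liftQ (T n) (hT n), fun ξ s v hv => ?_⟩
  refine Eq.trans (h.mfderiv_quotient_eq ξ.2 (hpick (qN s))) ?_
  rw [mfderiv_restrictedAction (h.immersion s) hv]

variable {ρ' : Q.Reduced 𝔠 →ₗ[ℝ] Π n : N', TangentSpace 𝓘(ℝ, F₂) n}
  (hρ' : ∀ (ξ : 𝔠) (s : S) (v : TangentSpace 𝓘(ℝ, F₁) s),
        mfderiv 𝓘(ℝ, F₁) 𝓘(ℝ, F) iN s v = ρ (ξ : 𝔡) (iN s) →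
          ρ' (Q.proj 𝔠 ξ) (qN s) = mfderiv 𝓘(ℝ, F₁) 𝓘(ℝ, F₂) qN s v)
include hρ'

/-- Near a given point the reduced field is the push-forward of the field on `S` along a smooth
local section of `qN`. -/
lemma quotientAction_smooth (ζ : Q.Reduced 𝔠) : IsSmoothVectorField (ρ' ζ) := by
  obtain ⟨ξ, rfl⟩ := Q.proj_surjective 𝔠 ζ
  intro n
  obtain ⟨s, rfl⟩ := h.quotient.surjective n
  obtain ⟨σ, hσ, hσ'⟩ := exists_local_section h.quotient.smooth s (h.quotient.submersion s)
  have key : ∀ (s : S) (y : N'), qN s = y →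
      (⟨y, ρ' (Q.proj 𝔠 ξ) y⟩ : TangentBundle 𝓘(ℝ, F₂) N') =
      ⟨qN s, mfderiv 𝓘(ℝ, F₁) 𝓘(ℝ, F₂) qN s (restrictedAction (F₁ := F₁) ρ iN ξ s)⟩ := by
    rintro s _ rfl
    rw [hρ' ξ s _ (h.mfderiv_restricted ξ.2 s)]
  have h1 := ContMDiffAt.mfderiv_tangent h.quotient.smooth
    (((h.smooth_restricted ξ.2) (σ (qN s))).comp (qN s) hσ'.self_of_nhds.1)
  refine h1.congr_of_eventuallyEq ?_
  filter_upwards [hσ'] with y hy using key (σ y) y hy.2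

theorem quotientAction_isLieAlgebraAction : IsLieAlgebraAction ρ' where
  smooth := h.quotientAction_smooth hρ'
  map_lie ζ θ := by
    funext n
    obtain ⟨s, rfl⟩ := h.quotient.surjective n
    obtain ⟨ξ, hξ⟩ := Q.proj_surjective 𝔠 ζ
    obtain ⟨η, hη⟩ := Q.proj_surjective 𝔠 θ
    have hrel : ∀ ξ : 𝔠, ∀ s, mfderiv 𝓘(ℝ, F₁) 𝓘(ℝ, F₂) qN s (restrictedAction (F₁ := F₁) ρ iN ξ s) =
        ρ' (Q.proj 𝔠 ξ) (qN s) := fun ξ s => (hρ' ξ s _ (h.mfderiv_restricted ξ.2 s)).symm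
    rw [← mfderiv_mlieBracket_of_related h.quotient.smooth (h.smooth_restricted ξ.2)
      (h.smooth_restricted η.2) (h.quotientAction_smooth hρ' ζ) (h.quotientAction_smooth hρ' θ)
      (hξ ▸ hrel ξ) (hη ▸ hrel η), ← h.restricted_lie ξ.2 η.2, ← hξ, ← hη, ← LieHom.map_lie]
    exact (hrel ⁅ξ, η⁆ s).symm

/-- Test `ρ' ζ` by a covector `ℓ`. A representative `ξ ∈ 𝔠` of its coanchor is orthogonal to the
stabilizer upstairs, hence lies in it; so its class stabilizes the point below and pairs to zero
with `ζ`. -/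
theorem quotientAction_coisotropic [FiniteDimensional ℝ 𝔡] (hst : HasCoisotropicStabilizers Q ρ) :
    HasCoisotropicStabilizers (Q.reduce 𝔠) ρ' := by
  intro n ζ hζ
  obtain ⟨s, rfl⟩ := h.quotient.surjective n
  refine (SeparatingDual.eq_iff_forall_dual_eq (R := ℝ) (V := F₂)).2 fun ℓ => ?_
  obtain ⟨ξ, ν, h1, h2, h3⟩ := Q.exists_reducible_coanchor (B := F) (B₁ := F₁) (B₂ := F₂)
    (r := actionAt ρ (iN s)) (iB := mfderiv 𝓘(ℝ, F₁) 𝓘(ℝ, F) iN s)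
    (qB := mfderiv 𝓘(ℝ, F₁) 𝓘(ℝ, F₂) qN s) (r' := actionAt ρ' (qN s)) h.coisotropic
    (h.immersion s) (fun ξ hξ => h.invariant ξ hξ s)
    (fun v => by
      constructor
      · intro hv
        obtain ⟨X, ⟨ξ, hξ, hX⟩, rfl⟩ := (h.quotient.tangent s v).1 hv
        exact ⟨ξ, hξ, hX s⟩
      · rintro ⟨ξ, hξ, hv⟩
        have h1 := h.mfderiv_quotient_restricted hξ s
        rw [mfderiv_restrictedAction (h.immersion s) hv] at h1
        exact h1)
    (fun ξ v hv => hρ' ξ s v hv) ℓ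
  have h4 : ρ (ξ : 𝔡) (iN s) = 0 := hst (iN s) ξ fun η hη => by
    rw [Q.symm, h1]
    exact (congrArg ν hη).trans (map_zero ν)
  have h5 : ρ' (Q.proj 𝔠 ξ) (qN s) = 0 :=
    (hρ' ξ s 0 ((map_zero _).trans h4.symm)).trans (map_zero _)
  have h6 := (h3 ζ).symm.trans (hζ _ h5)
  exact h6.trans (map_zero ℓ).symm

omit hρ' in
-- Duality gives `(𝔥 ∩ 𝔠)^⊥ ⊆ 𝔥 + 𝔠^⊥`. An element of `𝔠` orthogonal to `𝔥 ∩ 𝔠` thus differs by an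
-- element of `𝔠^⊥` from one of `𝔥`, which then lies in `𝔥 ∩ 𝔠`.
theorem reduceSubalgebra_isLagrangian [FiniteDimensional ℝ 𝔡] (h𝔥 : Q.IsLagrangian 𝔥) :
    (Q.reduce 𝔠).IsLagrangian (Q.reduceSubalgebra 𝔠 𝔥) := by
  have hsup : Q.form.orthogonal (𝔥.toSubmodule ⊓ 𝔠.toSubmodule) ≤
      𝔥.toSubmodule ⊔ Q.form.orthogonal 𝔠.toSubmodule := by
    rw [← Q.orthogonal_orthogonal (𝔥.toSubmodule ⊔ Q.form.orthogonal 𝔠.toSubmodule)]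
    refine LinearMap.BilinForm.orthogonal_le (le_inf ?_ ?_)
    · have := LinearMap.BilinForm.orthogonal_le (B := Q.form)
        (le_sup_left : 𝔥.toSubmodule ≤ 𝔥.toSubmodule ⊔ Q.form.orthogonal 𝔠.toSubmodule)
      rwa [h𝔥] at this
    · have := LinearMap.BilinForm.orthogonal_le (B := Q.form)
        (le_sup_right : Q.form.orthogonal 𝔠.toSubmodule ≤
          𝔥.toSubmodule ⊔ Q.form.orthogonal 𝔠.toSubmodule)
      rwa [Q.orthogonal_orthogonal] at this
  refine le_antisymm (fun x hx => ?_) fun x hx => ?_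
  · obtain ⟨x, rfl⟩ := Q.proj_surjective 𝔠 x
    rw [LinearMap.BilinForm.mem_orthogonal_iff] at hx
    have h1 : (x : 𝔡) ∈ 𝔥.toSubmodule ⊔ Q.form.orthogonal 𝔠.toSubmodule := by
      refine hsup (LinearMap.BilinForm.mem_orthogonal_iff.2 fun y hy => ?_)
      exact hx (Q.proj 𝔠 ⟨y, hy.2⟩) ⟨⟨y, hy.2⟩, hy.1, rfl⟩
    obtain ⟨y, hy, z, hz, hyz⟩ := Submodule.mem_sup.1 h1
    have h0 : Q.proj 𝔠 ⟨z, h.coisotropic hz⟩ = 0 := (Q.proj_eq_zero_iff 𝔠 _).2 hz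
    refine ⟨x - ⟨z, h.coisotropic hz⟩, ?_, ?_⟩
    · have : (x : 𝔡) - z = y := by rw [← hyz, add_sub_cancel_right]
      change (x : 𝔡) - z ∈ 𝔥
      rwa [this]
    · change Q.proj 𝔠 (x - ⟨z, h.coisotropic hz⟩) = Q.proj 𝔠 x
      rw [map_sub, h0, sub_zero]
  · obtain ⟨x, hx, rfl⟩ := hx
    rw [LinearMap.BilinForm.mem_orthogonal_iff]
    rintro _ ⟨y, hy, rfl⟩
    exact Q.form_eq_zero (W := 𝔥.toSubmodule) (x := (y : 𝔡)) (y := (x : 𝔡)) hy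
      (by rw [h𝔥]; exact hx)

end IsReducibleAction

end ReducedAction

/-! ### The induced map and the family of reduced fibres over `P`. -/

section ReducedMap

open Filter Topology Set

variable {𝔡 : Type*} [LieRing 𝔡] [LieAlgebra ℝ 𝔡] [FiniteDimensional ℝ 𝔡]
  {E : Type*} [NormedAddCommGroup E] [NormedSpace ℝ E] [FiniteDimensional ℝ E]
  {M : Type*} [TopologicalSpace M] [ChartedSpace E M] [IsManifold 𝓘(ℝ, E) ∞ M]
  {F : Type*} [NormedAddCommGroup F] [NormedSpace ℝ F] [FiniteDimensional ℝ F]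
  {N : Type*} [TopologicalSpace N] [ChartedSpace F N] [IsManifold 𝓘(ℝ, F) ∞ N]
  {E₁ : Type*} [NormedAddCommGroup E₁] [NormedSpace ℝ E₁] [FiniteDimensional ℝ E₁]
  {P : Type*} [TopologicalSpace P] [ChartedSpace E₁ P] [IsManifold 𝓘(ℝ, E₁) ∞ P]
  {F₁ : Type*} [NormedAddCommGroup F₁] [NormedSpace ℝ F₁] [FiniteDimensional ℝ F₁]
  {S : Type*} [TopologicalSpace S] [ChartedSpace F₁ S] [IsManifold 𝓘(ℝ, F₁) ∞ S]
  {E₂ : Type*} [NormedAddCommGroup E₂] [NormedSpace ℝ E₂] [FiniteDimensional ℝ E₂]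
  {M' : Type*} [TopologicalSpace M'] [ChartedSpace E₂ M'] [IsManifold 𝓘(ℝ, E₂) ∞ M']
  {F₂ : Type*} [NormedAddCommGroup F₂] [NormedSpace ℝ F₂] [FiniteDimensional ℝ F₂]
  {N' : Type*} [TopologicalSpace N'] [ChartedSpace F₂ N'] [IsManifold 𝓘(ℝ, F₂) ∞ N']
  {Q : QuadraticPairing 𝔡} {ρ : 𝔡 →ₗ[ℝ] Π n : N, TangentSpace 𝓘(ℝ, F) n}
  {𝔥 𝔠 : LieSubalgebra ℝ 𝔡} {μ : M → N} {L : Π m : M, Submodule ℝ (CourantFibre 𝔡 E m)}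
  {iN : S → N} {qN : S → N'} {iM : P → M} {j : P → S} {qM : P → M'}

namespace IsExactReduction

variable (h : IsExactReduction E F E₁ F₁ E₂ F₂ Q ρ 𝔥 μ L 𝔠 iN qN iM j qM)
include h

lemma isReducibleAction : IsReducibleAction (F₁ := F₁) (F₂ := F₂) Q ρ 𝔠 iN qN :=
  ⟨h.pair.action, h.data.coisotropic, h.data.smooth_incl, h.data.immersion, h.data.invariant,
    h.data.quotient_N⟩

/-- The restriction of `μ` maps residual orbits to orbits of `𝔠^⊥`. -/
lemma quotient_restriction_eq {p p' : P} (hp : qM p = qM p') : qN (j p) = qN (j p') := by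
  rw [h.data.quotient_M.fibres] at hp
  induction hp with
  | refl => rfl
  | symm _ _ _ ih => exact ih.symm
  | trans _ _ _ _ _ ih₁ ih₂ => exact ih₁.trans ih₂
  | rel p p' hpp =>
    obtain ⟨X, ⟨ξ, -, hξ, hX⟩, γ, a, b, hab, hγ, rfl, rfl⟩ := hpp
    -- The residual field of `ξ` on `P` and the field of `ξ` on `S` are `j`-related, so `j` maps
    -- integral curves to integral curves.
    have hj : ∀ p, mfderiv 𝓘(ℝ, E₁) 𝓘(ℝ, F₁) j p (X p) = restrictedAction (F₁ := F₁) ρ iN ξ (j p) :=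
      fun p => (mfderiv_restrictedAction (h.data.immersion (j p))
        ((h.comm p (X p)).symm.trans ((h.exact.anchor_mem _ _ (hX p)).symm.trans
          (actionAt_congr ρ (h.base_eq p) ξ).symm))).symm
    refine (h.data.quotient_N.fibres _ _).2 (Relation.EqvGen.rel _ _
      ⟨restrictedAction ρ iN ξ, ⟨ξ, hξ, h.isReducibleAction.mfderiv_restricted
        (h.data.coisotropic hξ)⟩, j ∘ γ, a, b, hab, fun t ht => ?_, rfl, rfl⟩)
    have h1 := (h.data.clean.smooth_restr.mdifferentiable (by simp) (γ t)).hasMFDerivAt.comp_hasMFDerivWithinAt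
      t (hγ t ht)
    refine h1.congr_mfderiv (ContinuousLinearMap.ext fun c : ℝ => ?_)
    exact (map_smul (mfderiv 𝓘(ℝ, E₁) 𝓘(ℝ, F₁) j (γ t)) c (X (γ t))).trans
      (congrArg (fun w : F₁ => c • w) (hj (γ t)))

/-- `μ` induces a smooth map of the quotients. -/
theorem exists_quotientMap : ∃ μ' : M' → N', ContMDiff 𝓘(ℝ, E₂) 𝓘(ℝ, F₂) ∞ μ' ∧
    ∀ p, μ' (qM p) = qN (j p) := by
  choose pick hpick using h.data.quotient_M.surjective
  have hq : ∀ p, qN (j (pick (qM p))) = qN (j p) := fun p => h.quotient_restriction_eq (hpick _)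
  refine ⟨fun m => qN (j (pick m)), fun m => ?_, hq⟩
  obtain ⟨p, rfl⟩ := h.data.quotient_M.surjective m
  obtain ⟨σ, -, hσ⟩ := exists_local_section h.data.quotient_M.smooth p (h.data.quotient_M.submersion p)
  have h1 := ((h.data.quotient_N.smooth.comp h.data.clean.smooth_restr) (σ (qM p))).comp (qM p)
    hσ.self_of_nhds.1
  refine h1.congr_of_eventuallyEq ?_
  filter_upwards [hσ] with m hm
  exact h.quotient_restriction_eq ((hpick m).trans hm.2.symm)

variable {μ' : M' → N'} (hμ' : ContMDiff 𝓘(ℝ, E₂) 𝓘(ℝ, F₂) ∞ μ') (hμq : ∀ p, μ' (qM p) = qN (j p))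
include hμ' hμq

lemma mfderiv_quotientMap (p : P) (u : E₁) :
    (mfderiv 𝓘(ℝ, E₂) 𝓘(ℝ, F₂) μ' (qM p) (mfderiv 𝓘(ℝ, E₁) 𝓘(ℝ, E₂) qM p u) : F₂) =
      mfderiv 𝓘(ℝ, F₁) 𝓘(ℝ, F₂) qN (j p) (mfderiv 𝓘(ℝ, E₁) 𝓘(ℝ, F₁) j p u) := by
  have h1 := mfderiv_comp p (hμ'.mdifferentiable (by simp) (qM p))
    (h.data.quotient_M.smooth.mdifferentiable (by simp) p)
  have h2 := mfderiv_comp p (h.data.quotient_N.smooth.mdifferentiable (by simp) (j p))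
    (h.data.clean.smooth_restr.mdifferentiable (by simp) p)
  have h4 : ∀ f g : P → N', f = g → ∀ u : E₁, (mfderiv 𝓘(ℝ, E₁) 𝓘(ℝ, F₂) f p u : F₂) =
      mfderiv 𝓘(ℝ, E₁) 𝓘(ℝ, F₂) g p u := by
    rintro f _ rfl u
    rfl
  exact (congrArg (fun T : E₁ →L[ℝ] F₂ => T u) h1).symm.trans
    ((h4 (μ' ∘ qM) (qN ∘ j) (funext hμq) u).trans (congrArg (fun T : E₁ →L[ℝ] F₂ => T u) h2))

end IsExactReduction

variable (E₁ E₂) in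
/-- The reduction of the fibre of `L` at the image of a point of the preimage. -/
noncomputable def reducedFamily (Q : QuadraticPairing 𝔡) (𝔠 : LieSubalgebra ℝ 𝔡)
    (L : Π m : M, Submodule ℝ (CourantFibre 𝔡 E m)) (iM : P → M) (qM : P → M') (p : P) :
    Submodule ℝ (Q.Reduced 𝔠 × E₂ × (E₂ →L[ℝ] ℝ)) :=
  reducedFibre (A := E) (A₁ := E₁) (A₂ := E₂) Q 𝔠 (L (iM p)) (mfderiv 𝓘(ℝ, E₁) 𝓘(ℝ, E) iM p : E₁ →L[ℝ] E)
    (mfderiv 𝓘(ℝ, E₁) 𝓘(ℝ, E₂) qM p : E₁ →L[ℝ] E₂)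

namespace IsExactReduction

variable (h : IsExactReduction E F E₁ F₁ E₂ F₂ Q ρ 𝔥 μ L 𝔠 iN qN iM j qM)
  {ρ' : Q.Reduced 𝔠 →ₗ[ℝ] Π n : N', TangentSpace 𝓘(ℝ, F₂) n}
  (hρ' : ∀ (ξ : 𝔠) (s : S) (v : TangentSpace 𝓘(ℝ, F₁) s),
        mfderiv 𝓘(ℝ, F₁) 𝓘(ℝ, F) iN s v = ρ (ξ : 𝔡) (iN s) →
          ρ' (Q.proj 𝔠 ξ) (qN s) = mfderiv 𝓘(ℝ, F₁) 𝓘(ℝ, F₂) qN s v)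
  {μ' : M' → N'} (hμ' : ContMDiff 𝓘(ℝ, E₂) 𝓘(ℝ, F₂) ∞ μ') (hμq : ∀ p, μ' (qM p) = qN (j p))
include h hρ' hμq

lemma quotientAction_eq (p : P) (ξ : 𝔠) (v : F₁)
    (hv : (mfderiv 𝓘(ℝ, F₁) 𝓘(ℝ, F) iN (j p) v : F) = actionAt ρ (μ (iM p)) ξ) :
    actionAt ρ' (μ' (qM p)) (Q.proj 𝔠 ξ) = (mfderiv 𝓘(ℝ, F₁) 𝓘(ℝ, F₂) qN (j p) v : F₂) :=
  Eq.trans (actionAt_congr ρ' (hμq p) _)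
    (hρ' ξ (j p) v (hv.trans (actionAt_congr ρ (h.base_eq p) ξ).symm))

include hμ'

/-- The point `m` is kept separate from `qM p` so that the reduced fibres at different points over
`m` can be compared with respect to the same action map and derivative. -/
theorem isExactFibre_reducedFamily {p : P} {m : M'} (hp : qM p = m) :
    IsExactFibre (A := E₂) (B := F₂) (Q.reduce 𝔠) (Q.reduceSubalgebra 𝔠 𝔥) (actionAt ρ' (μ' m))
      (mfderiv 𝓘(ℝ, E₂) 𝓘(ℝ, F₂) μ' m : E₂ →L[ℝ] F₂) (reducedFamily E₁ E₂ Q 𝔠 L iM qM p) := by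
  subst hp
  exact (h.isReductionFibre p).isExactFibre (h.quotientAction_eq hρ' hμq p)
    (h.mfderiv_quotientMap hμ' hμq p)

end IsExactReduction

end ReducedMap

/-! ### Smooth sections of `L` along parametrized maps. -/

section Lifts

open Filter Topology

namespace IsReductionFibre

variable {𝔡 : Type*} [LieRing 𝔡] [LieAlgebra ℝ 𝔡] {A B A₁ A₂ B₁ B₂ : Type*}
    [NormedAddCommGroup A] [NormedSpace ℝ A] [NormedAddCommGroup B] [NormedSpace ℝ B]
    [NormedAddCommGroup A₁] [NormedSpace ℝ A₁]
    [NormedAddCommGroup A₂] [NormedSpace ℝ A₂]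
    [NormedAddCommGroup B₁] [NormedSpace ℝ B₁] [FiniteDimensional ℝ B₁]
    [NormedAddCommGroup B₂] [NormedSpace ℝ B₂]
    {Q : QuadraticPairing 𝔡} {𝔥 𝔠 : LieSubalgebra ℝ 𝔡} {r : 𝔡 →ₗ[ℝ] B}
    {D : A →L[ℝ] B} {L : Submodule ℝ (𝔡 × A × (A →L[ℝ] ℝ))}
    {iB : B₁ →L[ℝ] B} {qB : B₁ →L[ℝ] B₂} {iA : A₁ →L[ℝ] A} {j : A₁ →L[ℝ] B₁}
    {qA : A₁ →L[ℝ] A₂}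

/-- By invariance and transitivity the image of `𝔠` is exactly the tangent space of `S`. This
supplies the constant rank needed to lift smooth families. -/
lemma finrank_map (h : IsReductionFibre Q 𝔥 𝔠 r D L iB qB iA j qA) :
    Module.finrank ℝ (𝔠.toSubmodule.map r) = Module.finrank ℝ B₁ := by
  have h1 : 𝔠.toSubmodule.map r = LinearMap.range (iB : B₁ →ₗ[ℝ] B) := by
    ext x
    constructor
    · rintro ⟨ξ, hξ, rfl⟩
      exact h.invariant ξ hξ
    · rintro ⟨v, rfl⟩
      obtain ⟨ξ, hξ, hv⟩ := h.transitive v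
      exact ⟨ξ, hξ, hv.symm⟩
  rw [h1]
  exact LinearMap.finrank_range_of_inj h.injective

/-- The image of `𝔠^⊥` is the tangent space of a leaf, that is the kernel of the submersion `qB`. -/
lemma finrank_map_orthogonal (h : IsReductionFibre Q 𝔥 𝔠 r D L iB qB iA j qA) :
    Module.finrank ℝ ((Q.form.orthogonal 𝔠.toSubmodule).map r) =
      Module.finrank ℝ B₁ - Module.finrank ℝ B₂ := by
  have h1 : (Q.form.orthogonal 𝔠.toSubmodule).map r =
      (LinearMap.ker (qB : B₁ →ₗ[ℝ] B₂)).map (iB : B₁ →ₗ[ℝ] B) := by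
    ext x
    constructor
    · rintro ⟨ξ, hξ, rfl⟩
      obtain ⟨v, hv⟩ := h.invariant ξ (h.coisotropic hξ)
      exact ⟨v, (h.ker v).2 ⟨ξ, hξ, hv⟩, hv⟩
    · rintro ⟨v, hv, rfl⟩
      obtain ⟨ξ, hξ, hv⟩ := (h.ker v).1 hv
      exact ⟨ξ, hξ, hv.symm⟩
  have h2 := (qB : B₁ →ₗ[ℝ] B₂).finrank_range_add_finrank_ker
  rw [LinearMap.range_eq_top.2 h.surjective, finrank_top] at h2
  rw [h1, ← (Submodule.equivMapOfInjective (iB : B₁ →ₗ[ℝ] B) h.injective _).finrank_eq]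
  omega

lemma exists_tangent_lift (h : IsReductionFibre Q 𝔥 𝔠 r D L iB qB iA j qA) (u : A₁) :
    ∃ ξ ∈ 𝔠, r ξ = D (iA u) := by
  obtain ⟨ξ, hξ, hu⟩ := h.transitive (j u)
  exact ⟨ξ, hξ, by rw [h.comm, hu]⟩

lemma exists_orthogonal_lift (h : IsReductionFibre Q 𝔥 𝔠 r D L iB qB iA j qA) {u : A₁}
    (hu : qB (j u) = 0) : ∃ ξ ∈ Q.form.orthogonal 𝔠.toSubmodule, r ξ = D (iA u) := by
  obtain ⟨ξ, hξ, hu⟩ := (h.ker (j u)).1 hu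
  exact ⟨ξ, hξ, by rw [h.comm, hu]⟩

end IsReductionFibre

section

variable {E : Type*} [NormedAddCommGroup E] [NormedSpace ℝ E]
  {M : Type*} [TopologicalSpace M] [ChartedSpace E M] [IsManifold 𝓘(ℝ, E) ∞ M]
  {G H : Type*} [NormedAddCommGroup G] [NormedSpace ℝ G] [TopologicalSpace H]
  {I : ModelWithCorners ℝ G H} {Z : Type*} [TopologicalSpace Z] [ChartedSpace H Z]

/-- Here the chart is centred at a fixed `m₀` and not at `f z₀`, as is needed for smoothness at all
points of a neighbourhood in one chart. -/
lemma contMDiffAt_coordAt {f : Z → M} {X : Π z, TangentSpace 𝓘(ℝ, E) (f z)} {z₀ : Z} {m₀ : M}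
    (hX : ContMDiffAt I 𝓘(ℝ, E).tangent ∞ (fun z => (⟨f z, X z⟩ : TangentBundle 𝓘(ℝ, E) M)) z₀)
    (hm : f z₀ ∈ (chartAt E m₀).source) :
    ContMDiffAt I 𝓘(ℝ, E) ∞ (fun z => coordAt (E := E) m₀ (f z) (X z)) z₀ := by
  have : IsManifold 𝓘(ℝ, E) 1 M := isManifold_one_of_infty E M
  have h1 := ((Bundle.Trivialization.contMDiffAt_iff (IM := I) (IB := 𝓘(ℝ, E)) (n := ∞)
    (e := trivializationAt E (TangentSpace 𝓘(ℝ, E)) m₀)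
    (f := fun z => (⟨f z, X z⟩ : TangentBundle 𝓘(ℝ, E) M)) (x₀ := z₀) (by simpa using hm)).1 hX)
  refine h1.2.congr_of_eventuallyEq ?_
  filter_upwards [h1.1.continuousAt ((chartAt E m₀).open_source.mem_nhds hm)] with z hz
  have h2 := TangentBundle.continuousLinearMapAt_trivializationAt (I := 𝓘(ℝ, E)) (x₀ := m₀) hz
  refine (congrArg (fun T : TangentSpace 𝓘(ℝ, E) (f z) →L[ℝ] E => T (X z)) h2).symm.trans ?_
  rw [Bundle.Trivialization.continuousLinearMapAt_apply,
    Bundle.Trivialization.linearMapAt_apply, if_pos (by simpa using hz)]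

end

variable {𝔡 : Type*} [LieRing 𝔡] [LieAlgebra ℝ 𝔡] [FiniteDimensional ℝ 𝔡]
  {V : Type*} [NormedAddCommGroup V] [NormedSpace ℝ V]
  {E : Type*} [NormedAddCommGroup E] [NormedSpace ℝ E] [FiniteDimensional ℝ E]
  {M : Type*} [TopologicalSpace M] [ChartedSpace E M] [IsManifold 𝓘(ℝ, E) ∞ M]
  {F : Type*} [NormedAddCommGroup F] [NormedSpace ℝ F] [FiniteDimensional ℝ F]
  {N : Type*} [TopologicalSpace N] [ChartedSpace F N] [IsManifold 𝓘(ℝ, F) ∞ N]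
  {ρ : 𝔡 →ₗ[ℝ] Π n : N, TangentSpace 𝓘(ℝ, F) n}

/-- If a space of vector fields of constant rank is tangent to a curve of a parametrized map, then
the tangent vectors are the values of a smooth family of elements. -/
theorem exists_smooth_action_lift (hρ : ∀ ξ, IsSmoothVectorField (ρ ξ)) (W : Submodule ℝ 𝔡) (k : ℕ)
    {ψ : V → N} {t v : V} (hψ : ∀ᶠ s in 𝓝 t, ContMDiffAt 𝓘(ℝ, V) 𝓘(ℝ, F) ∞ ψ s)
    (hk : ∀ᶠ s in 𝓝 t, Module.finrank ℝ (W.map (actionAt ρ (ψ s))) = k)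
    (hv : ∀ᶠ s in 𝓝 t, ∃ a ∈ W, ρ a (ψ s) = mfderiv 𝓘(ℝ, V) 𝓘(ℝ, F) ψ s v)
    {ξ₀ : 𝔡} (hξ₀ : ξ₀ ∈ W) (h₀ : ρ ξ₀ (ψ t) = mfderiv 𝓘(ℝ, V) 𝓘(ℝ, F) ψ t v) :
    ∃ ξ : V → 𝔡, ξ t = ξ₀ ∧ (∀ s, ξ s ∈ W) ∧
      (∀ᶠ s in 𝓝 t, ∀ ℓ : Module.Dual ℝ 𝔡, ContDiffAt ℝ ∞ (fun s => ℓ (ξ s)) s) ∧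
      ∀ᶠ s in 𝓝 t, ρ (ξ s) (ψ s) = mfderiv 𝓘(ℝ, V) 𝓘(ℝ, F) ψ s v := by
  let c : V → F →ₗ[ℝ] F := fun s => (coordAt (E := F) (ψ t) (ψ s)).toLinearMap
  let J : V → W →ₗ[ℝ] F := fun s => (c s).comp ((actionAt ρ (ψ s)).comp W.subtype)
  have hch : ∀ᶠ s in 𝓝 t, ψ s ∈ (chartAt F (ψ t)).source :=
    eventually_mem_chartAt (E := F) hψ.self_of_nhds.continuousAt
  have hinj : ∀ᶠ s in 𝓝 t, Function.Injective (c s) := by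
    filter_upwards [hch] with s hs using coordAt_injective (E := F) hs
  have hrank : ∀ᶠ s in 𝓝 t, Module.finrank ℝ (LinearMap.range (J s)) = k := by
    filter_upwards [hinj, hk] with s hs hs'
    have h1 : LinearMap.range (J s) = (W.map (actionAt ρ (ψ s))).map (c s) := by
      rw [LinearMap.range_comp, LinearMap.range_comp, Submodule.range_subtype]
    rw [h1, ← (Submodule.equivMapOfInjective (c s) hs _).finrank_eq, hs']
  obtain ⟨a, ha, hat, haJ⟩ := exists_smooth_solution J
    (fun s => (coordAt (E := F) (ψ t) (ψ s) (mfderiv 𝓘(ℝ, V) 𝓘(ℝ, F) ψ s v) : F)) t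
    (by
      filter_upwards [hch, hψ] with s hs hs' a
      exact contMDiffAt_iff_contDiffAt.1 (contMDiffAt_coordAt (E := F)
        (((hρ a) (ψ s)).comp s hs') hs))
    (by
      filter_upwards [hch, hψ] with s hs hs'
      exact contMDiffAt_iff_contDiffAt.1 (contMDiffAt_coordAt (E := F)
        (contMDiffAt_mfderiv_apply hs' v) hs))
    (by
      filter_upwards [hv] with s ⟨a, haW, ha⟩
      exact ⟨⟨a, haW⟩, congrArg (c s) ha⟩)
    (by
      filter_upwards [hrank] with s hs
      rw [hs, hrank.self_of_nhds]) ⟨ξ₀, hξ₀⟩ (congrArg (c t) h₀)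
  refine ⟨fun s => a s, congrArg Subtype.val hat, fun s => (a s).2, ?_, ?_⟩
  · filter_upwards [ha] with s hs ℓ
    exact hs (ℓ.comp W.subtype)
  · filter_upwards [haJ, hinj] with s hs hs'
    exact hs' hs

variable {Q : QuadraticPairing 𝔡} {𝔥 : LieSubalgebra ℝ 𝔡} {μ : M → N}
  {L : Π m : M, Submodule ℝ (CourantFibre 𝔡 E m)}

/-- Under a constant rank condition, a section of `L` along a parametrized map can be found over a
given coordinate vector field, with values over a given space of elements. -/
theorem IsManinPairMorphism.exists_isSectionAlong (hρ : ∀ ξ, IsSmoothVectorField (ρ ξ))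
    (hL : IsManinPairMorphism Q ρ 𝔥 μ L) (hex : IsExactOnGraph Q ρ μ L) (W : Submodule ℝ 𝔡) (k : ℕ)
    {φ : V → M} {t v : V} (hφ : ∀ᶠ s in 𝓝 t, ContMDiffAt 𝓘(ℝ, V) 𝓘(ℝ, E) ∞ φ s)
    (hk : ∀ᶠ s in 𝓝 t, Module.finrank ℝ (W.map (actionAt ρ (μ (φ s)))) = k)
    (hv : ∀ᶠ s in 𝓝 t, ∃ a ∈ W, ρ a (μ (φ s)) = mfderiv 𝓘(ℝ, E) 𝓘(ℝ, F) μ (φ s)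
      (mfderiv 𝓘(ℝ, V) 𝓘(ℝ, E) φ s v))
    {ξ₀ : 𝔡} (hξ₀ : ξ₀ ∈ W) (h₀ : ρ ξ₀ (μ (φ t)) = mfderiv 𝓘(ℝ, E) 𝓘(ℝ, F) μ (φ t)
      (mfderiv 𝓘(ℝ, V) 𝓘(ℝ, E) φ t v)) :
    ∃ (ξ : V → 𝔡) (α : Π s, TangentSpace 𝓘(ℝ, E) (φ s) →L[ℝ] ℝ), ξ t = ξ₀ ∧ (∀ s, ξ s ∈ W) ∧
      ∀ᶠ s in 𝓝 t, IsSectionAlong L φ s v ξ α := by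
  have hcomp : ∀ᶠ s in 𝓝 t, mfderiv 𝓘(ℝ, V) 𝓘(ℝ, F) (fun s => μ (φ s)) s v =
      mfderiv 𝓘(ℝ, E) 𝓘(ℝ, F) μ (φ s) (mfderiv 𝓘(ℝ, V) 𝓘(ℝ, E) φ s v) := by
    filter_upwards [hφ] with s hs
    have h1 := mfderiv_comp s (hL.smooth_map.mdifferentiable (by simp) (φ s))
      (hs.mdifferentiableAt (by simp))
    exact congrArg (fun T : V →L[ℝ] F => T v) h1
  obtain ⟨ξ, hξt, hξW, hξs, hξ⟩ := exists_smooth_action_lift hρ W k (ψ := fun s => μ (φ s)) (t := t)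
    (v := v) (by filter_upwards [hφ] with s hs using (hL.smooth_map (φ s)).comp s hs) hk
    (by
      filter_upwards [hv, hcomp] with s ⟨a, ha, ha'⟩ hs
      exact ⟨a, ha, ha'.trans hs.symm⟩) hξ₀ (h₀.trans hcomp.self_of_nhds.symm)
  -- Covectors are chosen pointwise, with the junk value `0` where the lifting equation fails. No
  -- smoothness is needed here: it follows from the Lagrangian condition.
  have hα : ∀ s, ∃ α : TangentSpace 𝓘(ℝ, E) (φ s) →L[ℝ] ℝ,
      ρ (ξ s) (μ (φ s)) = mfderiv 𝓘(ℝ, E) 𝓘(ℝ, F) μ (φ s) (mfderiv 𝓘(ℝ, V) 𝓘(ℝ, E) φ s v) →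
      ((ξ s, mfderiv 𝓘(ℝ, V) 𝓘(ℝ, E) φ s v, α) : CourantFibre 𝔡 E (φ s)) ∈ L (φ s) := by
    intro s
    by_cases hs : ρ (ξ s) (μ (φ s)) =
        mfderiv 𝓘(ℝ, E) 𝓘(ℝ, F) μ (φ s) (mfderiv 𝓘(ℝ, V) 𝓘(ℝ, E) φ s v)
    · obtain ⟨α, hα⟩ := (hL.isExactFibre hex (φ s)).exists_covector hs
      exact ⟨α, fun _ => hα⟩
    · exact ⟨0, fun h => absurd h hs⟩
  choose α hα using hα
  refine ⟨ξ, α, hξt, hξW, ?_⟩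
  filter_upwards [hξs, (hξ.and hcomp).eventually_nhds] with s hs hs'
  refine ⟨hs, ?_⟩
  filter_upwards [hs'] with s' hs''
  exact hα s' (hs''.1.trans hs''.2)

end Lifts

/-! ### Invariance of the reduced fibres along the fibres of `qM`. -/

section Invariance

open Filter Topology Set

section

variable {V : Type*} [NormedAddCommGroup V] [NormedSpace ℝ V]
  {E₁ : Type*} [NormedAddCommGroup E₁] [NormedSpace ℝ E₁]
  {P : Type*} [TopologicalSpace P] [ChartedSpace E₁ P]
  {E₂ : Type*} [NormedAddCommGroup E₂] [NormedSpace ℝ E₂]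
  {Y : Type*} [TopologicalSpace Y] [ChartedSpace E₂ Y] [IsManifold 𝓘(ℝ, E₂) ∞ Y]

lemma mfderiv_extChartAt_symm_self (y : Y) (v : E₂) :
    (mfderiv 𝓘(ℝ, E₂) 𝓘(ℝ, E₂) (extChartAt 𝓘(ℝ, E₂) y).symm (extChartAt 𝓘(ℝ, E₂) y y) v : E₂) = v := by
  have : IsManifold 𝓘(ℝ, E₂) 1 Y := isManifold_one_of_infty E₂ Y
  have h1 := mfderivWithin_range_extChartAt_symm (I := 𝓘(ℝ, E₂)) (x := y)
  rw [ModelWithCorners.range_eq_univ, mfderivWithin_univ] at h1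
  exact congrArg (fun T : E₂ →L[ℝ] E₂ => T v) h1

/-- The derivative of a submersion in adapted coordinates. -/
lemma mfderiv_of_comp_eq_extChartAt_symm {q : P → Y} (hq : ContMDiff 𝓘(ℝ, E₁) 𝓘(ℝ, E₂) ∞ q)
    {Ψ : V → P} {z : V} {y : Y} (pr : V →L[ℝ] E₂) (hΨ : ContMDiffAt 𝓘(ℝ, V) 𝓘(ℝ, E₁) ∞ Ψ z)
    (hz : pr z ∈ (extChartAt 𝓘(ℝ, E₂) y).target)
    (he : ∀ᶠ z' in 𝓝 z, q (Ψ z') = (extChartAt 𝓘(ℝ, E₂) y).symm (pr z')) (w : V) :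
    (mfderiv 𝓘(ℝ, E₁) 𝓘(ℝ, E₂) q (Ψ z) (mfderiv 𝓘(ℝ, V) 𝓘(ℝ, E₁) Ψ z w) : E₂) =
      mfderiv 𝓘(ℝ, E₂) 𝓘(ℝ, E₂) (extChartAt 𝓘(ℝ, E₂) y).symm (pr z) (pr w) := by
  have hs : ContMDiffAt 𝓘(ℝ, E₂) 𝓘(ℝ, E₂) ∞ (extChartAt 𝓘(ℝ, E₂) y).symm (pr z) :=
    (contMDiffOn_extChartAt_symm y).contMDiffAt ((isOpen_extChartAt_target y).mem_nhds hz)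
  have h1 := mfderiv_comp z (hq.mdifferentiable (by simp) (Ψ z)) (hΨ.mdifferentiableAt (by simp))
  have h2 := mfderiv_comp z (hs.mdifferentiableAt (by simp)) pr.differentiableAt.mdifferentiableAt
  rw [mfderiv_eq_fderiv, pr.fderiv] at h2
  have h3 : ∀ f g : V → Y, f =ᶠ[𝓝 z] g → (mfderiv 𝓘(ℝ, V) 𝓘(ℝ, E₂) f z w : E₂) =
      mfderiv 𝓘(ℝ, V) 𝓘(ℝ, E₂) g z w := by
    intro f g hfg
    rw [hfg.mfderiv_eq]
    rfl
  exact (congrArg (fun T : V →L[ℝ] E₂ => T w) h1).symm.trans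
    ((h3 _ _ he).trans (congrArg (fun T : V →L[ℝ] E₂ => T w) h2))

end

variable {𝔡 : Type*} [LieRing 𝔡] [LieAlgebra ℝ 𝔡] [FiniteDimensional ℝ 𝔡]
  {V : Type*} [NormedAddCommGroup V] [NormedSpace ℝ V]
  {E : Type*} [NormedAddCommGroup E] [NormedSpace ℝ E] [FiniteDimensional ℝ E]
  {M : Type*} [TopologicalSpace M] [ChartedSpace E M] [IsManifold 𝓘(ℝ, E) ∞ M]
  {F : Type*} [NormedAddCommGroup F] [NormedSpace ℝ F] [FiniteDimensional ℝ F]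
  {N : Type*} [TopologicalSpace N] [ChartedSpace F N] [IsManifold 𝓘(ℝ, F) ∞ N]
  {E₁ : Type*} [NormedAddCommGroup E₁] [NormedSpace ℝ E₁] [FiniteDimensional ℝ E₁]
  {P : Type*} [TopologicalSpace P] [ChartedSpace E₁ P] [IsManifold 𝓘(ℝ, E₁) ∞ P]
  {F₁ : Type*} [NormedAddCommGroup F₁] [NormedSpace ℝ F₁] [FiniteDimensional ℝ F₁]
  {S : Type*} [TopologicalSpace S] [ChartedSpace F₁ S] [IsManifold 𝓘(ℝ, F₁) ∞ S]
  {E₂ : Type*} [NormedAddCommGroup E₂] [NormedSpace ℝ E₂] [FiniteDimensional ℝ E₂]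
  {M' : Type*} [TopologicalSpace M'] [ChartedSpace E₂ M'] [IsManifold 𝓘(ℝ, E₂) ∞ M']
  {F₂ : Type*} [NormedAddCommGroup F₂] [NormedSpace ℝ F₂] [FiniteDimensional ℝ F₂]
  {N' : Type*} [TopologicalSpace N'] [ChartedSpace F₂ N'] [IsManifold 𝓘(ℝ, F₂) ∞ N']
  {Q : QuadraticPairing 𝔡} {ρ : 𝔡 →ₗ[ℝ] Π n : N, TangentSpace 𝓘(ℝ, F) n}
  {𝔥 𝔠 : LieSubalgebra ℝ 𝔡} {μ : M → N} {L : Π m : M, Submodule ℝ (CourantFibre 𝔡 E m)}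
  {iN : S → N} {qN : S → N'} {iM : P → M} {j : P → S} {qM : P → M'}

namespace IsExactReduction

variable (h : IsExactReduction E F E₁ F₁ E₂ F₂ Q ρ 𝔥 μ L 𝔠 iN qN iM j qM)
include h

lemma mfderiv_source_comp {φ : V → P} {s : V} (hφ : ContMDiffAt 𝓘(ℝ, V) 𝓘(ℝ, E₁) ∞ φ s) (v : V) :
    mfderiv 𝓘(ℝ, V) 𝓘(ℝ, E) (fun s => iM (φ s)) s v =
      mfderiv 𝓘(ℝ, E₁) 𝓘(ℝ, E) iM (φ s) (mfderiv 𝓘(ℝ, V) 𝓘(ℝ, E₁) φ s v) :=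
  congrArg (fun T : V →L[ℝ] E => T v) (mfderiv_comp s
    (h.data.clean.smooth_incl.mdifferentiable (by simp) (φ s)) (hφ.mdifferentiableAt (by simp)))

theorem exists_isSectionAlong {φ : V → P} {t v : V}
    (hφ : ∀ᶠ s in 𝓝 t, ContMDiffAt 𝓘(ℝ, V) 𝓘(ℝ, E₁) ∞ φ s) {ξ₀ : 𝔡} (hξ₀ : ξ₀ ∈ 𝔠)
    (h₀ : ρ ξ₀ (μ (iM (φ t))) = mfderiv 𝓘(ℝ, E) 𝓘(ℝ, F) μ (iM (φ t))
      (mfderiv 𝓘(ℝ, E₁) 𝓘(ℝ, E) iM (φ t) (mfderiv 𝓘(ℝ, V) 𝓘(ℝ, E₁) φ t v))) :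
    ∃ (ξ : V → 𝔡) (α : Π s, TangentSpace 𝓘(ℝ, E) (iM (φ s)) →L[ℝ] ℝ), ξ t = ξ₀ ∧
      (∀ s, ξ s ∈ 𝔠) ∧ ∀ᶠ s in 𝓝 t, IsSectionAlong L (fun s => iM (φ s)) s v ξ α := by
  refine h.morphism.exists_isSectionAlong h.pair.action.smooth h.exact 𝔠.toSubmodule
    (Module.finrank ℝ F₁) (φ := fun s => iM (φ s)) ?_ ?_ ?_ hξ₀ ?_
  · filter_upwards [hφ] with s hs using (h.data.clean.smooth_incl (φ s)).comp s hs
  · exact Eventually.of_forall fun s => (h.isReductionFibre (φ s)).finrank_map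
  · filter_upwards [hφ] with s hs
    rw [h.mfderiv_source_comp hs]
    exact (h.isReductionFibre (φ s)).exists_tangent_lift _
  · rw [h.mfderiv_source_comp hφ.self_of_nhds]
    exact h₀

/-- Directions that die in `N'` are tangent to the `𝔠^⊥`-leaves, so they lift to sections over `𝔠^⊥`
and not merely over `𝔠`. -/
theorem exists_isSectionAlong_orthogonal {φ : V → P} {t v : V}
    (hφ : ∀ᶠ s in 𝓝 t, ContMDiffAt 𝓘(ℝ, V) 𝓘(ℝ, E₁) ∞ φ s)
    (hv : ∀ᶠ s in 𝓝 t, (mfderiv 𝓘(ℝ, F₁) 𝓘(ℝ, F₂) qN (j (φ s))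
      (mfderiv 𝓘(ℝ, E₁) 𝓘(ℝ, F₁) j (φ s) (mfderiv 𝓘(ℝ, V) 𝓘(ℝ, E₁) φ s v)) : F₂) = 0) :
    ∃ (ξ : V → 𝔡) (α : Π s, TangentSpace 𝓘(ℝ, E) (iM (φ s)) →L[ℝ] ℝ),
      (∀ s, ξ s ∈ Q.form.orthogonal 𝔠.toSubmodule) ∧
      ∀ᶠ s in 𝓝 t, IsSectionAlong L (fun s => iM (φ s)) s v ξ α := by
  obtain ⟨ξ₀, hξ₀, h₀⟩ := (h.isReductionFibre (φ t)).exists_orthogonal_lift hv.self_of_nhds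
  obtain ⟨ξ, α, -, hξ, hα⟩ := h.morphism.exists_isSectionAlong (v := v) (t := t)
    h.pair.action.smooth h.exact
    (Q.form.orthogonal 𝔠.toSubmodule) (Module.finrank ℝ F₁ - Module.finrank ℝ F₂)
    (φ := fun s => iM (φ s))
    (by filter_upwards [hφ] with s hs using (h.data.clean.smooth_incl (φ s)).comp s hs)
    (Eventually.of_forall fun s => (h.isReductionFibre (φ s)).finrank_map_orthogonal)
    (by
      filter_upwards [hφ, hv] with s hs hs'
      rw [h.mfderiv_source_comp hs]
      exact (h.isReductionFibre (φ s)).exists_orthogonal_lift hs') hξ₀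
    (by
      rw [h.mfderiv_source_comp hφ.self_of_nhds]
      exact h₀)
  exact ⟨ξ, α, hξ, hα⟩

/-- An element of `L` over `𝔠` at a point of the preimage descends. -/
lemma exists_mem_reducedFamily {p : P} {ξ : 𝔠} {u : E₁} {α : E →L[ℝ] ℝ}
    (hα : (((ξ : 𝔡), (mfderiv 𝓘(ℝ, E₁) 𝓘(ℝ, E) iM p u : E), α) : 𝔡 × E × (E →L[ℝ] ℝ)) ∈
      (L (iM p) : Submodule ℝ (𝔡 × E × (E →L[ℝ] ℝ)))) :
    ∃ α' : E₂ →L[ℝ] ℝ, (Q.proj 𝔠 ξ, (mfderiv 𝓘(ℝ, E₁) 𝓘(ℝ, E₂) qM p u : E₂), α') ∈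
      reducedFamily E₁ E₂ Q 𝔠 L iM qM p ∧ ∀ w : E₁,
        α' (mfderiv 𝓘(ℝ, E₁) 𝓘(ℝ, E₂) qM p w : E₂) = α (mfderiv 𝓘(ℝ, E₁) 𝓘(ℝ, E) iM p w : E) := by
  obtain ⟨α', hα'⟩ := (h.isReductionFibre p).exists_descend ξ.2 hα
  exact ⟨α', ⟨ξ, u, α, hα, rfl, rfl, fun v => (hα' v).symm⟩, hα'⟩

lemma exists_mem_of_isSectionAlong {φ : V → P} {s v : V} {ξ : V → 𝔡}
    {α : Π s, TangentSpace 𝓘(ℝ, E) (iM (φ s)) →L[ℝ] ℝ}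
    (hα : IsSectionAlong L (fun s => iM (φ s)) s v ξ α)
    (hφ : ContMDiffAt 𝓘(ℝ, V) 𝓘(ℝ, E₁) ∞ φ s) (hξ : ξ s ∈ 𝔠) :
    ∃ α' : E₂ →L[ℝ] ℝ, (Q.proj 𝔠 ⟨ξ s, hξ⟩,
      (mfderiv 𝓘(ℝ, E₁) 𝓘(ℝ, E₂) qM (φ s) (mfderiv 𝓘(ℝ, V) 𝓘(ℝ, E₁) φ s v) : E₂), α') ∈
      reducedFamily E₁ E₂ Q 𝔠 L iM qM (φ s) ∧ ∀ w : V,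
        α' (mfderiv 𝓘(ℝ, E₁) 𝓘(ℝ, E₂) qM (φ s) (mfderiv 𝓘(ℝ, V) 𝓘(ℝ, E₁) φ s w) : E₂) =
          α s (mfderiv 𝓘(ℝ, V) 𝓘(ℝ, E) (fun s => iM (φ s)) s w) := by
  have h1 := hα.mem.self_of_nhds
  rw [h.mfderiv_source_comp hφ] at h1
  obtain ⟨α', h2, h3⟩ := h.exists_mem_reducedFamily (ξ := ⟨ξ s, hξ⟩) h1
  refine ⟨α', h2, fun w => ?_⟩
  rw [h.mfderiv_source_comp hφ]
  exact h3 _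

variable {ρ' : Q.Reduced 𝔠 →ₗ[ℝ] Π n : N', TangentSpace 𝓘(ℝ, F₂) n}
  (hρ' : ∀ (ξ : 𝔠) (s : S) (v : TangentSpace 𝓘(ℝ, F₁) s),
        mfderiv 𝓘(ℝ, F₁) 𝓘(ℝ, F) iN s v = ρ (ξ : 𝔡) (iN s) →
          ρ' (Q.proj 𝔠 ξ) (qN s) = mfderiv 𝓘(ℝ, F₁) 𝓘(ℝ, F₂) qN s v)
  {μ' : M' → N'} (hμ' : ContMDiff 𝓘(ℝ, E₂) 𝓘(ℝ, F₂) ∞ μ') (hμq : ∀ p, μ' (qM p) = qN (j p))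
include hρ' hμ' hμq

lemma exists_lift {p : P} {m : M'} (hp : qM p = m) {ζ : Q.Reduced 𝔠} {u : E₁}
    (hζ : actionAt ρ' (μ' m) ζ = (mfderiv 𝓘(ℝ, E₂) 𝓘(ℝ, F₂) μ' m : E₂ →L[ℝ] F₂)
      (mfderiv 𝓘(ℝ, E₁) 𝓘(ℝ, E₂) qM p u : E₂)) :
    ∃ ξ : 𝔠, Q.proj 𝔠 ξ = ζ ∧ ρ (ξ : 𝔡) (μ (iM p)) = mfderiv 𝓘(ℝ, E) 𝓘(ℝ, F) μ (iM p)
      (mfderiv 𝓘(ℝ, E₁) 𝓘(ℝ, E) iM p u) := by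
  subst hp
  exact (h.isReductionFibre p).exists_lift (h.quotientAction_eq hρ' hμq p)
    (h.mfderiv_quotientMap hμ' hμq p) hζ

/-- Along the fibres of the quotient map, the covectors of the reduced fibres are constant. -/
theorem hasFDerivAt_covector_zero {G : Type*} [NormedAddCommGroup G] [NormedSpace ℝ G]
    {Ψ : E₂ × G → P} {m : M'} {g₀ : G}
    (hΨ : ∀ᶠ z in 𝓝 (extChartAt 𝓘(ℝ, E₂) m m, g₀), ContMDiffAt 𝓘(ℝ, E₂ × G) 𝓘(ℝ, E₁) ∞ Ψ z ∧
      z.1 ∈ (extChartAt 𝓘(ℝ, E₂) m).target ∧ qM (Ψ z) = (extChartAt 𝓘(ℝ, E₂) m).symm z.1)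
    {ζ η : Q.Reduced 𝔠} {X Y : E₂}
    (hζ : actionAt ρ' (μ' m) ζ = (mfderiv 𝓘(ℝ, E₂) 𝓘(ℝ, F₂) μ' m : E₂ →L[ℝ] F₂) X)
    (hη : actionAt ρ' (μ' m) η = (mfderiv 𝓘(ℝ, E₂) 𝓘(ℝ, F₂) μ' m : E₂ →L[ℝ] F₂) Y) {b : G → ℝ}
    (hb : ∀ᶠ g in 𝓝 g₀, ∃ β : E₂ →L[ℝ] ℝ,
      (ζ, X, β) ∈ reducedFamily E₁ E₂ Q 𝔠 L iM qM (Ψ (extChartAt 𝓘(ℝ, E₂) m m, g)) ∧ b g = β Y) :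
    HasFDerivAt b (0 : G →L[ℝ] ℝ) g₀ := by
  set y₀ := extChartAt 𝓘(ℝ, E₂) m m with hy₀
  have hs : ∀ᶠ z in 𝓝 (y₀, g₀), ContMDiffAt 𝓘(ℝ, E₂ × G) 𝓘(ℝ, E₁) ∞ Ψ z := hΨ.mono fun z hz => hz.1
  have hd : ∀ᶠ z in 𝓝 (y₀, g₀), ∀ w : E₂ × G,
      (mfderiv 𝓘(ℝ, E₁) 𝓘(ℝ, E₂) qM (Ψ z) (mfderiv 𝓘(ℝ, E₂ × G) 𝓘(ℝ, E₁) Ψ z w) : E₂) =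
      mfderiv 𝓘(ℝ, E₂) 𝓘(ℝ, E₂) (extChartAt 𝓘(ℝ, E₂) m).symm z.1 w.1 := by
    filter_upwards [hΨ, hΨ.eventually_nhds] with z hz hz' w
    exact mfderiv_of_comp_eq_extChartAt_symm h.data.quotient_M.smooth
      (ContinuousLinearMap.fst ℝ E₂ G) hz.1 hz.2.1 (hz'.mono fun z hz => hz.2.2) w
  have hfib : ∀ g, (∀ w : E₂ × G,
      (mfderiv 𝓘(ℝ, E₁) 𝓘(ℝ, E₂) qM (Ψ (y₀, g)) (mfderiv 𝓘(ℝ, E₂ × G) 𝓘(ℝ, E₁) Ψ (y₀, g) w) : E₂) =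
      mfderiv 𝓘(ℝ, E₂) 𝓘(ℝ, E₂) (extChartAt 𝓘(ℝ, E₂) m).symm y₀ w.1) → ∀ X : E₂,
      (mfderiv 𝓘(ℝ, E₁) 𝓘(ℝ, E₂) qM (Ψ (y₀, g))
        (mfderiv 𝓘(ℝ, E₂ × G) 𝓘(ℝ, E₁) Ψ (y₀, g) ((X, 0) : E₂ × G)) : E₂) = X := fun g hg X =>
    (hg (X, 0)).trans (mfderiv_extChartAt_symm_self m X)
  have hbase : ∀ g, qM (Ψ (y₀, g)) = (extChartAt 𝓘(ℝ, E₂) m).symm y₀ → qM (Ψ (y₀, g)) = m :=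
    fun g hg => hg.trans (extChartAt_to_inv m)
  have hp₀ : qM (Ψ (y₀, g₀)) = m := hbase g₀ hΨ.self_of_nhds.2.2
  have hd₀ := hfib g₀ hd.self_of_nhds
  obtain ⟨ξ, hξζ, hξ⟩ := h.exists_lift hρ' hμ' hμq hp₀
    (u := mfderiv 𝓘(ℝ, E₂ × G) 𝓘(ℝ, E₁) Ψ (y₀, g₀) ((X, 0) : E₂ × G)) (by rw [hd₀]; exact hζ)
  obtain ⟨θ, hθη, hθ⟩ := h.exists_lift hρ' hμ' hμq hp₀
    (u := mfderiv 𝓘(ℝ, E₂ × G) 𝓘(ℝ, E₁) Ψ (y₀, g₀) ((Y, 0) : E₂ × G)) (by rw [hd₀]; exact hη)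
  obtain ⟨ξ₂, α₂, hξ₂0, hξ₂, hα₂⟩ := h.exists_isSectionAlong hs ξ.2 hξ
  obtain ⟨ξ₃, α₃, hξ₃0, hξ₃, hα₃⟩ := h.exists_isSectionAlong hs θ.2 hθ
  let a : E₂ × G → ℝ := fun z =>
    α₂ z (mfderiv 𝓘(ℝ, E₂ × G) 𝓘(ℝ, E) (fun z => iM (Ψ z)) z ((Y, 0) : E₂ × G))
  -- The class of `ξ₂` need not stay equal to `ζ` along the fibre. Comparing both isotropy relations
  -- with one element over `(η, Y)` shows that the covector over the constant `ζ` is that of `ξ₂`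
  -- corrected by the change of the pairing with `θ`; so `b` is a restriction of the differentiable
  -- function `f`.
  let f : E₂ × G → ℝ := fun z => a z - Q.form (ξ₂ z) (ξ₃ (y₀, g₀)) + Q.form ξ θ
  have hφ : ContMDiffAt 𝓘(ℝ, E₂ × G) 𝓘(ℝ, E) ∞ (fun z => iM (Ψ z)) (y₀, g₀) :=
    (h.data.clean.smooth_incl _).comp (y₀, g₀) hs.self_of_nhds
  have hbf : b =ᶠ[𝓝 g₀] fun g => f (y₀, g) := by
    have ht : Tendsto (fun g : G => (y₀, g)) (𝓝 g₀) (𝓝 (y₀, g₀)) :=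
      (Continuous.prodMk_right y₀).tendsto g₀
    filter_upwards [hb, ht.eventually hs, ht.eventually hd, ht.eventually hα₂,
      ht.eventually hΨ] with g ⟨β, hβ, hbβ⟩ h1 h2 h3 h4
    have hE := h.isExactFibre_reducedFamily hρ' hμ' hμq (hbase g h4.2.2)
    obtain ⟨γ, hγ⟩ := hE.exists_covector hη
    obtain ⟨α', h5, h6⟩ := h.exists_mem_of_isSectionAlong h3 h1 (hξ₂ _)
    rw [hfib g h2 X] at h5
    have h7 := h6 ((Y, 0) : E₂ × G)
    rw [hfib g h2 Y] at h7
    have e1 := hE.form_eq hβ hγ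
    have e2 := hE.form_eq h5 hγ
    simp only at e1 e2
    have e3 : (Q.reduce 𝔠).form ζ η = Q.form ξ θ := by rw [← hξζ, ← hθη]; rfl
    have e4 : (Q.reduce 𝔠).form (Q.proj 𝔠 ⟨ξ₂ (y₀, g), hξ₂ _⟩) η =
        Q.form (ξ₂ (y₀, g)) (ξ₃ (y₀, g₀)) := by
      rw [← hθη, hξ₃0]; rfl
    change b g = α₂ (y₀, g) _ - Q.form (ξ₂ (y₀, g)) (ξ₃ (y₀, g₀)) + Q.form ξ θ
    rw [hbβ, ← h7, ← e3, ← e4, e1, e2]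
    ring
  have hsec₂ := hα₂.self_of_nhds.isSmoothSectionAt h.lagrangian hφ
  have hda : DifferentiableAt ℝ a (y₀, g₀) :=
    (contMDiffAt_iff_contDiffAt.1 (ContMDiffAt.cotangent_apply hsec₂.covector
      (contMDiffAt_mfderiv_apply hφ ((Y, 0) : E₂ × G)))).differentiableAt (by simp)
  have hdq : DifferentiableAt ℝ (fun z => Q.form (ξ₂ z) (ξ₃ (y₀, g₀))) (y₀, g₀) :=
    (hα₂.self_of_nhds.smooth (Q.form.flip (ξ₃ (y₀, g₀)))).differentiableAt (by simp)
  have hdf : HasFDerivAt f (fderiv ℝ a (y₀, g₀) -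
      fderiv ℝ (fun z => Q.form (ξ₂ z) (ξ₃ (y₀, g₀))) (y₀, g₀)) (y₀, g₀) :=
    (hda.hasFDerivAt.sub hdq.hasFDerivAt).add_const _
  have hzero : ∀ k : G, (fderiv ℝ a (y₀, g₀) -
      fderiv ℝ (fun z => Q.form (ξ₂ z) (ξ₃ (y₀, g₀))) (y₀, g₀)) ((0, k) : E₂ × G) = 0 := by
    intro k
    obtain ⟨ξ₁, α₁, hξ₁, hα₁⟩ := h.exists_isSectionAlong_orthogonal (v := ((0, k) : E₂ × G)) hs (by
      filter_upwards [hd] with z hz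
      refine (h.mfderiv_quotientMap hμ' hμq (Ψ z) _).symm.trans ?_
      exact (congrArg (mfderiv 𝓘(ℝ, E₂) 𝓘(ℝ, F₂) μ' (qM (Ψ z)) : E₂ →L[ℝ] F₂)
        ((hz ((0, k) : E₂ × G)).trans (map_zero (mfderiv 𝓘(ℝ, E₂) 𝓘(ℝ, E₂)
          (extChartAt 𝓘(ℝ, E₂) m).symm z.1 : E₂ →L[ℝ] E₂)))).trans
          (map_zero (mfderiv 𝓘(ℝ, E₂) 𝓘(ℝ, F₂) μ' (qM (Ψ z)) : E₂ →L[ℝ] F₂)))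
    -- The section over `𝔠^⊥` in a vertical direction reduces to an element with zero algebra and
    -- vector parts. Uniqueness of covectors makes it zero, so `α₁` vanishes on vectors tangent to
    -- `P`.
    have hcov : ∀ w : E₂ × G, (fun z => α₁ z (mfderiv 𝓘(ℝ, E₂ × G) 𝓘(ℝ, E) (fun z => iM (Ψ z)) z w))
        =ᶠ[𝓝 (y₀, g₀)] fun _ => 0 := by
      intro w
      filter_upwards [hs, hα₁, hd] with z h1 h2 h3
      obtain ⟨α', h4, h5⟩ := h.exists_mem_of_isSectionAlong h2 h1 (h.data.coisotropic (hξ₁ z))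
      have h6 : Q.proj 𝔠 ⟨ξ₁ z, h.data.coisotropic (hξ₁ z)⟩ = 0 :=
        (Q.proj_eq_zero_iff 𝔠 _).2 (hξ₁ z)
      have h7 := (h3 ((0, k) : E₂ × G)).trans (map_zero (mfderiv 𝓘(ℝ, E₂) 𝓘(ℝ, E₂)
        (extChartAt 𝓘(ℝ, E₂) m).symm z.1 : E₂ →L[ℝ] E₂))
      rw [h6, h7] at h4
      have h8 := (h.isExactFibre_reducedFamily hρ' hμ' hμq rfl).covector_unique h4
        (Submodule.zero_mem _)
      rw [← h5, h8]
      rfl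
    -- Involutivity with the three directions `(0, k)`, `(X, 0)`, `(Y, 0)`. All terms with `ξ₁` or
    -- `α₁` vanish, and the only survivors are the derivatives in direction `(0, k)` that make up
    -- `f`.
    have key := h.morphism.dirac.parametricBracket_eq_zero h.pair.action.smooth
      h.morphism.smooth_map h.lagrangian hφ hα₁.self_of_nhds hα₂.self_of_nhds hα₃.self_of_nhds
    unfold parametricBracket at key
    have hQ : ∀ x ∈ 𝔠, ∀ y ∈ Q.form.orthogonal 𝔠.toSubmodule, Q.form y x = 0 := fun x hx y hy =>
      Q.form_eq_zero' (W := 𝔠.toSubmodule) hx hy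
    have hconst : ∀ x ∈ 𝔠, (fun z => Q.form (ξ₁ z) x) = fun _ => 0 := fun x hx =>
      funext fun z => hQ x hx _ (hξ₁ z)
    rw [hQ _ (hξ₃ _) _ (h.isReducibleAction.lie_mem_orthogonal (hξ₁ _) (hξ₂ _)),
      hconst _ (hξ₃ _), hconst _ (hξ₂ _), (hcov _).fderiv_eq, (hcov _).fderiv_eq] at key
    simp only [fderiv_const_apply, zero_apply] at key
    rw [sub_apply]
    linarith
  have h1 : HasFDerivAt (fun g : G => (y₀, g)) (ContinuousLinearMap.inr ℝ E₂ G) g₀ :=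
    (hasFDerivAt_const y₀ g₀).prodMk (hasFDerivAt_id g₀)
  refine ((hdf.comp g₀ h1).congr_of_eventuallyEq hbf).congr_fderiv ?_
  ext k
  exact hzero k

/-- The reduced fibres do not change locally along the fibres of the quotient map. -/
theorem eventually_reducedFamily_eq (p₀ : P) : ∀ᶠ p in 𝓝 p₀, qM p = qM p₀ →
    reducedFamily E₁ E₂ Q 𝔠 L iM qM p = reducedFamily E₁ E₂ Q 𝔠 L iM qM p₀ := by
  obtain ⟨G, Ψ, r, hr, hΨ0, hΨ, hsurj⟩ := exists_submersion_chart h.data.quotient_M.smooth p₀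
    (h.data.quotient_M.submersion p₀)
  set m := qM p₀ with hm
  set y₀ := extChartAt 𝓘(ℝ, E₂) m m with hy₀
  have hmem : ∀ g ∈ Metric.ball (0 : G) r, (y₀, g) ∈ Metric.ball (y₀, (0 : G)) r := fun g hg => by
    rw [← ball_prod_same]
    exact ⟨Metric.mem_ball_self hr, hg⟩
  have hbase : ∀ g ∈ Metric.ball (0 : G) r, qM (Ψ (y₀, g)) = m := fun g hg =>
    (hΨ _ (hmem g hg)).2.2.trans (extChartAt_to_inv m)
  have hle : ∀ g ∈ Metric.ball (0 : G) r, ∀ g' ∈ Metric.ball (0 : G) r,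
      reducedFamily E₁ E₂ Q 𝔠 L iM qM (Ψ (y₀, g)) ≤
        reducedFamily E₁ E₂ Q 𝔠 L iM qM (Ψ (y₀, g')) := by
    rintro g hg g' hg' ⟨ζ, X, β⟩ hβ
    have hE := fun g hg => h.isExactFibre_reducedFamily hρ' hμ' hμq (hbase g hg)
    have hζ := (hE g hg).anchor_mem _ hβ
    have hex : ∀ g, ∃ β : E₂ →L[ℝ] ℝ, g ∈ Metric.ball (0 : G) r →
        (ζ, X, β) ∈ reducedFamily E₁ E₂ Q 𝔠 L iM qM (Ψ (y₀, g)) := fun g => by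
      by_cases hg : g ∈ Metric.ball (0 : G) r
      · obtain ⟨β, hβ⟩ := (hE g hg).exists_covector hζ
        exact ⟨β, fun _ => hβ⟩
      · exact ⟨0, fun h => absurd h hg⟩
    -- `B g` is the covector over the fixed pair `(ζ, X)` at the point with vertical coordinate `g`.
    -- It remains to see that it is constant on the ball, which is connected.
    choose B hB using hex
    have hBβ : B g = β := (hE g hg).covector_unique (hB g hg) hβ
    have hBB : B g = B g' := by
      ext Y
      obtain ⟨⟨η, Y', γ⟩, hz, hzY⟩ := (hE g hg).anchor_surjective Y
      obtain rfl : Y' = Y := hzY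
      have hη := (hE g hg).anchor_mem _ hz
      have hder : ∀ g ∈ Metric.ball (0 : G) r,
          HasFDerivAt (fun g => B g Y') (0 : G →L[ℝ] ℝ) g := fun g hg =>
        h.hasFDerivAt_covector_zero hρ' hμ' hμq (η := η) (Y := Y')
          (by filter_upwards [Metric.isOpen_ball.mem_nhds (hmem g hg)] with z hz using hΨ z hz)
          hζ hη
          (by
            filter_upwards [Metric.isOpen_ball.mem_nhds hg] with g hg
            exact ⟨B g, hB g hg, rfl⟩)
      exact Metric.isOpen_ball.is_const_of_fderiv_eq_zero (convex_ball (0 : G) r).isPreconnected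
        (fun g hg => (hder g hg).differentiableAt.differentiableWithinAt)
        (fun g hg => (hder g hg).fderiv) hg hg'
    rw [← hBβ, hBB]
    exact hB g' hg'
  -- In the adapted chart, a nearby point with the same image under `qM` has the same horizontal
  -- coordinate `y₀`.
  filter_upwards [hsurj] with p ⟨⟨y, g⟩, hz, hzp⟩ hp
  obtain ⟨-, h2, h3⟩ := hΨ _ hz
  have hy : y = y₀ := by
    have h4 : (extChartAt 𝓘(ℝ, E₂) m).symm y = m := h3.symm.trans ((congrArg qM hzp).trans hp)
    exact ((extChartAt 𝓘(ℝ, E₂) m).right_inv h2).symm.trans (congrArg (extChartAt 𝓘(ℝ, E₂) m) h4)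
  subst hy
  rw [← ball_prod_same] at hz
  rw [← hzp, ← hΨ0]
  exact le_antisymm (hle g hz.2 0 (Metric.mem_ball_self hr)) (hle 0 (Metric.mem_ball_self hr) g hz.2)

/-- Orbits are chains of integral curves, each staying in one fibre of `qM`; on the parameter
interval, which is connected, the reduced fibre is locally constant. -/
theorem reducedFamily_eq {p p' : P} (hp : qM p = qM p') :
    reducedFamily E₁ E₂ Q 𝔠 L iM qM p = reducedFamily E₁ E₂ Q 𝔠 L iM qM p' := by
  rw [h.data.quotient_M.fibres] at hp
  induction hp with
  | refl => rfl
  | symm _ _ _ ih => exact ih.symm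
  | trans _ _ _ _ _ ih₁ ih₂ => exact ih₁.trans ih₂
  | rel p p' hpp =>
    obtain ⟨X, hX, γ, a, b, hab, hγ, rfl, rfl⟩ := hpp
    have hc : ∀ t ∈ Icc a b, qM (γ t) = qM (γ a) := fun t ht =>
      ((h.data.quotient_M.fibres _ _).2 (sameOrbit_of_mem_Icc hX hγ ht)).symm
    refine isPreconnected_Icc.induction₂ (fun s t => reducedFamily E₁ E₂ Q 𝔠 L iM qM (γ s) =
      reducedFamily E₁ E₂ Q 𝔠 L iM qM (γ t)) (fun t ht => ?_)
      (fun _ _ _ _ _ _ h1 h2 => h1.trans h2) (fun _ _ _ _ h1 => h1.symm)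
      (left_mem_Icc.2 hab) (right_mem_Icc.2 hab)
    filter_upwards [(hγ t ht).continuousWithinAt.eventually
      (h.eventually_reducedFamily_eq hρ' hμ' hμq (γ t)), self_mem_nhdsWithin] with s hs hs'
    exact (hs ((hc s hs').trans (hc t ht).symm)).symm

/-- The reduction of an exact morphism of Manin pairs, as a family of subspaces. -/
theorem exists_reduction : ∃ L' : Π m : M', Submodule ℝ (CourantFibre (Q.Reduced 𝔠) E₂ m),
    ∀ p, (L' (qM p) : Submodule ℝ (Q.Reduced 𝔠 × E₂ × (E₂ →L[ℝ] ℝ))) =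
      reducedFamily E₁ E₂ Q 𝔠 L iM qM p := by
  choose pick hpick using h.data.quotient_M.surjective
  exact ⟨fun m => reducedFamily E₁ E₂ Q 𝔠 L iM qM (pick m), fun p =>
    h.reducedFamily_eq hρ' hμ' hμq (hpick _)⟩

end IsExactReduction

end Invariance

/-! ### The reduced family as an exact morphism of Manin pairs. -/

section ReducedMorphism

open Filter Topology Set

namespace IsExactFibre

variable {𝔡 : Type*} [LieRing 𝔡] [LieAlgebra ℝ 𝔡] [FiniteDimensional ℝ 𝔡]
  {A : Type*} [NormedAddCommGroup A] [NormedSpace ℝ A] [FiniteDimensional ℝ A]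
  {B : Type*} [NormedAddCommGroup B] [NormedSpace ℝ B] [FiniteDimensional ℝ B]
  {Q : QuadraticPairing 𝔡} {𝔥 : LieSubalgebra ℝ 𝔡} {r : 𝔡 →ₗ[ℝ] B}
  {D : A →L[ℝ] B} {L : Submodule ℝ (𝔡 × A × (A →L[ℝ] ℝ))}

/-- Forgetting the covector identifies `L` with the kernel of `(ξ, X) ↦ r ξ - D X`, which is onto
because `r` is. So the rank is the same at all points. -/
lemma finrank_eq (h : IsExactFibre Q 𝔥 r D L) :
    Module.finrank ℝ L = Module.finrank ℝ 𝔡 + Module.finrank ℝ A - Module.finrank ℝ B := by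
  let g : 𝔡 × A →ₗ[ℝ] B := r.comp (LinearMap.fst ℝ 𝔡 A) - (D : A →ₗ[ℝ] B).comp (LinearMap.snd ℝ 𝔡 A)
  let i : L →ₗ[ℝ] 𝔡 × A := ((LinearMap.fst ℝ 𝔡 (A × (A →L[ℝ] ℝ))).prod
    ((LinearMap.fst ℝ A (A →L[ℝ] ℝ)).comp (LinearMap.snd ℝ 𝔡 (A × (A →L[ℝ] ℝ))))).comp L.subtype
  have hi : Function.Injective i := by
    rintro ⟨⟨ξ, X, α⟩, hα⟩ ⟨⟨η, Y, β⟩, hβ⟩ hz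
    obtain ⟨h1, h2⟩ := Prod.mk.inj hz
    change ξ = η at h1
    change X = Y at h2
    subst h1 h2
    obtain rfl := h.covector_unique hα hβ
    rfl
  have hg : LinearMap.range g = ⊤ := by
    refine LinearMap.range_eq_top.2 fun b => ?_
    obtain ⟨ξ, rfl⟩ := h.surjective b
    exact ⟨(ξ, 0), by simp [g]⟩
  have hr : LinearMap.range i = LinearMap.ker g := by
    ext ⟨ξ, X⟩
    constructor
    · rintro ⟨⟨z, hz⟩, hzx⟩
      rw [← hzx]
      exact sub_eq_zero.2 (h.anchor_mem z hz)
    · intro hx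
      obtain ⟨α, hα⟩ := h.exists_covector (sub_eq_zero.1 hx)
      exact ⟨⟨_, hα⟩, rfl⟩
  have h1 := g.finrank_range_add_finrank_ker
  rw [hg, finrank_top, ← hr, LinearMap.finrank_range_of_inj hi, Module.finrank_prod] at h1
  omega

end IsExactFibre

section

variable {𝔡 : Type*} [LieRing 𝔡] [LieAlgebra ℝ 𝔡]
  {E : Type*} [NormedAddCommGroup E] [NormedSpace ℝ E]
  {M : Type*} [TopologicalSpace M] [ChartedSpace E M]
  {F : Type*} [NormedAddCommGroup F] [NormedSpace ℝ F]
  {N : Type*} [TopologicalSpace N] [ChartedSpace F N]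
  {Q : QuadraticPairing 𝔡} {ρ : 𝔡 →ₗ[ℝ] Π n : N, TangentSpace 𝓘(ℝ, F) n}
  {𝔥 : LieSubalgebra ℝ 𝔡} {μ : M → N} {L : Π m : M, Submodule ℝ (CourantFibre 𝔡 E m)}

/-- An element `a^*(ℓ, β)` has vector part `0` and, as the metric of `𝕋M` is negated, covector part
`-β`; for `(ℓ, β)` annihilating the graph this is `ℓ ∘ dμ`, the form used in `IsExactFibre`.
Injectivity of `a^*` is dual to surjectivity of the action map. -/
theorem isExactOnGraph_of_isExactFibre [FiniteDimensional ℝ 𝔡] [FiniteDimensional ℝ E]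
    [FiniteDimensional ℝ F]
    (h : ∀ m, IsExactFibre (A := E) (B := F) Q 𝔥 (actionAt ρ (μ m))
      (mfderiv 𝓘(ℝ, E) 𝓘(ℝ, F) μ m : E →L[ℝ] F)
      (L m : Submodule ℝ (𝔡 × E × (E →L[ℝ] ℝ)))) : IsExactOnGraph Q ρ μ L where
  coanchor_injective := fun m (ℓ : F →L[ℝ] ℝ) (β : E →L[ℝ] ℝ) _ h0 => by
    constructor
    · refine ContinuousLinearMap.ext fun b : F => ?_
      obtain ⟨ξ, hξ⟩ := (h m).surjective b
      have h1 : Q.form 0 ξ - ((0 : E →L[ℝ] ℝ) 0 + (0 : E →L[ℝ] ℝ) 0) =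
        (ℓ : F →L[ℝ] ℝ) (actionAt ρ (μ m) ξ) + (β : E →L[ℝ] ℝ) 0 := h0 (ξ, 0, 0)
      rw [hξ] at h1
      have h2 : ℓ b = 0 := by simpa using h1.symm
      exact h2
    · refine ContinuousLinearMap.ext fun v : E => ?_
      have h1 : Q.form 0 0 - ((0 : E →L[ℝ] ℝ) v + (0 : E →L[ℝ] ℝ) 0) =
        (ℓ : F →L[ℝ] ℝ) (actionAt ρ (μ m) 0) + (β : E →L[ℝ] ℝ) v := h0 (0, v, 0)
      have h2 : (0 : ℝ) = β v := by
        rw [(actionAt ρ (μ m)).map_zero, (ℓ : F →L[ℝ] ℝ).map_zero] at h1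
        simpa using h1
      exact h2.symm
  exact_middle m z := by
    obtain ⟨ζ, (X : E), (α : E →L[ℝ] ℝ)⟩ := z
    constructor
    · rintro ⟨hz, h0⟩
      obtain rfl : X = 0 := congrArg Prod.snd h0
      obtain ⟨ℓ, h1, h2⟩ := (h m).middle ζ α hz
      refine ⟨ℓ, (-α : E →L[ℝ] ℝ), fun v => ?_, fun w => ?_⟩
      · rw [h2]
        exact add_neg_cancel _
      · obtain ⟨η, (Y : E), (γ : E →L[ℝ] ℝ)⟩ := w
        change Q.form ζ η - (α Y + γ 0) = ℓ (actionAt ρ (μ m) η) + -α Y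
        rw [h1, map_zero]
        ring
    · rintro ⟨(ℓ : F →L[ℝ] ℝ), (β : E →L[ℝ] ℝ), hann, hco⟩
      have hco' : ∀ (η : 𝔡) (Y : E) (γ : E →L[ℝ] ℝ), Q.form ζ η - (α Y + γ X) =
          ℓ (actionAt ρ (μ m) η) + β Y := fun η Y γ => hco (η, Y, γ)
      obtain rfl : X = 0 := by
        refine (SeparatingDual.eq_iff_forall_dual_eq (R := ℝ) (V := E)).2 fun γ => ?_
        simpa using hco' 0 0 γ
      have h1 : ∀ η, Q.form ζ η = ℓ (actionAt ρ (μ m) η) := fun η => by simpa using hco' η 0 0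
      have h2 : ℓ.comp (mfderiv 𝓘(ℝ, E) 𝓘(ℝ, F) μ m : E →L[ℝ] F) = α := by
        refine ContinuousLinearMap.ext fun v : E => ?_
        have h3 : -α v = β v := by simpa using hco' 0 v 0
        have h4 : ℓ ((mfderiv 𝓘(ℝ, E) 𝓘(ℝ, F) μ m : E →L[ℝ] F) v) + β v = 0 := hann v
        change ℓ ((mfderiv 𝓘(ℝ, E) 𝓘(ℝ, F) μ m : E →L[ℝ] F) v) = α v
        linarith
      have h3 : ((ζ, 0, α) : 𝔡 × E × (E →L[ℝ] ℝ)) ∈ (L m : Submodule ℝ (𝔡 × E × (E →L[ℝ] ℝ))) := by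
        rw [← h2]
        exact (h m).coanchor_mem h1
      exact ⟨h3, Prod.ext (((h m).anchor_mem _ h3).trans (map_zero _)) rfl⟩
  anchor_mem m z hz := (h m).anchor_mem z hz
  anchor_surjective m v := by
    obtain ⟨z, hz, hv⟩ := (h m).anchor_surjective v
    exact ⟨z, hz, Prod.ext (((h m).anchor_mem z hz).trans
      (congrArg (mfderiv 𝓘(ℝ, E) 𝓘(ℝ, F) μ m : E →L[ℝ] F) hv)) hv⟩

end

section

variable {E : Type*} [NormedAddCommGroup E] [NormedSpace ℝ E] [FiniteDimensional ℝ E]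
  {M : Type*} [TopologicalSpace M] [ChartedSpace E M] [IsManifold 𝓘(ℝ, E) ∞ M]
  {G H : Type*} [NormedAddCommGroup G] [NormedSpace ℝ G] [TopologicalSpace H]
  {I : ModelWithCorners ℝ G H} {Z : Type*} [TopologicalSpace Z] [ChartedSpace H Z]

omit [IsManifold 𝓘(ℝ, E) ∞ M] in
lemma ContinuousLinearMap.isInvertible_of_rightInverse {T U : E →L[ℝ] E} (h : ∀ x, T (U x) = x) :
    T.IsInvertible := by
  have hsurj : Function.Surjective (T : E →ₗ[ℝ] E) := fun x => ⟨U x, h x⟩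
  exact ⟨(LinearEquiv.ofBijective (T : E →ₗ[ℝ] E)
    ⟨LinearMap.injective_iff_surjective.2 hsurj, hsurj⟩).toContinuousLinearEquiv, by ext; rfl⟩

/-- A family of covectors is smooth if its values on a smooth frame are. -/
lemma contMDiffAt_cotangent_of_frame {f : Z → M}
    {α : Π z, TangentSpace 𝓘(ℝ, E) (f z) →L[ℝ] ℝ} {z₀ : Z}
    (T : Π z, E →L[ℝ] TangentSpace 𝓘(ℝ, E) (f z)) (hf : ContMDiffAt I 𝓘(ℝ, E) ∞ f z₀)
    (hT : ∀ w, ContMDiffAt I 𝓘(ℝ, E).tangent ∞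
      (fun z => (⟨f z, T z w⟩ : TangentBundle 𝓘(ℝ, E) M)) z₀)
    (hinv : (T z₀).IsInvertible) (hα : ∀ w, ContMDiffAt I 𝓘(ℝ, ℝ) ∞ (fun z => α z (T z w)) z₀) :
    ContMDiffAt I (𝓘(ℝ, E).prod 𝓘(ℝ, E →L[ℝ] ℝ)) ∞
      (fun z => TotalSpace.mk' (E →L[ℝ] ℝ)
        (E := fun m : M => TangentSpace 𝓘(ℝ, E) m →L[ℝ] ℝ) (f z) (α z)) z₀ := by
  rw [contMDiffAt_cotangent_iff]
  refine ⟨hf, ?_⟩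
  refine ContMDiffAt.of_comp_clm (T := fun z => ((coordAt (E := E) (f z₀) (f z)).comp (T z) : E →L[ℝ] E))
    (contMDiffAt_clm_of_apply fun w => (contMDiffAt_tangent_iff.1 (hT w)).2)
    ((coordAt_isInvertible (mem_chart_source E (f z₀))).comp hinv)
    (contMDiffAt_clm_of_apply fun w => (hα w).congr_of_eventuallyEq ?_)
  filter_upwards [eventually_mem_chartAt (E := E) hf.continuousAt] with z hz
  exact comp_inverse_coordAt hz (α z) (T z w)

end

variable {𝔡 : Type*} [LieRing 𝔡] [LieAlgebra ℝ 𝔡] [FiniteDimensional ℝ 𝔡]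
  {V : Type*} [NormedAddCommGroup V] [NormedSpace ℝ V]
  {E : Type*} [NormedAddCommGroup E] [NormedSpace ℝ E] [FiniteDimensional ℝ E]
  {M : Type*} [TopologicalSpace M] [ChartedSpace E M] [IsManifold 𝓘(ℝ, E) ∞ M]
  {F : Type*} [NormedAddCommGroup F] [NormedSpace ℝ F] [FiniteDimensional ℝ F]
  {N : Type*} [TopologicalSpace N] [ChartedSpace F N] [IsManifold 𝓘(ℝ, F) ∞ N]
  {E₁ : Type*} [NormedAddCommGroup E₁] [NormedSpace ℝ E₁] [FiniteDimensional ℝ E₁]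
  {P : Type*} [TopologicalSpace P] [ChartedSpace E₁ P] [IsManifold 𝓘(ℝ, E₁) ∞ P]
  {F₁ : Type*} [NormedAddCommGroup F₁] [NormedSpace ℝ F₁] [FiniteDimensional ℝ F₁]
  {S : Type*} [TopologicalSpace S] [ChartedSpace F₁ S] [IsManifold 𝓘(ℝ, F₁) ∞ S]
  {E₂ : Type*} [NormedAddCommGroup E₂] [NormedSpace ℝ E₂] [FiniteDimensional ℝ E₂]
  {M' : Type*} [TopologicalSpace M'] [ChartedSpace E₂ M'] [IsManifold 𝓘(ℝ, E₂) ∞ M']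
  {F₂ : Type*} [NormedAddCommGroup F₂] [NormedSpace ℝ F₂] [FiniteDimensional ℝ F₂]
  {N' : Type*} [TopologicalSpace N'] [ChartedSpace F₂ N'] [IsManifold 𝓘(ℝ, F₂) ∞ N']
  {Q : QuadraticPairing 𝔡} {ρ : 𝔡 →ₗ[ℝ] Π n : N, TangentSpace 𝓘(ℝ, F) n}
  {𝔥 𝔠 : LieSubalgebra ℝ 𝔡} {μ : M → N} {L : Π m : M, Submodule ℝ (CourantFibre 𝔡 E m)}
  {iN : S → N} {qN : S → N'} {iM : P → M} {j : P → S} {qM : P → M'}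

omit [IsManifold 𝓘(ℝ, E₁) ∞ P] in
/-- A section of a submersion in coordinates of the base. -/
lemma exists_section_in_chart [IsManifold 𝓘(ℝ, E₁) ∞ P] (hq : ContMDiff 𝓘(ℝ, E₁) 𝓘(ℝ, E₂) ∞ qM) (hsurj : Function.Surjective qM)
    (hs : ∀ p, Function.Surjective (mfderiv 𝓘(ℝ, E₁) 𝓘(ℝ, E₂) qM p)) (m : M') :
    ∃ (φ : E₂ → P) (χ : M' → E₂) (t : E₂), χ m = t ∧ qM (φ t) = m ∧
      (∀ᶠ s in 𝓝 t, ContMDiffAt 𝓘(ℝ, E₂) 𝓘(ℝ, E₁) ∞ φ s) ∧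
      ∀ᶠ y in 𝓝 m, ContMDiffAt 𝓘(ℝ, E₂) 𝓘(ℝ, E₂) ∞ χ y ∧ qM (φ (χ y)) = y := by
  obtain ⟨p, rfl⟩ := hsurj m
  obtain ⟨σ, hσ0, hσ⟩ := exists_local_section hq p (hs p)
  set c := extChartAt 𝓘(ℝ, E₂) (qM p) with hc
  have hct : ∀ᶠ x in 𝓝 (c (qM p)), x ∈ c.target := extChartAt_target_mem_nhds (qM p)
  have hsymm : ∀ x ∈ c.target, ContMDiffAt 𝓘(ℝ, E₂) 𝓘(ℝ, E₂) ∞ c.symm x := fun x hx =>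
    (contMDiffOn_extChartAt_symm (qM p)).contMDiffAt
      ((isOpen_extChartAt_target (qM p)).mem_nhds hx)
  have hctend : Tendsto c.symm (𝓝 (c (qM p))) (𝓝 (qM p)) := by
    have := (hsymm _ (mem_extChartAt_target (qM p))).continuousAt
    rwa [ContinuousAt, hc, extChartAt_to_inv] at this
  refine ⟨fun s => σ (c.symm s), c, c (qM p), rfl, ?_, ?_, ?_⟩
  · simp only [hc, extChartAt_to_inv, hσ0]
  · filter_upwards [hct, hctend.eventually hσ] with s h1 h2
    exact h2.1.comp s (hsymm s h1)
  · filter_upwards [extChartAt_source_mem_nhds (I := 𝓘(ℝ, E₂)) (qM p), hσ] with y h1 h2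
    refine ⟨contMDiffAt_extChartAt' (by rwa [extChartAt_source] at h1), ?_⟩
    rw [c.left_inv h1]
    exact h2.2

lemma mfderiv_isInvertible_of_rightInverse {ψ : E₂ → M'} {χ : M' → E₂} {m : M'}
    (hψ : ContMDiffAt 𝓘(ℝ, E₂) 𝓘(ℝ, E₂) ∞ ψ (χ m)) (hχ : ContMDiffAt 𝓘(ℝ, E₂) 𝓘(ℝ, E₂) ∞ χ m)
    (he : ∀ᶠ y in 𝓝 m, ψ (χ y) = y) :
    (mfderiv 𝓘(ℝ, E₂) 𝓘(ℝ, E₂) ψ (χ m) : E₂ →L[ℝ] E₂).IsInvertible := by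
  have h1 := mfderiv_comp m (hψ.mdifferentiableAt (by simp)) (hχ.mdifferentiableAt (by simp))
  have h2 : mfderiv 𝓘(ℝ, E₂) 𝓘(ℝ, E₂) (ψ ∘ χ) m = mfderiv 𝓘(ℝ, E₂) 𝓘(ℝ, E₂) id m :=
    Filter.EventuallyEq.mfderiv_eq he
  have h3 : ∀ X : E₂, (mfderiv 𝓘(ℝ, E₂) 𝓘(ℝ, E₂) ψ (χ m) : E₂ →L[ℝ] E₂)
      ((mfderiv 𝓘(ℝ, E₂) 𝓘(ℝ, E₂) χ m : E₂ →L[ℝ] E₂) X) = X := by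
    intro X
    have h4 := congrArg (fun T : E₂ →L[ℝ] E₂ => T X) (h1.symm.trans (h2.trans mfderiv_id))
    exact h4
  exact ContinuousLinearMap.isInvertible_of_rightInverse (E := E₂)
    (T := (mfderiv 𝓘(ℝ, E₂) 𝓘(ℝ, E₂) ψ (χ m) : E₂ →L[ℝ] E₂))
    (U := (mfderiv 𝓘(ℝ, E₂) 𝓘(ℝ, E₂) χ m : E₂ →L[ℝ] E₂)) h3

namespace IsExactReduction

variable (h : IsExactReduction E F E₁ F₁ E₂ F₂ Q ρ 𝔥 μ L 𝔠 iN qN iM j qM)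
  {ρ' : Q.Reduced 𝔠 →ₗ[ℝ] Π n : N', TangentSpace 𝓘(ℝ, F₂) n}
  (hρ' : ∀ (ξ : 𝔠) (s : S) (v : TangentSpace 𝓘(ℝ, F₁) s),
        mfderiv 𝓘(ℝ, F₁) 𝓘(ℝ, F) iN s v = ρ (ξ : 𝔡) (iN s) →
          ρ' (Q.proj 𝔠 ξ) (qN s) = mfderiv 𝓘(ℝ, F₁) 𝓘(ℝ, F₂) qN s v)
  {μ' : M' → N'} (hμ' : ContMDiff 𝓘(ℝ, E₂) 𝓘(ℝ, F₂) ∞ μ') (hμq : ∀ p, μ' (qM p) = qN (j p))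
  {L' : Π m : M', Submodule ℝ (CourantFibre (Q.Reduced 𝔠) E₂ m)}
  (hL' : ∀ p, (L' (qM p) : Submodule ℝ (Q.Reduced 𝔠 × E₂ × (E₂ →L[ℝ] ℝ))) =
      reducedFamily E₁ E₂ Q 𝔠 L iM qM p)
include h hμq hL'

/-- The two standard lifts share a covector on `P`, which is the condition that `α` and `α'` have
the same pull-back to `P` in the reduced fibre. Independence of the chosen `p` is contained in
`hL'`. -/
theorem reducedRel_eq_graphRel :
    reducedRel (E := E) (E₁ := E₁) (E₂ := E₂) Q μ L 𝔠 iN qN iM qM = graphRel μ' L' := by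
  refine Set.ext fun ⟨x, ζ, n'⟩ => ⟨?_, ?_⟩
  · rintro ⟨y, ⟨w, ⟨p, v, β, hw⟩, ⟨p', v', β', hw'⟩⟩, ⟨ξ, n⟩, ⟨m, z, hz, hyz⟩, ⟨⟨ξ', hξ'⟩, s, hs, hs'⟩⟩
    obtain ⟨rfl, rfl⟩ := Prod.mk.inj hw
    obtain ⟨h1, rfl⟩ := Prod.mk.inj hw'
    obtain ⟨rfl, h2⟩ := Sigma.mk.inj h1
    obtain ⟨rfl, h3⟩ := Prod.mk.inj (eq_of_heq h2)
    obtain ⟨h4, h5⟩ := Prod.mk.inj hyz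
    obtain ⟨rfl, h6⟩ := Sigma.mk.inj h4
    have h7 := eq_of_heq h6
    obtain ⟨rfl, rfl⟩ := Prod.mk.inj h5
    obtain ⟨h8, rfl⟩ := Prod.mk.inj hξ'
    change iN s = μ (iM p) at hs
    change qN s = n' at hs'
    -- Injectivity of `iN` makes the intermediate point of `S` unique, so the target point is `μ'
    -- (qM p)`.
    have h9 : s = j p := h.data.injective_incl (hs.trans (h.base_eq p).symm)
    have hmem : ((Q.proj 𝔠 ξ', (mfderiv 𝓘(ℝ, E₁) 𝓘(ℝ, E₂) qM p v : E₂), (β' : E₂ →L[ℝ] ℝ)) :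
        Q.Reduced 𝔠 × E₂ × (E₂ →L[ℝ] ℝ)) ∈
        (L' (qM p) : Submodule ℝ (Q.Reduced 𝔠 × E₂ × (E₂ →L[ℝ] ℝ))) := by
      rw [hL']
      refine ⟨ξ', v, β, ?_, rfl, rfl, fun u => ?_⟩
      · have h10 : z = ((ξ' : 𝔡), mfderiv 𝓘(ℝ, E₁) 𝓘(ℝ, E) iM p v, β) := Prod.ext h8 h7.symm
        rw [h10] at hz
        exact hz
      · exact congrArg (fun T : E₁ →L[ℝ] ℝ => T u) h3
    refine ⟨qM p, _, hmem, ?_⟩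
    rw [← hs', h9, ← hμq]
    rfl
  · rintro ⟨m, z, hz, hxz⟩
    obtain ⟨rfl, hx⟩ := Prod.mk.inj hxz
    obtain ⟨rfl, rfl⟩ := Prod.mk.inj hx
    clear hx hxz
    obtain ⟨p, rfl⟩ := h.data.quotient_M.surjective m
    have hz' : z ∈ reducedFamily E₁ E₂ Q 𝔠 L iM qM p := by
      rw [← hL']
      exact hz
    obtain ⟨ζ, X, α'⟩ := z
    obtain ⟨ξ, u, α, h1, h2, h3, h4⟩ := hz'
    change Q.proj 𝔠 ξ = ζ at h2
    change mfderiv 𝓘(ℝ, E₁) 𝓘(ℝ, E₂) qM p u = X at h3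
    subst h2 h3
    refine ⟨⟨iM p, mfderiv 𝓘(ℝ, E₁) 𝓘(ℝ, E) iM p u, α⟩, ⟨⟨p, u, α.comp (mfderiv 𝓘(ℝ, E₁) 𝓘(ℝ, E) iM p)⟩,
      ⟨p, u, α, rfl⟩, ⟨p, u, α', ?_⟩⟩, ((ξ : 𝔡), μ (iM p)), 
      ⟨iM p, ((ξ : 𝔡), mfderiv 𝓘(ℝ, E₁) 𝓘(ℝ, E) iM p u, α), h1, rfl⟩, ⟨ξ, rfl⟩, j p,
      h.base_eq p, (hμq p).symm⟩
    have h5 : (α.comp (mfderiv 𝓘(ℝ, E₁) 𝓘(ℝ, E) iM p : E₁ →L[ℝ] E)) =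
        (α'.comp (mfderiv 𝓘(ℝ, E₁) 𝓘(ℝ, E₂) qM p) : E₁ →L[ℝ] ℝ) :=
      ContinuousLinearMap.ext fun v : E₁ => h4 v
    exact congrArg (fun a : E₁ →L[ℝ] ℝ => ((⟨p, u, a⟩, ⟨qM p, mfderiv 𝓘(ℝ, E₁) 𝓘(ℝ, E₂) qM p u, α'⟩) :
      GenTangentBundle E₁ P × GenTangentBundle E₂ M')) h5

include hρ' hμ'

theorem isExactFibre_reduction (m : M') :
    IsExactFibre (A := E₂) (B := F₂) (Q.reduce 𝔠) (Q.reduceSubalgebra 𝔠 𝔥) (actionAt ρ' (μ' m))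
      (mfderiv 𝓘(ℝ, E₂) 𝓘(ℝ, F₂) μ' m : E₂ →L[ℝ] F₂)
      (L' m : Submodule ℝ (Q.Reduced 𝔠 × E₂ × (E₂ →L[ℝ] ℝ))) := by
  obtain ⟨p, rfl⟩ := h.data.quotient_M.surjective m
  rw [hL' p]
  exact h.isExactFibre_reducedFamily hρ' hμ' hμq rfl

/-- Elements of the reduction extend to sections along a map that come from sections of `L`. -/
theorem exists_reduced_section {φ : V → P} {t v : V}
    (hφ : ∀ᶠ s in 𝓝 t, ContMDiffAt 𝓘(ℝ, V) 𝓘(ℝ, E₁) ∞ φ s)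
    {z : CourantFibre (Q.Reduced 𝔠) E₂ (qM (φ t))} (hz : z ∈ L' (qM (φ t)))
    (hv : z.2.1 = mfderiv 𝓘(ℝ, V) 𝓘(ℝ, E₂) (fun s => qM (φ s)) t v) :
    ∃ (ξ : V → 𝔠) (α : Π s, TangentSpace 𝓘(ℝ, E) (iM (φ s)) →L[ℝ] ℝ)
      (α' : Π s, TangentSpace 𝓘(ℝ, E₂) (qM (φ s)) →L[ℝ] ℝ),
      z = (Q.proj 𝔠 (ξ t), mfderiv 𝓘(ℝ, V) 𝓘(ℝ, E₂) (fun s => qM (φ s)) t v, α' t) ∧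
      ∀ᶠ s in 𝓝 t, IsSectionAlong L (fun s => iM (φ s)) s v (fun s => (ξ s : 𝔡)) α ∧
        IsSectionAlong L' (fun s => qM (φ s)) s v (fun s => Q.proj 𝔠 (ξ s)) α' ∧
        ∀ w, α' s (mfderiv 𝓘(ℝ, V) 𝓘(ℝ, E₂) (fun s => qM (φ s)) s w) =
          α s (mfderiv 𝓘(ℝ, V) 𝓘(ℝ, E) (fun s => iM (φ s)) s w) := by
  have hq : ∀ s, ContMDiffAt 𝓘(ℝ, V) 𝓘(ℝ, E₁) ∞ φ s → ∀ w : V,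
      (mfderiv 𝓘(ℝ, V) 𝓘(ℝ, E₂) (fun s => qM (φ s)) s w : E₂) =
        mfderiv 𝓘(ℝ, E₁) 𝓘(ℝ, E₂) qM (φ s) (mfderiv 𝓘(ℝ, V) 𝓘(ℝ, E₁) φ s w) := fun s hs w =>
    congrArg (fun T : V →L[ℝ] E₂ => T w) (mfderiv_comp s
      (h.data.quotient_M.smooth.mdifferentiable (by simp) (φ s)) (hs.mdifferentiableAt (by simp)))
  obtain ⟨ζ, X, β⟩ := z
  have hE := h.isExactFibre_reduction hρ' hμ' hμq hL'
  have hX : (X : E₂) = mfderiv 𝓘(ℝ, E₁) 𝓘(ℝ, E₂) qM (φ t) (mfderiv 𝓘(ℝ, V) 𝓘(ℝ, E₁) φ t v) :=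
    Eq.trans hv (hq t hφ.self_of_nhds v)
  obtain ⟨ξ₀, h1, h2⟩ := h.exists_lift hρ' hμ' hμq rfl (ζ := ζ)
    (u := mfderiv 𝓘(ℝ, V) 𝓘(ℝ, E₁) φ t v)
    (((hE _).anchor_mem _ hz).trans (congrArg (mfderiv 𝓘(ℝ, E₂) 𝓘(ℝ, F₂) μ' (qM (φ t)) : E₂ →L[ℝ] F₂) hX))
  obtain ⟨ξ, α, h3, h4, h5⟩ := h.exists_isSectionAlong hφ ξ₀.2 h2
  have hex : ∀ s, ∃ α' : E₂ →L[ℝ] ℝ,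
      IsSectionAlong L (fun s => iM (φ s)) s v ξ α → ContMDiffAt 𝓘(ℝ, V) 𝓘(ℝ, E₁) ∞ φ s →
      (Q.proj 𝔠 ⟨ξ s, h4 s⟩, (mfderiv 𝓘(ℝ, V) 𝓘(ℝ, E₂) (fun s => qM (φ s)) s v : E₂), α') ∈
        (L' (qM (φ s)) : Submodule ℝ (Q.Reduced 𝔠 × E₂ × (E₂ →L[ℝ] ℝ))) ∧
      ∀ w : V, α' (mfderiv 𝓘(ℝ, V) 𝓘(ℝ, E₂) (fun s => qM (φ s)) s w : E₂) =
          α s (mfderiv 𝓘(ℝ, V) 𝓘(ℝ, E) (fun s => iM (φ s)) s w) := by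
    intro s
    by_cases hs : IsSectionAlong L (fun s => iM (φ s)) s v ξ α ∧ ContMDiffAt 𝓘(ℝ, V) 𝓘(ℝ, E₁) ∞ φ s
    · obtain ⟨α', h6, h7⟩ := h.exists_mem_of_isSectionAlong hs.1 hs.2 (h4 s)
      refine ⟨α', fun _ _ => ⟨?_, fun w => ?_⟩⟩
      · rw [hL', hq s hs.2]
        exact h6
      · rw [hq s hs.2]
        exact h7 w
    · exact ⟨0, fun h1 h2 => absurd ⟨h1, h2⟩ hs⟩
  choose α' hα' using hex
  refine ⟨fun s => ⟨ξ s, h4 s⟩, α, α', ?_, ?_⟩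
  · have h6 := (hα' t h5.self_of_nhds hφ.self_of_nhds).1
    have h7 : (⟨ξ t, h4 t⟩ : 𝔠) = ξ₀ := Subtype.ext h3
    have h8 : Q.proj 𝔠 ⟨ξ t, h4 t⟩ = ζ := by rw [h7, h1]
    have h9 : ((ζ, X, α' t) : Q.Reduced 𝔠 × E₂ × (E₂ →L[ℝ] ℝ)) =
        (Q.proj 𝔠 ⟨ξ t, h4 t⟩, (mfderiv 𝓘(ℝ, V) 𝓘(ℝ, E₂) (fun s => qM (φ s)) t v : E₂), α' t) :=
      Prod.ext h8.symm (Prod.ext hv rfl)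
    rw [← h9] at h6
    exact Prod.ext h8.symm (Prod.ext hv ((hE _).covector_unique hz h6))
  · filter_upwards [h5, hφ, (h5.and hφ).eventually_nhds] with s h6 h7 h8
    refine ⟨h6, ⟨fun ℓ => ?_, ?_⟩, (hα' s h6 h7).2⟩
    -- Smoothness of `ξ` is known for functionals on `𝔡` only; a functional on the quotient is
    -- pulled back to `𝔠` and extended.
    · obtain ⟨ℓ', hℓ'⟩ := LinearMap.exists_extend (p := 𝔠.toSubmodule)
        (ℓ.comp (Q.proj 𝔠 : 𝔠 →ₗ[ℝ] Q.Reduced 𝔠))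
      refine (h6.smooth ℓ').congr_of_eventuallyEq (Eventually.of_forall fun s => ?_)
      exact (LinearMap.congr_fun hℓ' ⟨ξ s, h4 s⟩).symm
    · filter_upwards [h8] with s' h9
      exact (hα' s' h9.1 h9.2).1

/-- Along a local section `φ` of `qM`, extend `z` with vector part in a constant direction and
return to `M'` by the chart `χ`. The covector part is smooth because on the frame given by the
derivative of `qM ∘ φ` it takes the values of a smooth section of `L`. -/
theorem reduction_smooth [T2Space M'] (m : M') (z : CourantFibre (Q.Reduced 𝔠) E₂ m) (hz : z ∈ L' m) :
    ∃ e : Π m : M', CourantFibre (Q.Reduced 𝔠) E₂ m,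
      IsSmoothSection 𝓘(ℝ, E₂) id e ∧ (∀ m', e m' ∈ L' m') ∧ e m = z := by
  obtain ⟨φ, χ, t, hχt, hm, hφ, hχ⟩ := exists_section_in_chart h.data.quotient_M.smooth
    h.data.quotient_M.surjective h.data.quotient_M.submersion m
  subst hm
  have hψ : ∀ᶠ s in 𝓝 t, ContMDiffAt 𝓘(ℝ, E₂) 𝓘(ℝ, E₂) ∞ (fun s => qM (φ s)) s := by
    filter_upwards [hφ] with s hs using (h.data.quotient_M.smooth (φ s)).comp s hs
  have hχtend : Tendsto χ (𝓝 (qM (φ t))) (𝓝 t) := by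
    have := hχ.self_of_nhds.1.continuousAt
    rwa [ContinuousAt, hχt] at this
  have hinv : ∀ᶠ y in 𝓝 (qM (φ t)), (mfderiv 𝓘(ℝ, E₂) 𝓘(ℝ, E₂) (fun s => qM (φ s)) (χ y) :
      E₂ →L[ℝ] E₂).IsInvertible := by
    filter_upwards [hχtend.eventually hψ, hχ, hχ.eventually_nhds] with y h1 h2 h3
    exact mfderiv_isInvertible_of_rightInverse h1 h2.1 (h3.mono fun y hy => hy.2)
  have hinvt := hinv.self_of_nhds
  rw [hχt] at hinvt
  obtain ⟨v, hv⟩ := hinvt.surjective z.2.1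
  obtain ⟨ξ, α, α', hzt, hev⟩ := h.exists_reduced_section hρ' hμ' hμq hL' hφ hz hv.symm
  let e : Π m : M', CourantFibre (Q.Reduced 𝔠) E₂ m := fun y =>
    (Q.proj 𝔠 (ξ (χ y)), (mfderiv 𝓘(ℝ, E₂) 𝓘(ℝ, E₂) (fun s => qM (φ s)) (χ y) v : E₂),
      (α' (χ y) : E₂ →L[ℝ] ℝ))
  have het : e (qM (φ t)) = z := by
    rw [hzt]
    have h1 : ∀ s, s = t → ((Q.proj 𝔠 (ξ s), (mfderiv 𝓘(ℝ, E₂) 𝓘(ℝ, E₂) (fun s => qM (φ s)) s v : E₂),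
      (α' s : E₂ →L[ℝ] ℝ)) : Q.Reduced 𝔠 × E₂ × (E₂ →L[ℝ] ℝ)) =
      (Q.proj 𝔠 (ξ t), (mfderiv 𝓘(ℝ, E₂) 𝓘(ℝ, E₂) (fun s => qM (φ s)) t v : E₂),
      (α' t : E₂ →L[ℝ] ℝ)) := by
      rintro _ rfl
      rfl
    exact h1 _ hχt
  rw [← het]
  refine exists_isSmoothSection_of_eventually L' _ e ?_ ?_
  · filter_upwards [hχ, hχ.eventually_nhds, hχtend.eventually hev.eventually_nhds, hχtend.eventually hφ,
      hχtend.eventually hψ, hinv] with y h1 h2 h3 h5 h6 h7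
    obtain ⟨h3', h4, -⟩ := h3.self_of_nhds
    have hφM := (h.data.clean.smooth_incl (φ (χ y))).comp (χ y) h5
    have hα : ∀ w : E₂, ContMDiffAt 𝓘(ℝ, E₂) 𝓘(ℝ, ℝ) ∞ (fun s =>
        α' s (mfderiv 𝓘(ℝ, E₂) 𝓘(ℝ, E₂) (fun s => qM (φ s)) s w)) (χ y) := fun w => by
      refine (ContMDiffAt.cotangent_apply (h3'.isSmoothSectionAt h.lagrangian hφM).covector
        (contMDiffAt_mfderiv_apply hφM w)).congr_of_eventuallyEq ?_
      filter_upwards [h3] with s hs using hs.2.2 w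
    have hcov := contMDiffAt_cotangent_of_frame (α := α')
      (fun s => mfderiv 𝓘(ℝ, E₂) 𝓘(ℝ, E₂) (fun s => qM (φ s)) s) h6
      (fun w => contMDiffAt_mfderiv_apply h6 w) h7 hα
    refine ⟨fun ℓ => ((h4.smooth ℓ).contMDiffAt).comp y h1.1, ?_, ?_⟩
    · refine ((contMDiffAt_mfderiv_apply h6 v).comp y h1.1).congr_of_eventuallyEq ?_
      have h8 : ∀ (a b : M') (_ : a = b) (w : E₂), (⟨b, w⟩ : TangentBundle 𝓘(ℝ, E₂) M') = ⟨a, w⟩ := by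
        rintro a _ rfl w
        rfl
      filter_upwards [h2] with y' hy' using h8 _ _ hy'.2 _
    · refine (hcov.comp y h1.1).congr_of_eventuallyEq ?_
      have h8 : ∀ (a b : M') (_ : a = b) (w : E₂ →L[ℝ] ℝ), TotalSpace.mk' (E₂ →L[ℝ] ℝ)
          (E := fun m : M' => TangentSpace 𝓘(ℝ, E₂) m →L[ℝ] ℝ) b w = TotalSpace.mk' (E₂ →L[ℝ] ℝ)
          (E := fun m : M' => TangentSpace 𝓘(ℝ, E₂) m →L[ℝ] ℝ) a w := by
        rintro a _ rfl w
        rfl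
      filter_upwards [h2] with y' hy' using h8 _ _ hy'.2 _
  · filter_upwards [hχ, hχtend.eventually hev] with y h1 h2
    have h3 : ∀ (a b : M') (_ : a = b) (z : Q.Reduced 𝔠 × E₂ × (E₂ →L[ℝ] ℝ)),
        z ∈ (L' a : Submodule ℝ (Q.Reduced 𝔠 × E₂ × (E₂ →L[ℝ] ℝ))) →
        z ∈ (L' b : Submodule ℝ (Q.Reduced 𝔠 × E₂ × (E₂ →L[ℝ] ℝ))) := by
      rintro a _ rfl z hz
      exact hz
    exact h3 _ _ h1.2 _ h2.2.1.mem.self_of_nhds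

theorem isLagrangianOverGraph_reduction [T2Space M'] :
    IsLagrangianOverGraph (Q.reduce 𝔠) ρ' μ' L' where
  smooth := h.reduction_smooth hρ' hμ' hμq hL'
  lagrangian m := (h.isExactFibre_reduction hρ' hμ' hμq hL' m).lagrangian
  anchor_mem m := (h.isExactFibre_reduction hρ' hμ' hμq hL' m).anchor_mem
  anchor_surjective m := (h.isExactFibre_reduction hρ' hμ' hμq hL' m).anchor_surjective

/-- The parametric bracket of `L'` along `qM ∘ φ` equals that of `L` along `iM ∘ φ`, which vanishes:
lifted sections have the same covector pairings, and on `𝔠` the reduced bracket and pairing are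
those of `𝔡`. -/
theorem courantBracketPairing_reduction_eq_zero [T2Space M']
    {f₁ f₂ f₃ : Π q : N' × M', CourantFibre (Q.Reduced 𝔠) E₂ q.2}
    (hf₁ : IsSmoothSection (𝓘(ℝ, F₂).prod 𝓘(ℝ, E₂)) Prod.snd f₁)
    (hf₂ : IsSmoothSection (𝓘(ℝ, F₂).prod 𝓘(ℝ, E₂)) Prod.snd f₂)
    (hf₃ : IsSmoothSection (𝓘(ℝ, F₂).prod 𝓘(ℝ, E₂)) Prod.snd f₃)
    (hfL₁ : ∀ m, f₁ (μ' m, m) ∈ L' m) (hfL₂ : ∀ m, f₂ (μ' m, m) ∈ L' m)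
    (hfL₃ : ∀ m, f₃ (μ' m, m) ∈ L' m) (m : M') :
    courantBracketPairing (Q.reduce 𝔠) ρ' f₁ f₂ f₃ (μ' m, m) = 0 := by
  obtain ⟨φ, χ, t, hχt, hm, hφ, hχ⟩ := exists_section_in_chart h.data.quotient_M.smooth
    h.data.quotient_M.surjective h.data.quotient_M.submersion m
  subst hm
  have hφM : ContMDiffAt 𝓘(ℝ, E₂) 𝓘(ℝ, E) ∞ (fun s => iM (φ s)) t :=
    (h.data.clean.smooth_incl (φ t)).comp t hφ.self_of_nhds
  have hψ : ContMDiffAt 𝓘(ℝ, E₂) 𝓘(ℝ, E₂) ∞ (fun s => qM (φ s)) t :=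
    (h.data.quotient_M.smooth (φ t)).comp t hφ.self_of_nhds
  have hinv : (mfderiv 𝓘(ℝ, E₂) 𝓘(ℝ, E₂) (fun s => qM (φ s)) t : E₂ →L[ℝ] E₂).IsInvertible := by
    have h1 := mfderiv_isInvertible_of_rightInverse (χ := χ) (m := qM (φ t)) (hχt ▸ hψ)
      hχ.self_of_nhds.1 (hχ.mono fun y hy => hy.2)
    rwa [hχt] at h1
  obtain ⟨v₁, hv₁⟩ := hinv.surjective (f₁ (μ' (qM (φ t)), qM (φ t))).2.1
  obtain ⟨v₂, hv₂⟩ := hinv.surjective (f₂ (μ' (qM (φ t)), qM (φ t))).2.1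
  obtain ⟨v₃, hv₃⟩ := hinv.surjective (f₃ (μ' (qM (φ t)), qM (φ t))).2.1
  obtain ⟨ξ₁, α₁, α₁', hz₁, hev₁⟩ := h.exists_reduced_section hρ' hμ' hμq hL' hφ (hfL₁ _) hv₁.symm
  obtain ⟨ξ₂, α₂, α₂', hz₂, hev₂⟩ := h.exists_reduced_section hρ' hμ' hμq hL' hφ (hfL₂ _) hv₂.symm
  obtain ⟨ξ₃, α₃, α₃', hz₃, hev₃⟩ := h.exists_reduced_section hρ' hμ' hμq hL' hφ (hfL₃ _) hv₃.symm
  rw [courantBracketPairing_eq_parametricBracket (V := E₂) (h.isReducibleAction.quotientAction_smooth hρ') hμ'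
    (h.isLagrangianOverGraph_reduction hρ' hμ' hμq hL') hf₁ hf₂ hf₃ hfL₁ hfL₂ hfL₃ hψ
    hev₁.self_of_nhds.2.1 hev₂.self_of_nhds.2.1 hz₁ hz₂ (ξ₃ := fun s => Q.proj 𝔠 (ξ₃ s)) (v₃ := (v₃ : E₂))
    (α₃ := α₃') hz₃]
  have key := h.morphism.dirac.parametricBracket_eq_zero h.pair.action.smooth h.morphism.smooth_map
    h.lagrangian hφM hev₁.self_of_nhds.1 hev₂.self_of_nhds.1 hev₃.self_of_nhds.1
  rw [← key]
  have d₁₂ : (fun s => α₁' s (mfderiv 𝓘(ℝ, E₂) 𝓘(ℝ, E₂) (fun s => qM (φ s)) s v₂)) =ᶠ[𝓝 t]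
      fun s => α₁ s (mfderiv 𝓘(ℝ, E₂) 𝓘(ℝ, E) (fun s => iM (φ s)) s v₂) :=
    hev₁.mono fun s hs => hs.2.2 v₂
  have d₁₃ : (fun s => α₁' s (mfderiv 𝓘(ℝ, E₂) 𝓘(ℝ, E₂) (fun s => qM (φ s)) s v₃)) =ᶠ[𝓝 t]
      fun s => α₁ s (mfderiv 𝓘(ℝ, E₂) 𝓘(ℝ, E) (fun s => iM (φ s)) s v₃) :=
    hev₁.mono fun s hs => hs.2.2 v₃
  have d₂₃ : (fun s => α₂' s (mfderiv 𝓘(ℝ, E₂) 𝓘(ℝ, E₂) (fun s => qM (φ s)) s v₃)) =ᶠ[𝓝 t]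
      fun s => α₂ s (mfderiv 𝓘(ℝ, E₂) 𝓘(ℝ, E) (fun s => iM (φ s)) s v₃) :=
    hev₂.mono fun s hs => hs.2.2 v₃
  unfold parametricBracket
  congr 1
  exact congrArg₂ (· + ·) (congrArg₂ (· - ·) (congrArg (fun T : E₂ →L[ℝ] ℝ => T v₁) d₂₃.fderiv_eq)
    (congrArg (fun T : E₂ →L[ℝ] ℝ => T v₂) d₁₃.fderiv_eq))
    (congrArg (fun T : E₂ →L[ℝ] ℝ => T v₃) d₁₂.fderiv_eq)

theorem isManinPairMorphism_reduction [T2Space M'] :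
    IsManinPairMorphism (Q.reduce 𝔠) ρ' (Q.reduceSubalgebra 𝔠 𝔥) μ' L' where
  smooth_map := hμ'
  dirac :=
    { constant_rank := ⟨_, fun m => (h.isExactFibre_reduction hρ' hμ' hμq hL' m).finrank_eq⟩
      smooth := h.reduction_smooth hρ' hμ' hμq hL'
      lagrangian := fun m => (h.isExactFibre_reduction hρ' hμ' hμq hL' m).lagrangian
      involutive := fun _ _ _ hf₁ hf₂ hf₃ hfL₁ hfL₂ hfL₃ =>
        h.courantBracketPairing_reduction_eq_zero hρ' hμ' hμq hL' hf₁ hf₂ hf₃ hfL₁ hfL₂ hfL₃ }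
  range_le m := (h.isExactFibre_reduction hρ' hμ' hμq hL' m).range_le
  ker_inter m := (h.isExactFibre_reduction hρ' hμ' hμq hL' m).ker_inter

theorem isExactOnGraph_reduction : IsExactOnGraph (Q.reduce 𝔠) ρ' μ' L' :=
  isExactOnGraph_of_isExactFibre (h.isExactFibre_reduction hρ' hμ' hμq hL')

end IsExactReduction

end ReducedMorphism

/-! ### The case of a Lagrangian `𝔠`. -/

section SymplecticReduction

open Filter Topology

section

variable {E : Type*} [NormedAddCommGroup E] [NormedSpace ℝ E]
  {M : Type*} [TopologicalSpace M] [ChartedSpace E M] [IsManifold 𝓘(ℝ, E) ∞ M]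
  {F : Type*} [NormedAddCommGroup F] [NormedSpace ℝ F]
  {N : Type*} [TopologicalSpace N] [ChartedSpace F N] [IsManifold 𝓘(ℝ, F) ∞ N]

lemma dirDeriv_comp_snd {f : M → ℝ} {r : N × M} (hf : MDifferentiableAt 𝓘(ℝ, E) 𝓘(ℝ, ℝ) f r.2)
    (w : TangentSpace (𝓘(ℝ, F).prod 𝓘(ℝ, E)) r) :
    dirDeriv (𝓘(ℝ, F).prod 𝓘(ℝ, E)) (fun r : N × M => f r.2) r w = dirDeriv 𝓘(ℝ, E) f r.2 w.2 := by
  refine (dirDeriv_comp (I := 𝓘(ℝ, F).prod 𝓘(ℝ, E)) (φ := (Prod.snd : N × M → M)) (z := r)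
    hf mdifferentiableAt_snd w).trans ?_
  rw [mfderiv_snd]
  rfl

/-- Fields on the product that project to fields on `M` act on functions pulled back from `M`
through those projections; test the commutator formula on such functions. -/
lemma mlieBracket_snd [CompleteSpace E] [CompleteSpace F]
    {A B : Π r : N × M, TangentSpace (𝓘(ℝ, F).prod 𝓘(ℝ, E)) r} {X Y : Π m : M, TangentSpace 𝓘(ℝ, E) m}
    {r : N × M}
    (hA : ContMDiffAt (𝓘(ℝ, F).prod 𝓘(ℝ, E)) (𝓘(ℝ, F).prod 𝓘(ℝ, E)).tangent ∞
      (fun r => (⟨r, A r⟩ : TangentBundle (𝓘(ℝ, F).prod 𝓘(ℝ, E)) (N × M))) r)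
    (hB : ContMDiffAt (𝓘(ℝ, F).prod 𝓘(ℝ, E)) (𝓘(ℝ, F).prod 𝓘(ℝ, E)).tangent ∞
      (fun r => (⟨r, B r⟩ : TangentBundle (𝓘(ℝ, F).prod 𝓘(ℝ, E)) (N × M))) r)
    (hX : IsSmoothVectorField X) (hY : IsSmoothVectorField Y)
    (hAX : ∀ r, (A r).2 = X r.2) (hBY : ∀ r, (B r).2 = Y r.2) :
    ((VectorField.mlieBracket (𝓘(ℝ, F).prod 𝓘(ℝ, E)) A B r).2 : E) =
      VectorField.mlieBracket 𝓘(ℝ, E) X Y r.2 := by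
  have h2 : (2 : WithTop ℕ∞) ≤ ∞ := WithTop.coe_le_coe.2 (le_top : (2 : ℕ∞) ≤ ⊤)
  have : IsManifold 𝓘(ℝ, E) 2 M := IsManifold.of_le (n := ∞) h2
  have : IsManifold 𝓘(ℝ, F) 2 N := IsManifold.of_le (n := ∞) h2
  refine (SeparatingDual.eq_iff_forall_dual_eq (R := ℝ) (V := E)).2 fun γ => ?_
  set f : M → ℝ := fun m => γ (extChartAt 𝓘(ℝ, E) r.2 m) with hf
  have hfs : ContMDiffAt 𝓘(ℝ, E) 𝓘(ℝ, ℝ) ∞ f r.2 :=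
    contMDiffAt_dual_comp_extChartAt γ (mem_chart_source E r.2)
  have hfr : ContMDiffAt (𝓘(ℝ, F).prod 𝓘(ℝ, E)) 𝓘(ℝ, ℝ) 2 (fun r : N × M => f r.2) r :=
    (hfs.of_le h2).comp r contMDiffAt_snd
  have key : ∀ (C D : Π r : N × M, TangentSpace (𝓘(ℝ, F).prod 𝓘(ℝ, E)) r)
      (W Z : Π m : M, TangentSpace 𝓘(ℝ, E) m), IsSmoothVectorField W →
      (∀ r, (C r).2 = W r.2) → (∀ r, (D r).2 = Z r.2) →
      dirDeriv (𝓘(ℝ, F).prod 𝓘(ℝ, E))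
        (fun y => dirDeriv (𝓘(ℝ, F).prod 𝓘(ℝ, E)) (fun r : N × M => f r.2) y (C y)) r (D r)
        = dirDeriv 𝓘(ℝ, E) (fun m => dirDeriv 𝓘(ℝ, E) f m (W m)) r.2 (Z r.2) := by
    intro C D W Z hW hCW hDZ
    have hev : (fun y => dirDeriv (𝓘(ℝ, F).prod 𝓘(ℝ, E)) (fun r : N × M => f r.2) y (C y)) =ᶠ[𝓝 r]
        fun y => dirDeriv 𝓘(ℝ, E) f y.2 (W y.2) := by
      filter_upwards [eventually_mem_chartAt (E := E) (f := (Prod.snd : N × M → M)) (z₀ := r)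
        continuousAt_snd] with y hy
      rw [← hCW]
      exact dirDeriv_comp_snd ((contMDiffAt_dual_comp_extChartAt γ hy).mdifferentiableAt (by simp)) _
    have hd := (contMDiffAt_dirDeriv_dual γ (hW r.2)).mdifferentiableAt (by simp : (∞ : WithTop ℕ∞) ≠ 0)
    rw [← hDZ, ← dirDeriv_comp_snd (N := N) (F := F) hd (D r)]
    unfold dirDeriv at hev ⊢
    rw [hev.mfderiv_eq]
    rfl
  have h1 := dirDeriv_comp_snd (N := N) (F := F) (hfs.mdifferentiableAt (by simp))
    (VectorField.mlieBracket (𝓘(ℝ, F).prod 𝓘(ℝ, E)) A B r)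
  have h3 := h1.trans (dirDeriv_dual_comp_extChartAt_self (E := E) γ r.2 _)
  refine h3.symm.trans (Eq.trans ?_ (dirDeriv_dual_comp_extChartAt_self (E := E) γ r.2 _))
  rw [mfderiv_mlieBracket_apply hfr (hA.mdifferentiableAt (by simp)) (hB.mdifferentiableAt (by simp)),
    key B A Y X hY hBY hAX, key A B X Y hX hAX hBY]
  exact (mfderiv_mlieBracket_apply (hfs.of_le h2) ((hX r.2).mdifferentiableAt (by simp))
    ((hY r.2).mdifferentiableAt (by simp))).symm

end

variable {𝔡 : Type*} [LieRing 𝔡] [LieAlgebra ℝ 𝔡] [FiniteDimensional ℝ 𝔡] [Subsingleton 𝔡]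
  {E : Type*} [NormedAddCommGroup E] [NormedSpace ℝ E] [FiniteDimensional ℝ E]
  {M : Type*} [TopologicalSpace M] [ChartedSpace E M] [IsManifold 𝓘(ℝ, E) ∞ M]
  {F : Type*} [NormedAddCommGroup F] [NormedSpace ℝ F] [FiniteDimensional ℝ F]
  {N : Type*} [TopologicalSpace N] [ChartedSpace F N] [IsManifold 𝓘(ℝ, F) ∞ N]
  {Q : QuadraticPairing 𝔡} {ρ : 𝔡 →ₗ[ℝ] Π n : N, TangentSpace 𝓘(ℝ, F) n}
  {𝔥 : LieSubalgebra ℝ 𝔡} {μ : M → N} {L : Π m : M, Submodule ℝ (CourantFibre 𝔡 E m)}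

/-- An exact fibre for the trivial quadratic Lie algebra is the graph of a bilinear map. -/
lemma IsExactFibre.exists_bilinear {A : Type*} [NormedAddCommGroup A] [NormedSpace ℝ A]
    [FiniteDimensional ℝ A] {B : Type*} [NormedAddCommGroup B] [NormedSpace ℝ B]
    [FiniteDimensional ℝ B] {r : 𝔡 →ₗ[ℝ] B} {D : A →L[ℝ] B}
    {L : Submodule ℝ (𝔡 × A × (A →L[ℝ] ℝ))} (h : IsExactFibre Q 𝔥 r D L) :
    ∃ σ : A →L[ℝ] A →L[ℝ] ℝ, ∀ z, z ∈ L ↔ z.2.2 = σ z.2.1 := by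
  -- The action map from the trivial Lie algebra is onto, so the target is zero and every vector
  -- satisfies the anchor condition.
  have hB : ∀ b b' : B, b = b' := fun b b' => by
    obtain ⟨x, rfl⟩ := h.surjective b
    obtain ⟨y, rfl⟩ := h.surjective b'
    rw [Subsingleton.elim x y]
  choose s hs using fun X : A => h.exists_covector (ξ := 0) (X := X) (hB _ _)
  have huniq : ∀ X α, ((0, X, α) : 𝔡 × A × (A →L[ℝ] ℝ)) ∈ L → α = s X :=
    fun X α hα => h.covector_unique hα (hs X)
  let σ : A →ₗ[ℝ] A →L[ℝ] ℝ :=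
    { toFun := s
      map_add' := fun X Y => (huniq _ _ (by simpa using L.add_mem (hs X) (hs Y))).symm
      map_smul' := fun c X => (huniq _ _ (by simpa using L.smul_mem c (hs X))).symm }
  refine ⟨LinearMap.toContinuousLinearMap σ, fun ⟨ζ, X, α⟩ => ?_⟩
  rw [Subsingleton.elim ζ 0]
  constructor
  · exact huniq X α
  · intro hα
    have hα' : α = s X := hα
    rw [hα']
    exact hs X

lemma IsSmoothVectorField.isSmoothSection_graph (hL : IsLagrangianOverGraph Q ρ μ L)
    {σ : Π m : M, TangentSpace 𝓘(ℝ, E) m →L[ℝ] TangentSpace 𝓘(ℝ, E) m →L[ℝ] ℝ}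
    (hσ : ∀ m (z : CourantFibre 𝔡 E m), z ∈ L m ↔ z.2.2 = σ m z.2.1)
    {X : Π m : M, TangentSpace 𝓘(ℝ, E) m} (hX : IsSmoothVectorField X) (m : M) :
    IsSmoothSectionAt 𝓘(ℝ, E) id (fun m => ((0, X m, σ m (X m)) : CourantFibre 𝔡 E m)) m :=
  hL.isSmoothSectionAt (Eventually.of_forall fun _ => (hσ _ _).2 rfl)
    (fun ℓ => by simpa using contMDiffAt_const) (hX m)

/-- A morphism of Manin pairs for the trivial quadratic Lie algebra whose fibres are graphs of
bilinear maps is the graph of a symplectic form. -/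
theorem IsManinPairMorphism.isSymplecticForm (hρ : ∀ ξ, IsSmoothVectorField (ρ ξ))
    (h : IsManinPairMorphism Q ρ 𝔥 μ L) (hL : IsLagrangianOverGraph Q ρ μ L)
    {σ : Π m : M, TangentSpace 𝓘(ℝ, E) m →L[ℝ] TangentSpace 𝓘(ℝ, E) m →L[ℝ] ℝ}
    (hσ : ∀ m (z : CourantFibre 𝔡 E m), z ∈ L m ↔ z.2.2 = σ m z.2.1) :
    IsSymplecticForm σ := by
  have hmem : ∀ (m : M) (X : TangentSpace 𝓘(ℝ, E) m), ((0, X, σ m X) : CourantFibre 𝔡 E m) ∈ L m :=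
    fun m X => (hσ m _).2 rfl
  -- Isotropy of the graph, with no contribution from the trivial algebra.
  have hskew : ∀ (m : M) (X Y : TangentSpace 𝓘(ℝ, E) m), σ m X Y = -σ m Y X := fun m X Y => by
    have h1 := hL.form_eq (hmem m X) (hmem m Y)
    have h2 : (0 : ℝ) = σ m X Y + σ m Y X := by simpa using h1
    linarith
  have hsm : ∀ X Y : Π m : M, TangentSpace 𝓘(ℝ, E) m,
      IsSmoothVectorField X → IsSmoothVectorField Y →
      ContMDiff 𝓘(ℝ, E) 𝓘(ℝ, ℝ) ∞ (fun m => σ m (X m) (Y m)) := fun X Y hX hY m =>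
    ContMDiffAt.cotangent_apply (hX.isSmoothSection_graph hL hσ m).covector (hY m)
  refine ⟨hsm, fun m v => ?_, fun m v hv => ?_, fun X Y Z hX hY hZ m => ?_⟩
  · have := hskew m v v
    linarith
  · refine h.ker_inter m v ((hσ m _).2 ?_)
    exact (ContinuousLinearMap.ext fun w => hv w).symm
  · let e : (Π m : M, TangentSpace 𝓘(ℝ, E) m) → Π q : N × M, CourantFibre 𝔡 E q.2 :=
      fun W q => (0, W q.2, σ q.2 (W q.2))
    have he : ∀ W, IsSmoothVectorField W →
        IsSmoothSection (𝓘(ℝ, F).prod 𝓘(ℝ, E)) Prod.snd (e W) := fun W hW =>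
      ⟨fun ℓ q => ((hW.isSmoothSection_graph hL hσ q.2).algebra ℓ).comp q contMDiffAt_snd,
        fun q => (hW.isSmoothSection_graph hL hσ q.2).vector.comp q contMDiffAt_snd,
        fun q => (hW.isSmoothSection_graph hL hσ q.2).covector.comp q contMDiffAt_snd⟩
    have hA : ∀ W, IsSmoothVectorField W → ∀ r : N × M,
        ContMDiffAt (𝓘(ℝ, F).prod 𝓘(ℝ, E)) (𝓘(ℝ, F).prod 𝓘(ℝ, E)).tangent ∞
        (fun r : N × M => (⟨r, courantAnchor ρ r.1 r.2 (e W r)⟩ :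
          TangentBundle (𝓘(ℝ, F).prod 𝓘(ℝ, E)) (N × M))) r := fun W hW r =>
      ContMDiffAt.tangentBundle_prodMk ((hρ 0 r.1).comp r contMDiffAt_fst)
        ((hW r.2).comp r contMDiffAt_snd)
    have hbr : ∀ W W', IsSmoothVectorField W → IsSmoothVectorField W' → ∀ r : N × M,
        ((VectorField.mlieBracket (𝓘(ℝ, F).prod 𝓘(ℝ, E)) (fun r => courantAnchor ρ r.1 r.2 (e W r))
          (fun r => courantAnchor ρ r.1 r.2 (e W' r)) r).2 : E) =
        VectorField.mlieBracket 𝓘(ℝ, E) W W' r.2 := fun W W' hW hW' r =>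
      mlieBracket_snd (hA W hW r) (hA W' hW' r) hW hW' (fun _ => rfl) (fun _ => rfl)
    have hdd : ∀ W W' W'', IsSmoothVectorField W → IsSmoothVectorField W' →
        dirDeriv (𝓘(ℝ, F).prod 𝓘(ℝ, E)) (fun r : N × M => (e W r).2.2 (e W' r).2.1) (μ m, m)
          (courantAnchor ρ (μ m) m (e W'' (μ m, m))) =
        dirDeriv 𝓘(ℝ, E) (fun m => σ m (W m) (W' m)) m (W'' m) := fun W W' W'' hW hW' =>
      dirDeriv_comp_snd (r := (μ m, m)) ((hsm W W' hW hW').mdifferentiable (by simp) m) _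
    have hQ : ∀ W (x : 𝔡) w, dirDeriv (𝓘(ℝ, F).prod 𝓘(ℝ, E))
        (fun r : N × M => Q.form (e W r).1 x) (μ m, m) w = 0 := fun W x w => by
      have h1 : (fun r : N × M => Q.form (e W r).1 x) = fun _ => 0 := by
        funext r
        simp [e]
      unfold dirDeriv
      rw [h1, mfderiv_const]
      rfl
    -- For the sections `(0, W, σ W)` the bracket pairing is, up to sign and the skewness of `σ`,
    -- the exterior derivative of `σ`; all terms with `Q` vanish.
    have key := h.dirac.involutive (e X) (e Y) (e Z) (he X hX) (he Y hY) (he Z hZ)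
      (fun m => hmem m _) (fun m => hmem m _) (fun m => hmem m _) m
    have h12 := congrArg (σ m (Z m)) (hbr X Y hX hY (μ m, m))
    have h13 := congrArg (σ m (Y m)) (hbr X Z hX hZ (μ m, m))
    have h23 := congrArg (σ m (X m)) (hbr Y Z hY hZ (μ m, m))
    have d1 := hdd Y Z X hY hZ
    have d2 := hdd X Z Y hX hZ
    have d3 := hdd X Y Z hX hY
    have q1 := hQ Y (e Z (μ m, m)).1 (courantAnchor ρ (μ m) m (e X (μ m, m)))
    have q2 := hQ X (e Z (μ m, m)).1 (courantAnchor ρ (μ m) m (e Y (μ m, m)))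
    have q3 := hQ X (e Y (μ m, m)).1 (courantAnchor ρ (μ m) m (e Z (μ m, m)))
    have q0 : Q.form ⁅(e X (μ m, m)).1, (e Y (μ m, m)).1⁆ (e Z (μ m, m)).1 = 0 := by simp [e]
    have key' : 0 + 0 - 0 + 0 - (σ m (Z m) (VectorField.mlieBracket 𝓘(ℝ, E) X Y m)
        + (dirDeriv 𝓘(ℝ, E) (fun r => σ r (Y r) (Z r)) m (X m)
          - σ m (Y m) (VectorField.mlieBracket 𝓘(ℝ, E) X Z m))
        - (dirDeriv 𝓘(ℝ, E) (fun r => σ r (X r) (Z r)) m (Y m)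
          - dirDeriv 𝓘(ℝ, E) (fun r => σ r (X r) (Y r)) m (Z m)
          - σ m (X m) (VectorField.mlieBracket 𝓘(ℝ, E) Y Z m))) = 0 := (congrArg₂ (· - ·) (congrArg₂ (· + ·) (congrArg₂ (· - ·) (congrArg₂ (· + ·) q0 q1) q2) q3)
      (congrArg₂ (· - ·) (congrArg₂ (· + ·) h12 (congrArg₂ (· - ·) d1 h13))
        (congrArg₂ (· - ·) (congrArg₂ (· - ·) d2 d3) h23))).symm.trans key
    have hd2 : dirDeriv 𝓘(ℝ, E) (fun r => σ r (Z r) (X r)) m (Y m) =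
        -dirDeriv 𝓘(ℝ, E) (fun r => σ r (X r) (Z r)) m (Y m) := by
      have h1 : (fun r => σ r (Z r) (X r)) = -fun r => σ r (X r) (Z r) := funext fun r => hskew r _ _
      unfold dirDeriv
      rw [h1, mfderiv_neg]
      rfl
    have hb : VectorField.mlieBracket 𝓘(ℝ, E) X Z m = -VectorField.mlieBracket 𝓘(ℝ, E) Z X m :=
      VectorField.mlieBracket_swap_apply
    have s12 := hskew m (Z m) (VectorField.mlieBracket 𝓘(ℝ, E) X Y m)
    have s13 := hskew m (Y m) (VectorField.mlieBracket 𝓘(ℝ, E) X Z m)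
    have s13' : (σ m (VectorField.mlieBracket 𝓘(ℝ, E) X Z m)) (Y m) =
      -(σ m (VectorField.mlieBracket 𝓘(ℝ, E) Z X m)) (Y m) := by
      rw [hb, map_neg]
      rfl
    have s23 := hskew m (X m) (VectorField.mlieBracket 𝓘(ℝ, E) Y Z m)
    linarith

end SymplecticReduction

/-! ### The reduction theorem. -/

theorem mainTheorem2
    {𝔡 : Type*} [LieRing 𝔡] [LieAlgebra ℝ 𝔡] [FiniteDimensional ℝ 𝔡]
    (Q : QuadraticPairing 𝔡) (𝔥 𝔠 : LieSubalgebra ℝ 𝔡)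
    -- the manifolds `M` and `N`
    {E : Type*} [NormedAddCommGroup E] [NormedSpace ℝ E] [FiniteDimensional ℝ E]
    {M : Type*} [TopologicalSpace M] [T2Space M] [SecondCountableTopology M]
    [ChartedSpace E M] [IsManifold 𝓘(ℝ, E) ∞ M]
    {F : Type*} [NormedAddCommGroup F] [NormedSpace ℝ F] [FiniteDimensional ℝ F]
    {N : Type*} [TopologicalSpace N] [T2Space N] [SecondCountableTopology N]
    [ChartedSpace F N] [IsManifold 𝓘(ℝ, F) ∞ N]
    -- the preimage `P = μ⁻¹(S)` and the submanifold `S` of `N`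
    {E₁ : Type*} [NormedAddCommGroup E₁] [NormedSpace ℝ E₁] [FiniteDimensional ℝ E₁]
    {P : Type*} [TopologicalSpace P] [T2Space P] [SecondCountableTopology P]
    [ChartedSpace E₁ P] [IsManifold 𝓘(ℝ, E₁) ∞ P]
    {F₁ : Type*} [NormedAddCommGroup F₁] [NormedSpace ℝ F₁] [FiniteDimensional ℝ F₁]
    {S : Type*} [TopologicalSpace S] [T2Space S] [SecondCountableTopology S]
    [ChartedSpace F₁ S] [IsManifold 𝓘(ℝ, F₁) ∞ S]
    -- the quotients `M'` of `P` and `N'` of `S`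
    {E₂ : Type*} [NormedAddCommGroup E₂] [NormedSpace ℝ E₂] [FiniteDimensional ℝ E₂]
    {M' : Type*} [TopologicalSpace M'] [T2Space M'] [SecondCountableTopology M']
    [ChartedSpace E₂ M'] [IsManifold 𝓘(ℝ, E₂) ∞ M']
    {F₂ : Type*} [NormedAddCommGroup F₂] [NormedSpace ℝ F₂] [FiniteDimensional ℝ F₂]
    {N' : Type*} [TopologicalSpace N'] [T2Space N'] [SecondCountableTopology N']
    [ChartedSpace F₂ N'] [IsManifold 𝓘(ℝ, F₂) ∞ N']
    (ρ : 𝔡 →ₗ[ℝ] Π n : N, TangentSpace 𝓘(ℝ, F) n)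
    (hpair : IsActionManinPair Q ρ 𝔥)
    (μ : M → N) (L : Π m : M, Submodule ℝ (CourantFibre 𝔡 E m))
    (hL : IsManinPairMorphism Q ρ 𝔥 μ L)
    (iN : S → N) (qN : S → N') (iM : P → M) (j : P → S) (qM : P → M')
    (hred : IsReductiveData (E := E) (F := F) (E₁ := E₁) (F₁ := F₁) (E₂ := E₂) (F₂ := F₂)
      Q ρ 𝔥 μ L 𝔠 iN qN iM j qM)
    (htrans : IsTransitiveOn (F := F) (F₁ := F₁) ρ 𝔠 iN)
    (hexact : IsExactOnGraph Q ρ μ L) :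
    ∃ (ρ' : Q.Reduced 𝔠 →ₗ[ℝ] Π n : N', TangentSpace 𝓘(ℝ, F₂) n) (μ' : M' → N')
      (L' : Π m : M', Submodule ℝ (CourantFibre (Q.Reduced 𝔠) E₂ m)),
      -- `ρ'` is the action of `𝔠 / 𝔠^⊥` on `N'` induced by the action of `𝔠` on `S`
      (∀ (ξ : 𝔠) (s : S) (v : TangentSpace 𝓘(ℝ, F₁) s),
        mfderiv 𝓘(ℝ, F₁) 𝓘(ℝ, F) iN s v = ρ (ξ : 𝔡) (iN s) →
          ρ' (Q.proj 𝔠 ξ) (qN s) = mfderiv 𝓘(ℝ, F₁) 𝓘(ℝ, F₂) qN s v) ∧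
      IsActionManinPair (Q.reduce 𝔠) ρ' (Q.reduceSubalgebra 𝔠 𝔥) ∧
      -- `μ'` is induced by `μ`
      (∀ p, μ' (qM p) = qN (j p)) ∧
      -- the reduced relation is `L'`, supported on the graph of `μ'`
      reducedRel (E := E) (E₁ := E₁) (E₂ := E₂) Q μ L 𝔠 iN qN iM qM = graphRel μ' L' ∧
      IsManinPairMorphism (Q.reduce 𝔠) ρ' (Q.reduceSubalgebra 𝔠 𝔥) μ' L' ∧
      IsExactOnGraph (Q.reduce 𝔠) ρ' μ' L' ∧
      -- if `𝔠` is Lagrangian, then the reduced relation is the graph of a symplectic form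
      (Q.IsLagrangian 𝔠 →
        ∃ σ : Π m : M', TangentSpace 𝓘(ℝ, E₂) m →L[ℝ] TangentSpace 𝓘(ℝ, E₂) m →L[ℝ] ℝ,
          IsSymplecticForm σ ∧
          ∀ m (z : CourantFibre (Q.Reduced 𝔠) E₂ m), z ∈ L' m ↔ z.2.2 = σ m z.2.1) := by

  have h : IsExactReduction E F E₁ F₁ E₂ F₂ Q ρ 𝔥 μ L 𝔠 iN qN iM j qM :=
    ⟨hpair, hL, hred, htrans, hexact⟩
  obtain ⟨ρ', hρ'⟩ := h.isReducibleAction.exists_quotientAction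
  obtain ⟨μ', hμ', hμq⟩ := h.exists_quotientMap
  obtain ⟨L', hL'⟩ := h.exists_reduction hρ' hμ' hμq
  have hsmooth := h.isReducibleAction.quotientAction_smooth hρ'
  have hmorph := h.isManinPairMorphism_reduction hρ' hμ' hμq hL'
  refine ⟨ρ', μ', L', hρ',
    ⟨h.isReducibleAction.quotientAction_isLieAlgebraAction hρ',
      h.isReducibleAction.quotientAction_coisotropic hρ' hpair.coisotropic,
      h.isReducibleAction.reduceSubalgebra_isLagrangian hpair.lagrangian⟩,
    hμq, h.reducedRel_eq_graphRel hμq hL', hmorph, h.isExactOnGraph_reduction hρ' hμ' hμq hL',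
    fun h𝔠 => ?_⟩
  have : Subsingleton (Q.Reduced 𝔠) := by
    refine subsingleton_of_forall_eq 0 fun ζ => ?_
    obtain ⟨ξ, rfl⟩ := Q.proj_surjective 𝔠 ζ
    have hξ : (ξ : 𝔡) ∈ Q.form.orthogonal 𝔠.toSubmodule := by
      rw [h𝔠]
      exact ξ.2
    exact Q.proj_eq_zero 𝔠 ξ fun y => hξ y y.2
  choose σ hσ using fun m => (h.isExactFibre_reduction hρ' hμ' hμq hL' m).exists_bilinear
  exact ⟨σ, hmorph.isSymplecticForm hsmooth (h.isLagrangianOverGraph_reduction hρ' hμ' hμq hL') hσ, hσ⟩
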